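/- **Theorem 1 (Point symmetries of static CGL and MHD equations).** For a first-order system $E(\mathbf x,\mathbf u,\mathbf u_1)=0$ with independent variables $\mathbf x=(x_1,x_2,x_3)$ and dependent variables $\mathbf u=(u^1,\dots,u^m)$, and an open connected nonempty set $M\subseteq\mathbb R^3\times\mathbb R^m$, a generator of Lie point symmetries on $M$ is a $C^\infty$ vector field $X=\sum_i\xi^i(\mathbf x,\mathbf u)\partial_{x_i}+\sum_k\eta^k(\mathbf x,\mathbf u)\partial_{u^k}$ on $M$ whose first prolongation $$\mathrm{pr}\,X=X+\sum_{i,k}\Big(D_i\eta^k-\sum_a u^k_a D_i\xi^a\Big)\partial_{u^k_i},\qquad D_i=\partial_{x_i}+\sum_l u^l_i\,\partial_{u^l},$$ satisfies $(\mathrm{pr}\,X)E=0$ at every jet $(\mathbf x,\mathbf u,\mathbf u_1)$ with $(\mathbf x,\mathbf u)\in M$ and $E(\mathbf x,\mathbf u,\mathbf u_1)=0$. Consider the following operators, where $\mathbf B=(B_1,B_2,B_3)$ and $\mathbf B^2=B_1^2+B_2^2+B_3^2$: - translations $X_{trans}=\sum_{i=1}^3K_i\partial_{x_i}+K_4\partial_{p_\perp}$,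 with $K_1,\dots,K_4\in\mathbb R$; - rotations $X_{rot}=(cB_2+dB_3)\partial_{B_1}+(-cB_1-bB_3)\partial_{B_2}+(-dB_1+bB_2)\partial_{B_3}+(cx_2+dx_3)\partial_{x_1}+(-cx_1-bx_3)\partial_{x_2}+(-dx_1+bx_2)\partial_{x_3}$, with $b,c,d\in\mathbb R$; - scalings $X^{(1)}_{scal}=\sum_i x_i\partial_{x_i}$, $\;X^{(2)}_{scal}=\sum_i B_i\partial_{B_i}+2p_\perp\partial_{p_\perp}$, $\;X^{(3)}_{scal}=\big(p_\perp+\tfrac{\mathbf B^2}{2}\big)\partial_{p_\perp}-(1-\tau)\partial_\tau$. (i) Let $M\subseteq\mathbb R^3\times\mathbb R^5$ be open, connected and nonempty. For the general static CGL equilibrium system $$(1-\tau)\,\mathrm{curl}\,\mathbf B\times\mathbf B=\mathrm{grad}\,p_\perp+\tau\,\mathrm{grad}\tfrac{\mathbf B^2}{2}+\mathbf B(\mathbf B\cdot\mathrm{grad}\,\tau),\qquad \mathrm{div}\,\mathbf B=0,$$ with $\mathbf u=(B_1,B_2,B_3,p_\perp,\tau)$, the generators of Lie point symmetries on $M$ form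 a real vector space with the basis consisting of the ten operators: four translations $\partial_{x_1},\partial_{x_2},\partial_{x_3},\partial_{p_\perp}$, three rotations $X_{rot}$ with $(b,c,d)=(1,0,0),(0,1,0),(0,0,1)$, and $X^{(1)}_{scal},X^{(2)}_{scal},X^{(3)}_{scal}$. (ii) Let $M\subseteq\mathbb R^3\times\mathbb R^5$ be open, connected and nonempty, and add to the system of (i) the equation of state $\mathbf B\cdot\mathrm{grad}\,\tau=0$. Then the ten operators of (i) and all the operators $$X_\infty=F\big(\tau,\,p_\perp+\tfrac{\tau\mathbf B^2}{2}\big)\Big(\sum_iB_i\partial_{B_i}+2(1-\tau)\partial_\tau-\mathbf B^2\partial_{p_\perp}\Big),$$ where $F$ is an arbitrary $C^\infty$ function on the (open) set of values taken on $M$ by $(\tau,\,p_\perp+\tau\mathbf B^2/2)$, are, together with their linear combinations, generators of Lie point symmetries on $M$, and the operators $X_\infty$ span an infinite-dimensional space. If moreover every level set of $(\tau,\,p_\perp+\tau\mathbf B^2/2)$ in $M$ is connected or empty (in particular if $M$ is the whole space), then every generator on $M$ is a linear combination of these operators. (iii) Let $M\subseteq\mathbb R^3\times\mathbb R^4$ be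 open, connected and nonempty. For the static MHD equilibrium system $\mathrm{curl}\,\mathbf B\times\mathbf B=\mathrm{grad}\,P$, $\mathrm{div}\,\mathbf B=0$, with $\mathbf u=(B_1,B_2,B_3,P)$, the generators of Lie point symmetries on $M$ form a real vector space with the basis consisting of the nine operators: four translations, three rotations, $X^{(1)}_{scal}$ and $X^{(2)}_{scal}$ as above with $p_\perp$ replaced by $P$. In particular it is finite-dimensional: there are no infinite symmetries. -/

import Mathlib

open scoped ContDiff

noncomputable section

/-! ### Lie point symmetries of first order systems -/

/-- The space `X × U` of `n` independent variables `x` and `m` dependent variables `u`. -/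
abbrev Base (n m : ℕ) : Type := (Fin n → ℝ) × (Fin m → ℝ)

/-- The first jet space `X × U × U₁`. In a jet `j = ((x, u), w)` the number `w k i` is the
coordinate that stands for `∂ u^k / ∂ x^i`. -/
abbrev Jet (n m : ℕ) : Type := Base n m × (Fin m → Fin n → ℝ)

/-- The total derivative `D_i g = ∂g/∂x^i + ∑ₗ (∂u^l/∂x^i) ∂g/∂u^l` of a function on `X × U`. -/
def totalDeriv {n m : ℕ} (g : Base n m → ℝ) (i : Fin n) (j : Jet n m) : ℝ :=
  fderiv ℝ g j.1 (Pi.single i 1, fun l => j.2 l i)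

/-- First prolongation of the vector field `v = ∑ ξ^i ∂/∂x^i + ∑ η^k ∂/∂u^k` to the jet space;
the component along `∂/∂u^k_i` is `D_i η^k - ∑ₐ u^k_a D_i ξ^a`. -/
def prolong {n m : ℕ} (v : Base n m → Base n m) (j : Jet n m) : Jet n m :=
  (v j.1, fun k i =>
    totalDeriv (fun z => (v z).2 k) i j
      - ∑ a : Fin n, j.2 k a * totalDeriv (fun z => (v z).1 a) i j)

/-- `v` is a smooth vector field on the open set `M ⊆ X × U` whose prolongation annihilates the
system `E = 0` at every jet over `M` that satisfies `E = 0`. -/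
def IsPointSymmetry {n m l : ℕ} (E : Jet n m → Fin l → ℝ) (M : Set (Base n m))
    (v : Base n m → Base n m) : Prop :=
  ContDiffOn ℝ ∞ v M ∧ ∀ j : Jet n m, j.1 ∈ M → E j = 0 → fderiv ℝ E j (prolong v j) = 0

/-- The generators of Lie point symmetries of `E = 0`, as vector fields on the open set `M`. -/
def symmetryGenerators {n m l : ℕ} (E : Jet n m → Fin l → ℝ) (M : Set (Base n m)) :
    Set (M → Base n m) :=
  {w | ∃ v : Base n m → Base n m, IsPointSymmetry E M v ∧ w = M.domRestrict v}

/-! ### Vector calculus in jet coordinates; `b k i` stands for `∂ B_k / ∂ x_i` -/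

def jetCurl (b : Fin 3 → Fin 3 → ℝ) : Fin 3 → ℝ :=
  ![b 2 1 - b 1 2, b 0 2 - b 2 0, b 1 0 - b 0 1]

def jetDiv (b : Fin 3 → Fin 3 → ℝ) : ℝ := b 0 0 + b 1 1 + b 2 2

/-- The gradient of `B² / 2`. -/
def jetGradHalfSq (B : Fin 3 → ℝ) (b : Fin 3 → Fin 3 → ℝ) : Fin 3 → ℝ :=
  fun i => ∑ k, B k * b k i

/-! ### The static MHD system, `u = (B₁, B₂, B₃, P)` -/

/-- `curl B × B - grad P = 0`, `div B = 0`. -/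
def mhdSystem (j : Jet 3 4) : Fin 4 → ℝ :=
  let B : Fin 3 → ℝ := ![j.1.2 0, j.1.2 1, j.1.2 2]
  let dB : Fin 3 → Fin 3 → ℝ := ![j.2 0, j.2 1, j.2 2]
  let gradP : Fin 3 → ℝ := j.2 3
  let e : Fin 3 → ℝ := crossProduct (jetCurl dB) B - gradP
  ![e 0, e 1, e 2, jetDiv dB]

/-! ### The static CGL systems, `u = (B₁, B₂, B₃, p⊥, τ)` -/

/-- `(1 - τ) curl B × B - grad p⊥ - τ grad (B²/2) - B (B · grad τ)`. -/
def cglForce (j : Jet 3 5) : Fin 3 → ℝ :=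
  let B : Fin 3 → ℝ := ![j.1.2 0, j.1.2 1, j.1.2 2]
  let τ : ℝ := j.1.2 4
  let dB : Fin 3 → Fin 3 → ℝ := ![j.2 0, j.2 1, j.2 2]
  let gradp : Fin 3 → ℝ := j.2 3
  let gradτ : Fin 3 → ℝ := j.2 4
  (1 - τ) • crossProduct (jetCurl dB) B
    - (gradp + τ • jetGradHalfSq B dB + (B ⬝ᵥ gradτ) • B)

/-- The general static CGL system: force balance and `div B = 0`. -/
def cglSystem (j : Jet 3 5) : Fin 4 → ℝ :=
  ![cglForce j 0, cglForce j 1, cglForce j 2, jetDiv ![j.2 0, j.2 1, j.2 2]]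

/-- The static CGL system closed with the equation of state `B · grad τ = 0`. -/
def cglStateSystem (j : Jet 3 5) : Fin 5 → ℝ :=
  ![cglForce j 0, cglForce j 1, cglForce j 2, jetDiv ![j.2 0, j.2 1, j.2 2],
    ![j.1.2 0, j.1.2 1, j.1.2 2] ⬝ᵥ j.2 4]

/-! ### The generators -/

/-- The infinitesimal rotation of `ℝ³` with parameters `b, c, d`. -/
def infRot (b c d : ℝ) (y : Fin 3 → ℝ) : Fin 3 → ℝ :=
  ![c * y 1 + d * y 2, -c * y 0 - b * y 2, -d * y 0 + b * y 1]

namespace MHD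

def transX (i : Fin 3) : Base 3 4 → Base 3 4 := fun _ => (Pi.single i 1, 0)

def transP : Base 3 4 → Base 3 4 := fun _ => (0, ![0, 0, 0, 1])

def rot (b c d : ℝ) : Base 3 4 → Base 3 4 := fun z =>
  let r := infRot b c d ![z.2 0, z.2 1, z.2 2]
  (infRot b c d z.1, ![r 0, r 1, r 2, 0])

def scal₁ : Base 3 4 → Base 3 4 := fun z => (z.1, 0)

def scal₂ : Base 3 4 → Base 3 4 := fun z => (0, ![z.2 0, z.2 1, z.2 2, 2 * z.2 3])

def generators : Fin 9 → Base 3 4 → Base 3 4 :=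
  ![transX 0, transX 1, transX 2, transP, rot 1 0 0, rot 0 1 0, rot 0 0 1, scal₁, scal₂]

end MHD

namespace CGL

/-- `B² = B₁² + B₂² + B₃²`. -/
def magSq (z : Base 3 5) : ℝ := z.2 0 ^ 2 + z.2 1 ^ 2 + z.2 2 ^ 2

def transX (i : Fin 3) : Base 3 5 → Base 3 5 := fun _ => (Pi.single i 1, 0)

def transP : Base 3 5 → Base 3 5 := fun _ => (0, ![0, 0, 0, 1, 0])

def rot (b c d : ℝ) : Base 3 5 → Base 3 5 := fun z =>
  let r := infRot b c d ![z.2 0, z.2 1, z.2 2]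
  (infRot b c d z.1, ![r 0, r 1, r 2, 0, 0])

def scal₁ : Base 3 5 → Base 3 5 := fun z => (z.1, 0)

def scal₂ : Base 3 5 → Base 3 5 := fun z => (0, ![z.2 0, z.2 1, z.2 2, 2 * z.2 3, 0])

def scal₃ : Base 3 5 → Base 3 5 := fun z =>
  (0, ![0, 0, 0, z.2 3 + magSq z / 2, -(1 - z.2 4)])

def generators : Fin 10 → Base 3 5 → Base 3 5 :=
  ![transX 0, transX 1, transX 2, transP, rot 1 0 0, rot 0 1 0, rot 0 0 1, scal₁, scal₂, scal₃]

/-- The pair `(τ, p⊥ + τ B² / 2)`. -/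
def stateInv (z : Base 3 5) : ℝ × ℝ := (z.2 4, z.2 3 + z.2 4 * magSq z / 2)

/-- `F(τ, p⊥ + τ B²/2) (∑ B_i ∂/∂B_i + 2 (1 - τ) ∂/∂τ - B² ∂/∂p⊥)`. -/
def xInf (F : ℝ × ℝ → ℝ) : Base 3 5 → Base 3 5 := fun z =>
  F (stateInv z) • ((0, ![z.2 0, z.2 1, z.2 2, -magSq z, 2 * (1 - z.2 4)]) : Base 3 5)

/-- The vector fields `xInf F` on `M`, with `F` smooth on the set of values of its arguments
(an open subset of the plane when `M` is open). -/
def infFields (M : Set (Base 3 5)) : Set (M → Base 3 5) :=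
  {w | ∃ F : ℝ × ℝ → ℝ, ContDiffOn ℝ ∞ F (stateInv '' M) ∧ w = M.domRestrict (xInf F)}

end CGL

end

/-! With `Q = p⊥ + B²/2` and `σ = 1 - τ` the force balance reads `grad Q = σ (B·∇)B + (B·∇σ) B`. The
closed system adds `B·∇σ = 0`, and static MHD is the case `σ = 1`. One analysis in the coordinates
`(x, B, Q, σ)` therefore serves all three systems: a field has components `ξ, β, ρ, κ` along `x, B,
Q, σ`, and `FieldFrame` axiomatizes the algebra of smooth functions with the commuting derivations
along these coordinates.

Testing the symmetry condition on jets with one or two nonzero entries of `∂B` gives the determining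
equations (`Balanced.determining`). The part of `div B = 0` quadratic in the jet shows that `ξ` does
not depend on `B` and `Q`. The linear parts show that `β = (∂ξ)B + lB` for a scalar `l`, that `ξ` is
a conformal Killing field, and that `κ = σ(∂ρ/∂Q - 2 ∂ξ₁/∂x₁ - 2l)`. The force equation at the zero
jet excludes special conformal fields, so `ξ` is affine (`Determining.affine`), and `ρ` turns out to
be affine in `Q`.

All remaining freedom lies in `l`, which satisfies `∂l/∂B_i = -σ B_i ∂l/∂Q`: it depends on `B` and
`Q` only through `Q - σB²/2 = p⊥ + τB²/2`. In MHD, `κ = 0` forces `l` to be constant. In the general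
CGL system, jets with `B·∇σ ≠ 0` give a second equation for `l`, whose compatibility with the first
makes `l` constant. In the closed system `l` may be any function that is locally a function of `(τ,
p⊥ + τB²/2)`; this is the family `X_∞`, and connected level sets make the dependence global.

Conversely, `Solved.divRes_eq`, `Solved.forceRes_eq` and `Solved.stateRes_eq` express the prolonged
action of any such field through the equations themselves, so these fields are symmetries. Constants
of integration match the coefficients of the listed generators. -/

noncomputable section

/-! ### The algebra of smooth functions on an open set and its derivations -/

section SmoothFun

variable {V : Type*} [NormedAddCommGroup V] [NormedSpace ℝ V] {M : Set V}

/-- The smooth functions on `M`. -/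
def smoothFun (M : Set V) : Subalgebra ℝ (M → ℝ) where
  carrier := {f | ∃ g : V → ℝ, ContDiffOn ℝ ∞ g M ∧ f = M.domRestrict g}
  mul_mem' := by
    rintro _ _ ⟨g, hg, rfl⟩ ⟨g', hg', rfl⟩
    exact ⟨fun z => g z * g' z, hg.mul hg', rfl⟩
  add_mem' := by
    rintro _ _ ⟨g, hg, rfl⟩ ⟨g', hg', rfl⟩
    exact ⟨fun z => g z + g' z, hg.add hg', rfl⟩
  algebraMap_mem' r := ⟨fun _ => r, contDiffOn_const, rfl⟩

namespace smoothFun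

/-- The restriction to `M` of a function which is smooth on `M`. -/
def mk (g : V → ℝ) (hg : ContDiffOn ℝ ∞ g M) : smoothFun M := ⟨M.domRestrict g, g, hg, rfl⟩

@[simp] lemma mk_apply (g : V → ℝ) (hg : ContDiffOn ℝ ∞ g M) (z : M) :
    (mk g hg).1 z = g z := rfl

/-- A function on the whole space that restricts to `f`. -/
def extension (f : smoothFun M) : V → ℝ := f.2.choose

lemma contDiffOn_extension (f : smoothFun M) : ContDiffOn ℝ ∞ (extension f) M :=
  f.2.choose_spec.1

lemma extension_apply (f : smoothFun M) (z : M) : (extension f) z = f.1 z :=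
  (congrFun f.2.choose_spec.2 z).symm

/-- An extension is an arbitrary choice off `M`; since `M` is open, derivatives at points of `M` do
not see that choice. -/
lemma fderiv_congr_on (hM : IsOpen M) {g g' : V → ℝ} (h : ∀ z ∈ M, g z = g' z) {z : V}
    (hz : z ∈ M) : fderiv ℝ g z = fderiv ℝ g' z :=
  Filter.EventuallyEq.fderiv_eq (Filter.eventually_of_mem (hM.mem_nhds hz) h)

lemma differentiableAt_extension (hM : IsOpen M) (f : smoothFun M) (z : M) :
    DifferentiableAt ℝ (extension f) z :=
  ((contDiffOn_extension f).contDiffAt (hM.mem_nhds z.2)).differentiableAt (by simp)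

/-- The derivative in direction `v`, as a derivation of the algebra of smooth functions. -/
def dir (hM : IsOpen M) (v : V) : Derivation ℝ (smoothFun M) (smoothFun M) :=
  Derivation.mk'
    { toFun := fun f => mk (fun z => fderiv ℝ (extension f) z v)
        (((contDiffOn_extension f).fderiv_of_isOpen hM (by simp)).clm_apply contDiffOn_const)
      map_add' := fun f g => by
        ext z
        have h : fderiv ℝ (extension (f + g)) z
            = fderiv ℝ (fun y => (extension f) y + (extension g) y) z :=
          fderiv_congr_on hM (fun y hy => by
            rw [extension_apply _ ⟨y, hy⟩, extension_apply _ ⟨y, hy⟩, extension_apply _ ⟨y, hy⟩]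
            rfl) z.2
        change fderiv ℝ (extension (f + g)) z v
          = fderiv ℝ (extension f) z v + fderiv ℝ (extension g) z v
        rw [h, fderiv_fun_add (differentiableAt_extension hM f z)
          (differentiableAt_extension hM g z)]
        rfl
      map_smul' := fun c f => by
        ext z
        have h : fderiv ℝ (extension (c • f)) z = fderiv ℝ (fun y => c • (extension f) y) z :=
          fderiv_congr_on hM (fun y hy => by
            rw [extension_apply _ ⟨y, hy⟩, extension_apply _ ⟨y, hy⟩]
            rfl) z.2
        change fderiv ℝ (extension (c • f)) z v = c • fderiv ℝ (extension f) z v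
        rw [h, fderiv_fun_const_smul (differentiableAt_extension hM f z)]
        rfl }
    (fun f g => by
      ext z
      have h : fderiv ℝ (extension (f * g)) z
          = fderiv ℝ (fun y => (extension f) y * (extension g) y) z :=
        fderiv_congr_on hM (fun y hy => by
          rw [extension_apply _ ⟨y, hy⟩, extension_apply _ ⟨y, hy⟩, extension_apply _ ⟨y, hy⟩]
          rfl) z.2
      change fderiv ℝ (extension (f * g)) z v
        = f.1 z * fderiv ℝ (extension g) z v + g.1 z * fderiv ℝ (extension f) z v
      rw [h, fderiv_fun_mul (differentiableAt_extension hM f z)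
        (differentiableAt_extension hM g z), ← extension_apply, ← extension_apply]
      rfl)

lemma dir_apply (hM : IsOpen M) (v : V) (f : smoothFun M) (z : M) :
    (dir hM v f).1 z = fderiv ℝ (extension f) z v := rfl

lemma dir_apply_of_eq (hM : IsOpen M) (v : V) {f : smoothFun M} {g : V → ℝ}
    (h : ∀ z : M, f.1 z = g z) (z : M) : (dir hM v f).1 z = fderiv ℝ g z v := by
  rw [dir_apply, fderiv_congr_on hM (fun y hy => ?_) z.2]
  rw [extension_apply _ ⟨y, hy⟩, h ⟨y, hy⟩]

@[simp] lemma dir_mk_apply (hM : IsOpen M) (v : V) (g : V → ℝ) (hg : ContDiffOn ℝ ∞ g M) (z : M) :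
    (dir hM v (mk g hg)).1 z = fderiv ℝ g z v :=
  dir_apply_of_eq hM v (fun _ => rfl) z

lemma dir_comm (hM : IsOpen M) (v w : V) (f : smoothFun M) :
    dir hM v (dir hM w f) = dir hM w (dir hM v f) := by
  ext z
  have key : ∀ a b : V, (dir hM a (dir hM b f)).1 z
      = fderiv ℝ (fderiv ℝ (extension f)) z a b := fun a b => by
    rw [dir_apply_of_eq hM a (g := fun y => fderiv ℝ (extension f) y b)
      (fun y => dir_apply hM b f y)]
    have hd : DifferentiableAt ℝ (fderiv ℝ (extension f)) z :=
      (((contDiffOn_extension f).fderiv_of_isOpen (m := ∞) hM (by simp)).contDiffAt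
        (hM.mem_nhds z.2)).differentiableAt (by simp)
    rw [fderiv_clm_apply hd (differentiableAt_const b)]
    simp
  rw [key, key]
  have hs : IsSymmSndFDerivAt ℝ (extension f) (z : V) :=
    ((contDiffOn_extension f).contDiffAt (hM.mem_nhds z.2)).isSymmSndFDerivAt (by
      simpa using WithTop.coe_le_coe.2 (le_top : (2 : ℕ∞) ≤ ⊤))
  exact hs v w

/-- A smooth function on a connected open set whose derivatives vanish is constant. -/
lemma exists_eq_algebraMap (hM : IsOpen M) (hc : IsConnected M) (f : smoothFun M)
    (h : ∀ v, dir hM v f = 0) : ∃ c : ℝ, f = algebraMap ℝ (smoothFun M) c := by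
  obtain ⟨c, hc⟩ := hM.exists_is_const_of_fderiv_eq_zero hc.isPreconnected
    (f := (extension f)) (fun z hz =>
      (differentiableAt_extension hM f ⟨z, hz⟩).differentiableWithinAt) (fun z hz => by
      ext v
      exact congrFun (congrArg Subtype.val (h v)) ⟨z, hz⟩)
  refine ⟨c, ?_⟩
  ext z
  rw [← extension_apply, hc z z.2]
  rfl

/-- A function whose derivative in some direction is a nonzero constant is not a zero divisor. -/
lemma eq_zero_of_mul_eq_zero (hM : IsOpen M) (f g : smoothFun M) {v : V} {c : ℝ} (hc : c ≠ 0)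
    (hf : ∀ (z : V) (t : ℝ) (h : z ∈ M) (h' : z + t • v ∈ M),
      f.1 ⟨z + t • v, h'⟩ = f.1 ⟨z, h⟩ + t * c)
    (h : ∀ z, f.1 z * g.1 z = 0) : g = 0 := by
  ext ⟨z, hz⟩
  change g.1 ⟨z, hz⟩ = 0
  by_contra hne
  -- If `g z ≠ 0`, then `g` is nonzero near `z`, so `f` vanishes at `z` and at `z + t • v` for small
  -- `t ≠ 0`, although its values there differ by `t * c`. Thus `B_k` and `σ` can be cancelled even
  -- when `M` meets their zero sets.
  have hcont : ContinuousAt (extension g) z := (differentiableAt_extension hM g ⟨z, hz⟩).continuousAt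
  have hpath : Filter.Tendsto (fun t : ℝ => z + t • v) (nhdsWithin 0 {0}ᶜ) (nhds z) := by
    have : Continuous (fun t : ℝ => z + t • v) := by fun_prop
    simpa using (this.tendsto 0).mono_left nhdsWithin_le_nhds
  have h1 : ∀ᶠ t in nhdsWithin (0 : ℝ) {0}ᶜ, z + t • v ∈ M := hpath (hM.mem_nhds hz)
  have h2 : ∀ᶠ t in nhdsWithin (0 : ℝ) {0}ᶜ, (extension g) (z + t • v) ≠ 0 :=
    (hcont.tendsto.comp hpath).eventually_ne (by rwa [extension_apply g ⟨z, hz⟩])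
  have hz0 : f.1 ⟨z, hz⟩ = 0 := (mul_eq_zero.1 (h ⟨z, hz⟩)).resolve_right hne
  have h3 : ∀ᶠ t in nhdsWithin (0 : ℝ) {0}ᶜ, t ∈ ({0}ᶜ : Set ℝ) := self_mem_nhdsWithin
  obtain ⟨t, ht, ht', ht0⟩ := (h1.and (h2.and h3)).exists
  rw [extension_apply g ⟨_, ht⟩] at ht'
  have := (mul_eq_zero.1 (h ⟨_, ht⟩)).resolve_right ht'
  rw [hf z t hz ht, hz0, zero_add] at this
  exact (mul_ne_zero ht0 hc) this

end smoothFun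

end SmoothFun

end

noncomputable section

/-! ### Differential algebra of the determining equations

The coordinates are the position `x`, the magnetic field `B`, the total pressure `Q = p + B² / 2`
and `σ = 1 - τ`. -/

/-- Commuting derivations `∂/∂x`, `∂/∂B`, `∂/∂Q`, `∂/∂σ` of an algebra with coordinates `B`, and an
element `σ` that does not depend on `x`, `B`, `Q`. The value of `∂/∂σ` at `σ` is left open, so that
`σ` may also be constant. -/
structure FieldFrame (A : Type*) [CommRing A] [Algebra ℝ A] where
  dx : Fin 3 → Derivation ℝ A A
  dB : Fin 3 → Derivation ℝ A A
  dQ : Derivation ℝ A A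
  dS : Derivation ℝ A A
  B : Fin 3 → A
  σ : A
  dx_B : ∀ i k, dx i (B k) = 0
  dB_B_self : ∀ i, dB i (B i) = 1
  dB_B_ne : ∀ i k, i ≠ k → dB i (B k) = 0
  dQ_B : ∀ k, dQ (B k) = 0
  dS_B : ∀ k, dS (B k) = 0
  dx_σ : ∀ i, dx i σ = 0
  dB_σ : ∀ i, dB i σ = 0
  dQ_σ : dQ σ = 0
  dx_dx : ∀ i k f, dx i (dx k f) = dx k (dx i f)
  dB_dx : ∀ i k f, dB i (dx k f) = dx k (dB i f)
  dQ_dx : ∀ k f, dQ (dx k f) = dx k (dQ f)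
  dB_dQ : ∀ k f, dB k (dQ f) = dQ (dB k f)
  dS_dx : ∀ k f, dS (dx k f) = dx k (dS f)
  dS_dB : ∀ k f, dS (dB k f) = dB k (dS f)
  dS_dQ : ∀ f, dS (dQ f) = dQ (dS f)
  eq_zero_of_B_mul : ∀ k f, B k * f = 0 → f = 0
  eq_zero_of_σ_mul : ∀ f, σ * f = 0 → f = 0

lemma exists_third (i k : Fin 3) : ∃ j, i ≠ j ∧ k ≠ j := by
  revert i k; decide

lemma exists_other (i : Fin 3) : ∃ j, i ≠ j := ⟨i + 1, by revert i; decide⟩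

lemma eq_zero_of_two_mul {A : Type*} [CommRing A] [Algebra ℝ A] {f : A} (h : 2 * f = 0) :
    f = 0 := by
  have h2 : algebraMap ℝ A 2⁻¹ * 2 = 1 := by
    rw [← map_ofNat (algebraMap ℝ A) 2, ← map_mul]; norm_num
  linear_combination algebraMap ℝ A 2⁻¹ * h - f * h2

namespace FieldFrame

variable {A : Type*} [CommRing A] [Algebra ℝ A] (Φ : FieldFrame A)

/-- The determining equations of first order that come from the jets along a single entry
`∂B_i/∂x_j`, `i ≠ j`, and from the traceless diagonal ones. -/
structure Determining (ξ β : Fin 3 → A) (ρ κ l : A) (n : Fin 3 → A) (nQ : A) : Prop where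
  dB_ξ : ∀ k a, Φ.dB k (ξ a) = 0
  dQ_ξ : ∀ a, Φ.dQ (ξ a) = 0
  dB_β_ne : ∀ i j, i ≠ j → Φ.dB i (β j) = Φ.dx i (ξ j) - Φ.σ * Φ.B j * Φ.dQ (β i)
  dB_β_self : ∀ i, Φ.dB i (β i) = Φ.dx i (ξ i) - Φ.σ * Φ.B i * Φ.dQ (β i) + l
  force_third : ∀ i j k, i ≠ j → i ≠ k → j ≠ k →
    Φ.σ * Φ.B j * (- Φ.dx k (ξ i) - Φ.dB i (β k) - Φ.σ * Φ.dQ (β k) * Φ.B i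
      - Φ.B k * nQ * Φ.B i) = Φ.B k * Φ.B j * n i
  force_col : ∀ i j, i ≠ j →
    Φ.dB i ρ + Φ.σ * Φ.B j * (- Φ.dx j (ξ i) - Φ.dB i (β j) - Φ.σ * Φ.dQ (β j) * Φ.B i
      - Φ.B j * nQ * Φ.B i) = Φ.B j ^ 2 * n i
  force_row : ∀ i j, i ≠ j →
    Φ.σ * Φ.B j * (Φ.dQ ρ - Φ.dx i (ξ i) - Φ.dB i (β i) - Φ.σ * Φ.dQ (β i) * Φ.B i
      - Φ.B i * nQ * Φ.B i) - κ * Φ.B j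
      - Φ.σ * (β j - ∑ a, Φ.dx a (ξ j) * Φ.B a) = Φ.B i * Φ.B j * n i

lemma dB_sum_mul (k : Fin 3) (f : Fin 3 → A) :
    Φ.dB k (∑ a, f a * Φ.B a) = f k + ∑ a, Φ.dB k (f a) * Φ.B a := by
  have h : ∀ a, Φ.dB k (f a * Φ.B a)
      = (if a = k then f a else 0) + Φ.dB k (f a) * Φ.B a := fun a => by
    rw [Derivation.leibniz, smul_eq_mul, smul_eq_mul]
    split_ifs with hak
    · rw [hak, Φ.dB_B_self]; ring
    · rw [Φ.dB_B_ne k a (Ne.symm hak)]; ring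
  rw [map_sum, Finset.sum_congr rfl fun a _ => h a, Finset.sum_add_distrib]
  simp

namespace Determining

variable {Φ} {ξ β : Fin 3 → A} {ρ κ l nQ : A} {n : Fin 3 → A}

section
variable (H : Φ.Determining ξ β ρ κ l n nQ)
include H

lemma dB_dx_ξ (k i a : Fin 3) : Φ.dB k (Φ.dx i (ξ a)) = 0 := by
  rw [Φ.dB_dx, H.dB_ξ, map_zero]

lemma dQ_dx_ξ (i a : Fin 3) : Φ.dQ (Φ.dx i (ξ a)) = 0 := by
  rw [Φ.dQ_dx, H.dQ_ξ, map_zero]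

lemma stress (i k : Fin 3) (hik : i ≠ k) :
    Φ.σ * (- Φ.dx k (ξ i) - Φ.dB i (β k) - Φ.σ * Φ.dQ (β k) * Φ.B i
      - Φ.B k * nQ * Φ.B i) = Φ.B k * n i := by
  obtain ⟨j, hij, hkj⟩ := exists_third i k
  rw [← sub_eq_zero]
  apply Φ.eq_zero_of_B_mul j
  linear_combination H.force_third i j k hij hik hkj.symm

lemma dB_ρ (i : Fin 3) : Φ.dB i ρ = 0 := by
  obtain ⟨j, hij⟩ := exists_other i
  linear_combination H.force_col i j hij - Φ.B j * H.stress i j hij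

/-- In `force_row k j` every term other than `β j - ∑ a, Φ.dx a (ξ j) * Φ.B a` is `B j` times a
factor that depends on `k` alone. Using the same third row `k` for both columns and
cross-multiplying eliminates that factor. -/
lemma β_sub_parallel (i j : Fin 3) :
    (β j - ∑ a, Φ.dx a (ξ j) * Φ.B a) * Φ.B i = (β i - ∑ a, Φ.dx a (ξ i) * Φ.B a) * Φ.B j := by
  obtain ⟨k, hik, hjk⟩ := exists_third i j
  rw [← sub_eq_zero]
  apply Φ.eq_zero_of_σ_mul
  linear_combination (-1) * Φ.B i * H.force_row k j hjk.symm + Φ.B j * H.force_row k i hik.symm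

lemma dB_sum (i j : Fin 3) : Φ.dB i (∑ a, Φ.dx a (ξ j) * Φ.B a) = Φ.dx i (ξ j) := by
  simp [Φ.dB_sum_mul, H.dB_dx_ξ]

lemma dQ_sum (j : Fin 3) : Φ.dQ (∑ a, Φ.dx a (ξ j) * Φ.B a) = 0 := by
  rw [map_sum]
  exact Finset.sum_eq_zero fun a _ => by simp [Derivation.leibniz, H.dQ_dx_ξ, Φ.dQ_B]

/-- Differentiating the parallelism with `B` in the direction `B i`, `i ≠ j`, extracts the
proportionality factor without dividing by a component of `B`; the diagonal equations identify it as
`l`. -/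
lemma β_eq (j : Fin 3) : β j = ∑ a, Φ.dx a (ξ j) * Φ.B a + l * Φ.B j := by
  obtain ⟨i, hji⟩ := exists_other j
  have h := congrArg (Φ.dB i) (H.β_sub_parallel i j)
  simp only [Derivation.leibniz, map_sub, H.dB_sum, Φ.dB_B_self, Φ.dB_B_ne i j hji.symm,
    smul_eq_mul, mul_one, mul_zero, zero_add, H.dB_β_ne i j hji.symm, H.dB_β_self i] at h
  linear_combination h

lemma dQ_β (j : Fin 3) : Φ.dQ (β j) = Φ.dQ l * Φ.B j := by
  have h := congrArg Φ.dQ (H.β_eq j)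
  simp only [Derivation.leibniz, map_add, H.dQ_sum, Φ.dQ_B, smul_eq_mul] at h
  linear_combination h

/-- Two expressions for `dB i (β j)` are compared. The result is the transport equation whose
solutions depend on `B` and `Q` through `Q - σB²/2`; it is the source of the infinite family. -/
lemma dB_l (i : Fin 3) : Φ.dB i l = - Φ.σ * Φ.dQ l * Φ.B i := by
  obtain ⟨j, hij⟩ := exists_other i
  have h := congrArg (Φ.dB i) (H.β_eq j)
  simp only [Derivation.leibniz, map_add, H.dB_sum, Φ.dB_B_ne i j hij,
    smul_eq_mul, H.dB_β_ne i j hij, H.dQ_β] at h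
  rw [← sub_eq_zero]
  apply Φ.eq_zero_of_B_mul j
  linear_combination -h

lemma stress_symm (i k : Fin 3) (hik : i ≠ k) :
    Φ.σ * (Φ.dx k (ξ i) + Φ.dx i (ξ k) + Φ.B i * Φ.B k * nQ) = - Φ.B k * n i := by
  linear_combination - H.stress i k hik - Φ.σ * H.dB_β_ne i k hik
    + Φ.σ ^ 2 * (Φ.B k * H.dQ_β i - Φ.B i * H.dQ_β k)

/-- The off-diagonal part of the conformal Killing equation for `ξ`. -/
lemma killing_ne (i k : Fin 3) (hik : i ≠ k) : Φ.dx k (ξ i) + Φ.dx i (ξ k) = 0 := by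
  obtain ⟨j, hij, hkj⟩ := exists_third i k
  -- Both `n i` and `nQ` drop out between the pairs `(i, k)` and `(i, j)`. The symmetrized gradient
  -- of `ξ` is free of `B`, so differentiating in `B j` isolates one of its entries.
  have h : (Φ.dx k (ξ i) + Φ.dx i (ξ k)) * Φ.B j = (Φ.dx j (ξ i) + Φ.dx i (ξ j)) * Φ.B k := by
    rw [← sub_eq_zero]
    apply Φ.eq_zero_of_σ_mul
    linear_combination Φ.B j * H.stress_symm i k hik - Φ.B k * H.stress_symm i j hij
  have h' := congrArg (Φ.dB j) h
  simp only [Derivation.leibniz, map_add, H.dB_dx_ξ, Φ.dB_B_self, Φ.dB_B_ne j k hkj.symm,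
    smul_eq_mul, mul_one, mul_zero, add_zero] at h'
  exact h'

lemma n_eq (i : Fin 3) : n i = - Φ.σ * nQ * Φ.B i := by
  obtain ⟨k, hik⟩ := exists_other i
  rw [← sub_eq_zero]
  apply Φ.eq_zero_of_B_mul k
  linear_combination H.stress_symm i k hik - Φ.σ * H.killing_ne i k hik

/-- Since `κ` does not involve the index `i`, this formula for all `i` makes the diagonal
derivatives of `ξ` equal. -/
lemma κ_eq (i : Fin 3) : κ = Φ.σ * (Φ.dQ ρ - 2 * Φ.dx i (ξ i) - 2 * l) := by
  obtain ⟨j, hij⟩ := exists_other i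
  rw [← sub_eq_zero]
  apply Φ.eq_zero_of_B_mul j
  linear_combination - H.force_row i j hij - Φ.B i * Φ.B j * H.n_eq i
    - Φ.σ * Φ.B j * H.dB_β_self i - Φ.σ * H.β_eq j

/-- The diagonal part of the conformal Killing equation for `ξ`. -/
lemma killing_self (i j : Fin 3) : Φ.dx i (ξ i) = Φ.dx j (ξ j) := by
  rw [← sub_eq_zero]
  apply eq_zero_of_two_mul
  apply Φ.eq_zero_of_σ_mul
  linear_combination H.κ_eq i - H.κ_eq j

/-- The operator `dB 0 + σ B₀ dQ` annihilates `κ`, `l`, `σ` and the derivatives of `ξ`. Applied to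
`κ_eq` it leaves only `σ² B₀ dQ (dQ ρ)`, because `ρ` does not depend on `B`. -/
lemma dQ_dQ_ρ (h : ∀ i, Φ.dB i κ = - Φ.σ * Φ.dQ κ * Φ.B i) : Φ.dQ (Φ.dQ ρ) = 0 := by
  have hκ := H.κ_eq 0
  have h2 : ∀ D : Derivation ℝ A A, D 2 = 0 := fun D => by
    rw [← map_ofNat (algebraMap ℝ A) 2, D.map_algebraMap]
  have h1 := congrArg (Φ.dB 0) hκ
  have hq := congrArg Φ.dQ hκ
  simp only [Derivation.leibniz, map_sub, H.dB_dx_ξ, H.dQ_dx_ξ, Φ.dB_dQ, H.dB_ρ, Φ.dB_σ, Φ.dQ_σ,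
    smul_eq_mul, h2, H.dB_l, map_zero] at h1 hq
  apply Φ.eq_zero_of_B_mul 0
  apply Φ.eq_zero_of_σ_mul
  apply Φ.eq_zero_of_σ_mul
  linear_combination (-1) * h1 + h 0 - Φ.σ * Φ.B 0 * hq

/-- The part of the force balance that is independent of the jet forces `ξ` to be affine. -/
lemma affine (m c : Fin 3 → A) (hm : ∀ k i, Φ.dB k (m i) = 0)
    (hc : ∀ k l i, Φ.dB k (Φ.dB l (c i)) = 0)
    (h : ∀ i, ∑ a, ∑ b, Φ.dx a (Φ.dx b (ξ i)) * Φ.B b * Φ.B a + (∑ a, Φ.B a * m a) * Φ.B i = c i) :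
    (∀ i a b, Φ.dx a (Φ.dx b (ξ i)) = 0) ∧ ∀ a, m a = 0 := by
  have hP : ∀ k a b i, Φ.dB k (Φ.dx a (Φ.dx b (ξ i))) = 0 := fun k a b i => by
    rw [Φ.dB_dx, H.dB_dx_ξ, map_zero]
  -- Polarization: two derivatives in `B` turn the quadratic form in `B` into its coefficients and
  -- kill the right-hand side, which is at most linear in `B`.
  have key : ∀ i k l, 2 * Φ.dx k (Φ.dx l (ξ i)) + m k * Φ.dB l (Φ.B i)
      + m l * Φ.dB k (Φ.B i) = 0 := by
    intro i k l
    have h0 : ∑ a, (∑ b, Φ.dx a (Φ.dx b (ξ i)) * Φ.B b) * Φ.B a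
        + (∑ a, m a * Φ.B a) * Φ.B i = c i := by
      rw [← h i]
      simp only [Finset.sum_mul, mul_comm (m _)]
    have hδ : Φ.dB l (Φ.dB k (Φ.B i)) = 0 := by
      rcases eq_or_ne k i with rfl | hki
      · rw [Φ.dB_B_self, Derivation.map_one_eq_zero]
      · rw [Φ.dB_B_ne k i hki, map_zero]
    have h2 := congrArg (fun f => Φ.dB l (Φ.dB k f)) h0
    simp only [hc, map_add, Φ.dB_sum_mul, Derivation.leibniz, hm, hP, smul_eq_mul, zero_mul, hδ,
      Finset.sum_const_zero, mul_zero, add_zero, zero_add] at h2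
    linear_combination h2 + Φ.dx_dx k l (ξ i)
  -- The coefficient identities have the shape of a special conformal field with parameter `m`, but
  -- with signs incompatible with the derivative of the Killing equation in the plane of `a` and
  -- `i`.
  have hm0 : ∀ a, m a = 0 := fun a => by
    obtain ⟨i, hai⟩ := exists_other a
    have hk := congrArg (Φ.dx i) (H.killing_ne a i hai)
    rw [map_add, map_zero] at hk
    have h1 := key a i i
    have h2 := key i i a
    rw [Φ.dB_B_ne i a hai.symm] at h1
    rw [Φ.dB_B_ne a i hai, Φ.dB_B_self] at h2
    linear_combination h1 + h2 - 2 * hk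
  refine ⟨fun i a b => eq_zero_of_two_mul ?_, hm0⟩
  have := key i a b
  rw [hm0, hm0] at this
  linear_combination this
end

end Determining

end FieldFrame

end

/-! ### Prolonged action on the equations, and the consequences common to the three systems. -/

noncomputable section

namespace FieldFrame

variable {A : Type*} [CommRing A] [Algebra ℝ A] (Φ : FieldFrame A)

/-- The total derivative along the jet with `∂B_k/∂x_i = b k i`, `∂Q/∂x_i = q i`,
`∂σ/∂x_i = h i`. -/
def tot (b : Fin 3 → Fin 3 → A) (q h : Fin 3 → A) (i : Fin 3) (f : A) : A :=
  Φ.dx i f + (∑ k, b k i * Φ.dB k f + q i * Φ.dQ f + h i * Φ.dS f)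

/-- The prolonged field applied to `div B`. -/
def divRes (ξ β : Fin 3 → A) (b : Fin 3 → Fin 3 → A) (q h : Fin 3 → A) : A :=
  ∑ i, Φ.tot b q h i (β i) - ∑ i, ∑ a, b i a * Φ.tot b q h i (ξ a)

/-- The prolonged field applied to `B · grad σ`. -/
def stateRes (ξ β : Fin 3 → A) (κ : A) (b : Fin 3 → Fin 3 → A) (q h : Fin 3 → A) : A :=
  ∑ i, β i * h i + ∑ i, Φ.B i * (Φ.tot b q h i κ - ∑ a, h a * Φ.tot b q h i (ξ a))

/-- The prolonged field applied to `grad Q - σ (B · grad) B`. -/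
def forceRes (ξ β : Fin 3 → A) (ρ κ : A) (b : Fin 3 → Fin 3 → A) (q h : Fin 3 → A)
    (m : Fin 3) : A :=
  Φ.tot b q h m ρ - ∑ a, q a * Φ.tot b q h m (ξ a) - κ * ∑ a, b m a * Φ.B a
    - Φ.σ * ∑ a, b m a * β a
    - Φ.σ * ∑ i, (Φ.tot b q h i (β m) - ∑ a, b m a * Φ.tot b q h i (ξ a)) * Φ.B i

/-- The jet with the single nonzero entry `∂B_i/∂x_j = 1`. -/
def unitJet (i j : Fin 3) : Fin 3 → Fin 3 → A :=
  fun k a => if k = i then (if a = j then 1 else 0) else 0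

lemma tot_neg (b : Fin 3 → Fin 3 → A) (q h : Fin 3 → A) (i : Fin 3) (f : A) :
    Φ.tot (-b) (-q) (-h) i f
      = Φ.dx i f - (∑ k, b k i * Φ.dB k f + q i * Φ.dQ f + h i * Φ.dS f) := by
  simp only [tot, Pi.neg_apply, neg_mul, Finset.sum_neg_distrib]
  ring

lemma tot_zero (i : Fin 3) (f : A) : Φ.tot 0 0 0 i f = Φ.dx i f := by
  simp [tot]

/-- The residual is a polynomial of degree two in the jet. Its values at zero, at a jet and at the
opposite jet separate the linear from the quadratic part. -/
lemma divRes_split {ξ β : Fin 3 → A} {b : Fin 3 → Fin 3 → A} {q h : Fin 3 → A}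
    (h0 : Φ.divRes ξ β 0 0 0 = 0) (h1 : Φ.divRes ξ β b q h = 0)
    (h2 : Φ.divRes ξ β (-b) (-q) (-h) = 0) :
    ∑ i, (∑ k, b k i * Φ.dB k (β i) + q i * Φ.dQ (β i) + h i * Φ.dS (β i))
        - ∑ i, ∑ a, b i a * Φ.dx i (ξ a) = 0 ∧
      ∑ i, ∑ a, b i a * (∑ k, b k i * Φ.dB k (ξ a) + q i * Φ.dQ (ξ a) + h i * Φ.dS (ξ a))
        = 0 := by
  simp only [divRes, tot_neg, tot_zero, Pi.zero_apply, zero_mul, Finset.sum_const_zero,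
    sub_zero, Pi.neg_apply, neg_mul, Finset.sum_neg_distrib, mul_sub, Finset.sum_sub_distrib] at h0 h2
  simp only [divRes, tot, mul_add, Finset.sum_add_distrib] at h1
  simp only [mul_add, Finset.sum_add_distrib] at h2 ⊢
  constructor
  · apply eq_zero_of_two_mul
    linear_combination h1 - h2
  · apply eq_zero_of_two_mul
    linear_combination 2 * h0 - h1 - h2

/-- A field whose components annihilate the quadratic terms does not move `x` by an amount that
depends on `B` and `Q`. -/
lemma ξ_of_quadratic {ξ : Fin 3 → A}
    (H : ∀ b : Fin 3 → Fin 3 → A, ∑ i, b i i = 0 →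
      ∑ i, ∑ a, b i a * (∑ k, b k i * Φ.dB k (ξ a)
        + (Φ.σ * ∑ j, b i j * Φ.B j) * Φ.dQ (ξ a)) = 0) :
    (∀ k a, Φ.dB k (ξ a) = 0) ∧ ∀ a, Φ.dQ (ξ a) = 0 := by
  have hQ : ∀ j, Φ.dQ (ξ j) = 0 := fun j => by
    obtain ⟨i, hji⟩ := exists_other j
    have h := H (unitJet i j) (by simp [unitJet, hji.symm])
    simp [unitJet, hji.symm] at h
    apply Φ.eq_zero_of_B_mul j
    apply Φ.eq_zero_of_σ_mul
    linear_combination h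
  -- The chained entries `∂B_i/∂x_j` and `∂B_j/∂x_k` are trace free, and their product is the only
  -- contribution of `dB`, with factor `dB i (ξ k)`. The diagonal derivatives are then reached
  -- through `E_ii - E_jj`: three pairwise sums that vanish force each term to vanish.
  have hne : ∀ i k, i ≠ k → Φ.dB i (ξ k) = 0 := fun i k hik => by
    obtain ⟨j, hij, hkj⟩ := exists_third i k
    have h := H (fun a b => unitJet i j a b + unitJet j k a b)
      (by simp [unitJet, hij, hkj.symm, Finset.sum_add_distrib])
    simp [unitJet, hij, hik, hkj.symm, hQ, add_mul, Finset.sum_add_distrib] at h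
    exact h
  have hdiag : ∀ i j, i ≠ j → Φ.dB i (ξ i) + Φ.dB j (ξ j) = 0 := fun i j hij => by
    have h := H (fun a b => unitJet i i a b - unitJet j j a b)
      (by simp [unitJet, Finset.sum_sub_distrib])
    simp [unitJet, hij, hij.symm, hQ, sub_mul, Finset.sum_sub_distrib] at h
    linear_combination h
  refine ⟨fun k a => ?_, hQ⟩
  rcases eq_or_ne k a with rfl | hka
  · obtain ⟨i, hki⟩ := exists_other k
    obtain ⟨j, hkj, hij⟩ := exists_third k i
    apply eq_zero_of_two_mul
    linear_combination hdiag k i hki + hdiag k j hkj - hdiag i j hij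
  · exact hne k a hka

/-- The equations that hold for each of the three systems: `ε = 1` for the general CGL system,
`ε = 0` for the other two. -/
structure Balanced (ξ β : Fin 3 → A) (ρ κ ε : A) : Prop where
  div_eq : ∀ b : Fin 3 → Fin 3 → A, ∑ i, b i i = 0 →
    Φ.divRes ξ β b (fun i => Φ.σ * ∑ j, b i j * Φ.B j) 0 = 0
  force_eq : ∀ b : Fin 3 → Fin 3 → A, ∑ i, b i i = 0 → ∀ m,
    Φ.forceRes ξ β ρ κ b (fun i => Φ.σ * ∑ j, b i j * Φ.B j) 0 m
      = ε * (∑ i, Φ.B i * Φ.tot b (fun i => Φ.σ * ∑ j, b i j * Φ.B j) 0 i κ) * Φ.B m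

namespace Balanced

variable {Φ} {ξ β : Fin 3 → A} {ρ κ ε : A} (H : Φ.Balanced ξ β ρ κ ε)
include H

lemma div_zero : Φ.divRes ξ β 0 0 0 = 0 := by
  have h := H.div_eq 0 (by simp)
  simpa [Pi.zero_def] using h

lemma div_split (b : Fin 3 → Fin 3 → A) (hb : ∑ i, b i i = 0) :
    ∑ i, (∑ k, b k i * Φ.dB k (β i) + (Φ.σ * ∑ j, b i j * Φ.B j) * Φ.dQ (β i))
        - ∑ i, ∑ a, b i a * Φ.dx i (ξ a) = 0 ∧
      ∑ i, ∑ a, b i a * (∑ k, b k i * Φ.dB k (ξ a)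
        + (Φ.σ * ∑ j, b i j * Φ.B j) * Φ.dQ (ξ a)) = 0 := by
  have h2 := H.div_eq (-b) (by simp [hb])
  have hq : (fun i => Φ.σ * ∑ j, (-b) i j * Φ.B j) = -(fun i => Φ.σ * ∑ j, b i j * Φ.B j) := by
    funext i
    simp
  rw [hq, show (0 : Fin 3 → A) = -0 by simp] at h2
  simpa using Φ.divRes_split H.div_zero (H.div_eq b hb) h2

lemma dB_ξ (k a : Fin 3) : Φ.dB k (ξ a) = 0 :=
  (Φ.ξ_of_quadratic fun b hb => (H.div_split b hb).2).1 k a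

lemma dQ_ξ (a : Fin 3) : Φ.dQ (ξ a) = 0 :=
  (Φ.ξ_of_quadratic fun b hb => (H.div_split b hb).2).2 a

lemma div_const : ∑ i, Φ.dx i (β i) = 0 := by
  simpa [divRes, tot_zero] using H.div_zero

lemma force_const (m : Fin 3) :
    Φ.dx m ρ = Φ.σ * ∑ i, Φ.dx i (β m) * Φ.B i + ε * (∑ i, Φ.B i * Φ.dx i κ) * Φ.B m := by
  have h := H.force_eq 0 (by simp) m
  simp [forceRes, tot] at h
  linear_combination h

/-- The factor `l` is read off at index `0`; the traceless jets `E_ii - E_00` show that other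
indices give the same value. Subtracting the zero-jet equation leaves the linear part of the force
equation, as no quadratic part survives once `ξ` is free of `B` and `Q`. The arguments `n`, `nQ`
record the term `B·∇κ` when `ε = 1`. -/
lemma determining : Φ.Determining ξ β ρ κ
    (Φ.dB 0 (β 0) - Φ.dx 0 (ξ 0) + Φ.σ * Φ.B 0 * Φ.dQ (β 0))
    (fun k => ε * Φ.dB k κ) (ε * Φ.dQ κ) where
  dB_ξ := H.dB_ξ
  dQ_ξ := H.dQ_ξ
  dB_β_ne i j hij := by
    have h := (H.div_split (unitJet i j) (by simp [unitJet, hij])).1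
    simp [unitJet, Finset.sum_add_distrib] at h
    linear_combination h
  dB_β_self i := by
    rcases eq_or_ne i 0 with rfl | hi
    · ring
    have h := (H.div_split (fun a b => unitJet i i a b - unitJet 0 0 a b)
      (by simp [unitJet, Finset.sum_sub_distrib])).1
    simp [unitJet, sub_mul, Finset.sum_sub_distrib, mul_sub, Finset.sum_add_distrib] at h
    linear_combination h
  force_third i j k hij hik hjk := by
    have h := H.force_eq (unitJet i j) (by simp [unitJet, hij]) k
    have hc := H.force_const k
    simp [unitJet, forceRes, tot, H.dB_ξ, H.dQ_ξ, hik.symm, hjk.symm, mul_add, add_mul,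
      Finset.sum_add_distrib] at h
    linear_combination h - hc
  force_col i j hij := by
    have h := H.force_eq (unitJet i j) (by simp [unitJet, hij]) j
    have hc := H.force_const j
    simp [unitJet, forceRes, tot, H.dB_ξ, H.dQ_ξ, hij.symm, mul_add, add_mul,
      Finset.sum_add_distrib] at h
    linear_combination h - hc
  force_row i j hij := by
    have h := H.force_eq (unitJet i j) (by simp [unitJet, hij]) i
    have hc := H.force_const i
    simp [unitJet, forceRes, tot, H.dB_ξ, H.dQ_ξ, hij, mul_add, add_mul, sub_mul,
      Finset.sum_add_distrib, Finset.sum_sub_distrib] at h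
    linear_combination h - hc

end Balanced

end FieldFrame

end

/-! ### Solution of the determining equations, system by system. -/

noncomputable section

namespace FieldFrame

variable {A : Type*} [CommRing A] [Algebra ℝ A] (Φ : FieldFrame A)

/-- The general solution of the determining equations, up to constants of integration. -/
structure Solved (ξ β : Fin 3 → A) (ρ κ l : A) : Prop where
  dB_ξ : ∀ k a, Φ.dB k (ξ a) = 0
  dQ_ξ : ∀ a, Φ.dQ (ξ a) = 0
  dS_ξ : ∀ a, Φ.dS (ξ a) = 0
  dx_dx_ξ : ∀ i a b, Φ.dx a (Φ.dx b (ξ i)) = 0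
  killing_ne : ∀ i k, i ≠ k → Φ.dx k (ξ i) + Φ.dx i (ξ k) = 0
  killing_self : ∀ i j, Φ.dx i (ξ i) = Φ.dx j (ξ j)
  β_eq : ∀ j, β j = ∑ a, Φ.dx a (ξ j) * Φ.B a + l * Φ.B j
  κ_eq : κ = Φ.σ * (Φ.dQ ρ - 2 * Φ.dx 0 (ξ 0) - 2 * l)
  dx_ρ : ∀ i, Φ.dx i ρ = 0
  dB_ρ : ∀ i, Φ.dB i ρ = 0
  dS_ρ : Φ.dS ρ = 0
  dQ_dQ_ρ : Φ.dQ (Φ.dQ ρ) = 0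
  dx_l : ∀ i, Φ.dx i l = 0
  dB_l : ∀ i, Φ.dB i l = - Φ.σ * Φ.dQ l * Φ.B i

/-- The symmetry condition for the general CGL system. -/
def CGLSymmetric (ξ β : Fin 3 → A) (ρ κ : A) : Prop :=
  ∀ (b : Fin 3 → Fin 3 → A) (q h : Fin 3 → A), ∑ i, b i i = 0 →
    (∀ i, q i = Φ.σ * ∑ j, b i j * Φ.B j + (∑ j, Φ.B j * h j) * Φ.B i) →
    Φ.divRes ξ β b q h = 0 ∧ ∀ m, Φ.forceRes ξ β ρ κ b q h m
      = Φ.stateRes ξ β κ b q h * Φ.B m + (∑ j, Φ.B j * h j) * β m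

/-- The symmetry condition for the CGL system with equation of state. -/
def StateSymmetric (ξ β : Fin 3 → A) (ρ κ : A) : Prop :=
  ∀ (b : Fin 3 → Fin 3 → A) (q h : Fin 3 → A), ∑ i, b i i = 0 →
    (∀ i, q i = Φ.σ * ∑ j, b i j * Φ.B j) → ∑ j, Φ.B j * h j = 0 →
    Φ.divRes ξ β b q h = 0 ∧ Φ.stateRes ξ β κ b q h = 0 ∧
      ∀ m, Φ.forceRes ξ β ρ κ b q h m = 0

variable {Φ} {ξ β : Fin 3 → A} {ρ κ ε l nQ : A} {n : Fin 3 → A}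

lemma dx_mul_B (i k : Fin 3) (f : A) : Φ.dx i (f * Φ.B k) = Φ.dx i f * Φ.B k := by
  rw [Derivation.leibniz, Φ.dx_B, smul_zero, zero_add, smul_eq_mul, mul_comm]

lemma dS_mul_B (k : Fin 3) (f : A) : Φ.dS (f * Φ.B k) = Φ.dS f * Φ.B k := by
  rw [Derivation.leibniz, Φ.dS_B, smul_zero, zero_add, smul_eq_mul, mul_comm]

lemma dQ_mul_B (k : Fin 3) (f : A) : Φ.dQ (f * Φ.B k) = Φ.dQ f * Φ.B k := by
  rw [Derivation.leibniz, Φ.dQ_B, smul_zero, zero_add, smul_eq_mul, mul_comm]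

lemma derivation_two_mul (D : Derivation ℝ A A) (f : A) : D (2 * f) = 2 * D f := by
  have h : D (2 : A) = 0 := by rw [← map_ofNat (algebraMap ℝ A) 2, D.map_algebraMap]
  rw [Derivation.leibniz, h, smul_zero, add_zero, smul_eq_mul]

lemma Determining.dx_β (H : Φ.Determining ξ β ρ κ l n nQ) (i j : Fin 3) :
    Φ.dx i (β j) = ∑ a, Φ.dx i (Φ.dx a (ξ j)) * Φ.B a + Φ.dx i l * Φ.B j := by
  rw [H.β_eq j, map_add, map_sum]
  simp only [dx_mul_B]

lemma Determining.sum_dx_β (H : Φ.Determining ξ β ρ κ l n nQ) (m : Fin 3) :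
    ∑ i, Φ.dx i (β m) * Φ.B i
      = ∑ a, ∑ b, Φ.dx a (Φ.dx b (ξ m)) * Φ.B b * Φ.B a + (∑ a, Φ.B a * Φ.dx a l) * Φ.B m := by
  simp only [H.dx_β, add_mul, Finset.sum_mul, Finset.sum_add_distrib]
  congr 1
  exact Finset.sum_congr rfl fun a _ => by ring

/-- With `κ = 0` and `σ = 1`, `κ_eq` ties `l` to `dQ ρ`, which is free of `B`. Then `dB_l` forces
`dQ l = 0`, so no function of the state invariants survives. -/
lemma Balanced.solved_of_const (H : Φ.Balanced ξ β ρ 0 0) (hσ : Φ.σ = 1)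
    (hS : ∀ f, Φ.dS f = 0) :
    ∃ l, Φ.Solved ξ β ρ 0 l ∧ Φ.dQ l = 0 := by
  have D := H.determining
  generalize Φ.dB 0 (β 0) - Φ.dx 0 (ξ 0) + Φ.σ * Φ.B 0 * Φ.dQ (β 0) = l at D
  have hρ : Φ.dQ ρ = 2 * Φ.dx 0 (ξ 0) + 2 * l := by
    have := D.κ_eq 0
    rw [hσ] at this
    linear_combination -this
  have hlB : ∀ i, Φ.dB i l = 0 := fun i => by
    apply eq_zero_of_two_mul
    have h := congrArg (Φ.dB i) hρ
    rw [Φ.dB_dQ, D.dB_ρ, map_zero, map_add, derivation_two_mul, derivation_two_mul, D.dB_dx_ξ] at h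
    linear_combination -h
  have hlQ : Φ.dQ l = 0 := by
    have := D.dB_l 0
    rw [hσ, hlB] at this
    apply Φ.eq_zero_of_B_mul 0
    linear_combination this
  have hc : ∀ m, ∑ a, ∑ b, Φ.dx a (Φ.dx b (ξ m)) * Φ.B b * Φ.B a
      + (∑ a, Φ.B a * Φ.dx a l) * Φ.B m = Φ.dx m ρ := fun m => by
    rw [← D.sum_dx_β m, H.force_const m, hσ]
    ring
  obtain ⟨h1, h2⟩ := D.affine (fun a => Φ.dx a l) (fun m => Φ.dx m ρ)
    (fun k i => by rw [Φ.dB_dx, hlB, map_zero])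
    (fun k l i => by rw [Φ.dB_dx _ _ ρ, D.dB_ρ, map_zero, map_zero]) hc
  refine ⟨l, ⟨D.dB_ξ, D.dQ_ξ, fun a => hS _, h1, D.killing_ne, D.killing_self, D.β_eq, D.κ_eq 0,
    fun m => ?_, D.dB_ρ, hS _, D.dQ_dQ_ρ (by simp), h2, D.dB_l⟩, hlQ⟩
  rw [← hc m]
  simp [h1, h2]

lemma StateSymmetric.balanced (H : Φ.StateSymmetric ξ β ρ κ) : Φ.Balanced ξ β ρ κ 0 where
  div_eq b hb := (H b _ 0 hb (fun _ => rfl) (by simp)).1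
  force_eq b hb m := by simpa using (H b _ 0 hb (fun _ => rfl) (by simp)).2.2 m

/-- Beyond the common equations, jets with `∇σ` orthogonal to `B` remove the dependence of `ξ` and
`ρ` on `σ`, and the equation of state controls `κ`. Nothing restricts `l` further in `Q` and `σ`. -/
lemma StateSymmetric.solved (H : Φ.StateSymmetric ξ β ρ κ) (hσ : Φ.dS Φ.σ = 1) :
    ∃ l, Φ.Solved ξ β ρ κ l := by
  have D := H.balanced.determining
  have hF := H.balanced.force_const
  generalize Φ.dB 0 (β 0) - Φ.dx 0 (ξ 0) + Φ.σ * Φ.B 0 * Φ.dQ (β 0) = l at D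
  -- a gradient of `σ` orthogonal to `B`
  have hh : ∀ i k : Fin 3, i ≠ k → ∑ j, Φ.B j * (if j = i then Φ.B k else if j = k then - Φ.B i
      else 0) = 0 := fun i k hik => by
    have : ∀ j, Φ.B j * (if j = i then Φ.B k else if j = k then - Φ.B i else 0)
        = (if j = i then Φ.B i * Φ.B k else 0) + (if j = k then - (Φ.B i * Φ.B k) else 0) := by
      intro j
      split_ifs with h1 h2 h2
      · exact absurd (h1.symm.trans h2) hik
      · rw [h1]; ring
      · rw [h2]; ring
      · ring
    simp only [this, Finset.sum_add_distrib]
    simp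
  -- The gradient of `σ` has entry `B j` in position `i`, so the quadratic part of the divergence
  -- equation at `∂B_i/∂x_j = 1` is `B j * dS (ξ j)`.
  have hSξ : ∀ a, Φ.dS (ξ a) = 0 := fun j => by
    obtain ⟨i, hji⟩ := exists_other j
    have hb : ∑ a, unitJet i j a a = (0 : A) := by simp [unitJet, hji.symm]
    have h1 := (H (unitJet i j) _ _ hb (fun _ => rfl) (hh i j hji.symm)).1
    have h2 := (H (-unitJet i j) (-fun m => Φ.σ * ∑ a, unitJet i j m a * Φ.B a)
      (-fun m => if m = i then Φ.B j else if m = j then - Φ.B i else 0)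
      (by simp [hb]) (fun _ => by simp) (by
        have := hh i j hji.symm
        simp only [Pi.neg_apply, mul_neg, Finset.sum_neg_distrib, this, neg_zero])).1
    have h3 := (Φ.divRes_split H.balanced.div_zero h1 h2).2
    simp [unitJet, D.dB_ξ, D.dQ_ξ] at h3
    rw [Finset.sum_eq_single i (by intro b _ hb; simp [hb]) (by simp), if_pos rfl, if_pos rfl] at h3
    exact Φ.eq_zero_of_B_mul _ _ h3
  have hSρ : Φ.dS ρ = 0 := by
    have h1 := (H 0 0 _ (by simp) (fun _ => by simp) (hh 0 1 (by decide))).2.2 0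
    have h0 := (H 0 0 0 (by simp) (fun _ => by simp) (by simp)).2.2 0
    simp [forceRes, tot, Fin.sum_univ_three] at h1 h0
    apply Φ.eq_zero_of_B_mul 1
    linear_combination h1 - h0
  have hκB : ∀ i, Φ.dB i κ = - Φ.σ * Φ.dQ κ * Φ.B i := fun i => by
    obtain ⟨j, hij⟩ := exists_other i
    have h1 := (H (unitJet i j) _ 0 (by simp [unitJet, hij]) (fun _ => rfl) (by simp)).2.1
    have h0 := (H 0 0 0 (by simp) (fun _ => by simp) (by simp)).2.1
    simp [stateRes, tot, unitJet, mul_add, Finset.sum_add_distrib] at h1 h0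
    rw [← sub_eq_zero]
    apply Φ.eq_zero_of_B_mul j
    linear_combination h1 - h0
  have hρQQ := D.dQ_dQ_ρ hκB
  have hdxX : ∀ i a, Φ.dS (Φ.dx i (ξ a)) = 0 := fun i a => by rw [Φ.dS_dx, hSξ, map_zero]
  -- `κ / σ` does not depend on `x`
  set k := Φ.dQ ρ - 2 * Φ.dx 0 (ξ 0) - 2 * l with hk
  have hkx0 : ∑ j, Φ.dx j k * Φ.B j = 0 := by
    have h0 := (H 0 0 0 (by simp) (fun _ => by simp) (by simp)).2.1
    simp only [stateRes, tot_zero, Pi.zero_apply, mul_zero, zero_mul, Finset.sum_const_zero, 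
      zero_add, sub_zero, D.κ_eq 0, Derivation.leibniz, Φ.dx_σ, add_zero, smul_eq_mul] at h0
    apply Φ.eq_zero_of_σ_mul
    rw [← h0, Finset.mul_sum]
    exact Finset.sum_congr rfl fun j _ => by ring
  have hkB : ∀ i, Φ.dB i k = - Φ.σ * Φ.dQ k * Φ.B i := fun i => by
    simp only [hk, map_sub, derivation_two_mul, Φ.dB_dQ, D.dB_ρ, map_zero, D.dB_dx_ξ, D.dQ_dx_ξ,
      hρQQ, D.dB_l]
    ring
  -- Apply `dB i` to `B·∂k = 0`. By the transport equation for `k`, the terms other than `dx i k`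
  -- add up to `-σ B i` times the `Q`-derivative of the same sum, hence to zero.
  have hkx : ∀ i, Φ.dx i k = 0 := fun i => by
    have h1 := congrArg (Φ.dB i) hkx0
    have h2 := congrArg Φ.dQ hkx0
    rw [map_sum, map_zero] at h2
    simp only [dQ_mul_B, Φ.dQ_dx] at h2
    rw [Φ.dB_sum_mul, map_zero] at h1
    have h3 : ∀ a, Φ.dB i (Φ.dx a k) * Φ.B a = - Φ.σ * Φ.B i * (Φ.dx a (Φ.dQ k) * Φ.B a) :=
      fun a => by
        rw [Φ.dB_dx, hkB]
        simp only [Derivation.leibniz, Φ.dx_B, map_neg, Φ.dx_σ, smul_eq_mul]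
        ring
    simp only [h3, ← Finset.mul_sum, h2] at h1
    linear_combination h1
  have hlx : ∀ i, 2 * Φ.dx i l = Φ.dx i (Φ.dQ ρ) - 2 * Φ.dx i (Φ.dx 0 (ξ 0)) := fun i => by
    have := hkx i
    simp only [hk, map_sub, derivation_two_mul] at this
    linear_combination -this
  have hlxB : ∀ a i, Φ.dB a (Φ.dx i l) = 0 := fun a i => by
    have := congrArg (Φ.dB a) (hlx i)
    simp only [map_sub, derivation_two_mul, Φ.dB_dx _ _ (Φ.dQ ρ), Φ.dB_dQ, D.dB_ρ, map_zero,
      Φ.dB_dx _ _ (Φ.dx 0 (ξ 0)), D.dB_dx_ξ] at this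
    exact eq_zero_of_two_mul (by linear_combination this)
  have hlxS : ∀ i, Φ.dS (Φ.dx i l) = 0 := fun i => by
    have := congrArg Φ.dS (hlx i)
    simp only [map_sub, derivation_two_mul, Φ.dS_dx _ (Φ.dQ ρ), Φ.dS_dQ, hSρ, map_zero,
      Φ.dS_dx _ (Φ.dx 0 (ξ 0)), hdxX] at this
    exact eq_zero_of_two_mul (by linear_combination this)
  -- At the zero jet `dx m ρ` equals `σ` times this expression. Both `dx m ρ` and the expression are
  -- free of `σ`, so the `σ`-derivative shows that the expression vanishes.
  have hc : ∀ m, ∑ a, ∑ b, Φ.dx a (Φ.dx b (ξ m)) * Φ.B b * Φ.B a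
      + (∑ a, Φ.B a * Φ.dx a l) * Φ.B m = 0 := fun m => by
    have h1 := congrArg Φ.dS (hF m)
    rw [D.sum_dx_β m] at h1
    simp only [zero_mul, add_zero] at h1
    rw [Φ.dS_dx, hSρ, map_zero, Derivation.leibniz, hσ] at h1
    simp only [mul_comm (Φ.B _) (Φ.dx _ _), map_add, map_sum, dS_mul_B, hlxS, Φ.dS_dx _ (Φ.dx _ _),
      hdxX, map_zero, zero_mul, Finset.sum_const_zero,
      add_zero, smul_eq_mul, mul_one, mul_zero,
      zero_add] at h1
    rw [h1]
    simp only [mul_comm (Φ.B _) (Φ.dx _ _)]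
  obtain ⟨h1, h2⟩ := D.affine (fun a => Φ.dx a l) (fun _ => 0) hlxB (by simp) hc
  refine ⟨l, ⟨D.dB_ξ, D.dQ_ξ, hSξ, h1, D.killing_ne, D.killing_self, D.β_eq, D.κ_eq 0,
    fun m => ?_, D.dB_ρ, hSρ, hρQQ, h2, D.dB_l⟩⟩
  rw [hF m, D.sum_dx_β m, hc m]
  simp

lemma CGLSymmetric.balanced (H : Φ.CGLSymmetric ξ β ρ κ) : Φ.Balanced ξ β ρ κ 1 where
  div_eq b hb := (H b _ 0 hb (fun _ => by simp)).1
  force_eq b hb m := by simpa [stateRes] using (H b _ 0 hb (fun _ => by simp)).2 m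

/-- Here `∇σ` is arbitrary, at the price of a pressure gradient `(B·∇σ)B`. These additional jets
give `dS l = -B² dQ l`, which together with `dB_l` excludes the infinite family. -/
lemma CGLSymmetric.solved (H : Φ.CGLSymmetric ξ β ρ κ) (hσ : Φ.dS Φ.σ = 1) :
    ∃ l, Φ.Solved ξ β ρ κ l ∧ Φ.dQ l = 0 ∧ Φ.dS l = 0 := by
  have D := H.balanced.determining
  have hF := H.balanced.force_const
  have hdiv := H.balanced.div_const
  generalize Φ.dB 0 (β 0) - Φ.dx 0 (ξ 0) + Φ.σ * Φ.B 0 * Φ.dQ (β 0) = l at D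
  have hSξ : ∀ a, Φ.dS (ξ a) = 0 := fun j => by
    obtain ⟨i, hji⟩ := exists_other j
    have hb : ∑ a, unitJet i j a a = (0 : A) := by simp [unitJet, hji.symm]
    have h1 := (H (unitJet i j) (fun m => Φ.σ * ∑ a, unitJet i j m a * Φ.B a + Φ.B i * Φ.B m)
      (fun m => if m = i then 1 else 0) hb (fun _ => by simp)).1
    have h2 := (H (-unitJet i j) (-fun m => Φ.σ * ∑ a, unitJet i j m a * Φ.B a + Φ.B i * Φ.B m)
      (-fun m => if m = i then 1 else 0) (by simp [hb]) (fun _ => by simp; ring)).1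
    have h3 := (Φ.divRes_split H.balanced.div_zero h1 h2).2
    simpa [unitJet, D.dB_ξ, D.dQ_ξ] using h3
  have hdxX : ∀ i a, Φ.dS (Φ.dx i (ξ a)) = 0 := fun i a => by rw [Φ.dS_dx, hSξ, map_zero]
  have hSρ : Φ.dS ρ = 0 := by
    have h0 := (H 0 0 0 (by simp) (fun _ => by simp)).2
    have h1 := (H 0 (fun m => Φ.B 0 * Φ.B m) (fun m => if m = 0 then 1 else 0) (by simp)
      (fun _ => by simp)).2
    have h2 := (H 0 (fun m => Φ.B 1 * Φ.B m) (fun m => if m = 1 then 1 else 0) (by simp)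
      (fun _ => by simp)).2
    -- The combination `B₁ e1 - B₀ e2` mimics the gradient `(B₁, -B₀, 0)` of `σ`, which is
    -- orthogonal to `B` and needs no pressure gradient. The terms in `β` cancel because `β - (∂ξ)B`
    -- is parallel to `B`.
    have e0 := h0 0
    have e1 := h1 0
    have e2 := h2 0
    have hβ0 := D.β_eq 0
    have hβ1 := D.β_eq 1
    simp [forceRes, stateRes, tot, D.dQ_ξ, hSξ, Fin.sum_univ_three] at e0 e1 e2 hβ0 hβ1
    apply Φ.eq_zero_of_B_mul 1
    linear_combination Φ.B 1 * (e1 - e0) - Φ.B 0 * (e2 - e0) + Φ.B 1 * Φ.B 0 * hβ0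
      - Φ.B 0 ^ 2 * hβ1
  have hκB : ∀ i, Φ.dB i κ = - Φ.σ * Φ.dQ κ * Φ.B i := fun i => by
    linear_combination D.n_eq i
  have hρQQ := D.dQ_dQ_ρ hκB
  have hβS : Φ.dS (β 0) = Φ.dS l * Φ.B 0 := by
    rw [D.β_eq 0, map_add, map_sum]
    simp only [dS_mul_B, hdxX, zero_mul, Finset.sum_const_zero, zero_add]
  have hlS : Φ.dS l = - (Φ.B 0 ^ 2 + Φ.B 1 ^ 2 + Φ.B 2 ^ 2) * Φ.dQ l := by
    have h0 := (H 0 0 0 (by simp) (fun _ => by simp)).1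
    have h1 := (H 0 (fun m => Φ.B 0 * Φ.B m) (fun m => if m = 0 then 1 else 0) (by simp)
      (fun _ => by simp)).1
    simp [divRes, tot, hSξ, D.dQ_ξ, Fin.sum_univ_three, D.dQ_β, hβS] at h0 h1
    rw [← sub_eq_zero]
    apply Φ.eq_zero_of_B_mul 0
    linear_combination h1 - h0
  -- The operators `dB 0 + σ B₀ dQ` and `dS + B² dQ` both annihilate `l`, hence so does their
  -- commutator, which is `B₀ dQ`.
  have hlQ : Φ.dQ l = 0 := by
    have h1 := congrArg Φ.dS (D.dB_l 0)
    have h2 := congrArg (Φ.dB 0) hlS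
    have h3 := congrArg Φ.dQ hlS
    have h4 := congrArg Φ.dQ (D.dB_l 0)
    rw [Φ.dS_dB] at h1
    simp only [Derivation.leibniz, Derivation.leibniz_pow, map_neg, map_add, Φ.dB_B_self,
      Φ.dB_B_ne 0 1 (by decide), Φ.dB_B_ne 0 2 (by decide), Φ.dQ_B, Φ.dS_B, hσ, Φ.dS_dQ, Φ.dB_dQ,
      Φ.dQ_σ, smul_eq_mul, smul_zero, mul_zero, zero_add, add_zero, neg_zero, mul_one, pow_one,
      nsmul_eq_mul, Nat.cast_ofNat, Nat.add_one_sub_one] at h1 h2 h3 h4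
    apply Φ.eq_zero_of_B_mul 0
    linear_combination h2 - h1 + Φ.σ * Φ.B 0 * h3 - (Φ.B 0 ^ 2 + Φ.B 1 ^ 2 + Φ.B 2 ^ 2) * h4
  have hlS0 : Φ.dS l = 0 := by rw [hlS, hlQ, mul_zero]
  have hlB : ∀ i, Φ.dB i l = 0 := fun i => by rw [D.dB_l, hlQ, mul_zero, zero_mul]
  set k := Φ.dQ ρ - 2 * Φ.dx 0 (ξ 0) - 2 * l with hk
  have hkS : Φ.dS k = 0 := by
    simp only [hk, map_sub, derivation_two_mul, Φ.dS_dQ, hSρ, map_zero, hdxX, hlS0]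
    ring
  have hkB : ∀ i, Φ.dB i k = 0 := fun i => by
    simp only [hk, map_sub, derivation_two_mul, Φ.dB_dQ, D.dB_ρ, map_zero, D.dB_dx_ξ, hlB]
    ring
  have hκx : ∀ i, Φ.dx i κ = Φ.σ * Φ.dx i k := fun i => by
    rw [D.κ_eq 0, Derivation.leibniz, Φ.dx_σ, smul_zero, add_zero, smul_eq_mul]
  have hF' : ∀ m, Φ.dx m ρ = Φ.σ * (∑ a, ∑ b, Φ.dx a (Φ.dx b (ξ m)) * Φ.B b * Φ.B a
      + (∑ a, Φ.B a * Φ.dx a (l + k)) * Φ.B m) := fun m => by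
    rw [hF m, D.sum_dx_β m]
    simp only [hκx, map_add, mul_add, Finset.sum_add_distrib, Finset.mul_sum, add_mul,
      Finset.sum_mul, add_assoc]
    congr 2
    exact Finset.sum_congr rfl fun a _ => by ring
  have hc : ∀ m, ∑ a, ∑ b, Φ.dx a (Φ.dx b (ξ m)) * Φ.B b * Φ.B a
      + (∑ a, Φ.B a * Φ.dx a (l + k)) * Φ.B m = 0 := fun m => by
    have h1 := congrArg Φ.dS (hF' m)
    rw [Φ.dS_dx, hSρ, map_zero, Derivation.leibniz, hσ] at h1
    simp only [mul_comm (Φ.B _) (Φ.dx _ _), Φ.dS.map_add, map_sum, dS_mul_B, hlS0, hkS,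
      Φ.dS_dx _ (l + k), Φ.dS_dx _ (Φ.dx _ _), hdxX, map_zero, zero_mul, Finset.sum_const_zero, add_zero, smul_eq_mul, mul_one, mul_zero,
      zero_add] at h1
    rw [h1]
    simp only [mul_comm (Φ.B _) (Φ.dx _ _)]
  obtain ⟨h1, h2⟩ := D.affine (fun a => Φ.dx a (l + k)) (fun _ => 0)
    (fun a i => by rw [Φ.dB_dx, map_add, hlB, hkB, add_zero, map_zero]) (by simp) hc
  -- The force balance controls only `l + k`. Once `ξ` is affine, the divergence equation at the
  -- zero jet becomes `B·∂l = 0`, and `l` is free of `B`.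
  have hlx : ∀ i, Φ.dx i l = 0 := fun i => by
    simp only [D.dx_β, h1, zero_mul, Finset.sum_const_zero, zero_add] at hdiv
    have := congrArg (Φ.dB i) hdiv
    rw [Φ.dB_sum_mul, map_zero] at this
    simpa [Φ.dB_dx, hlB] using this
  refine ⟨l, ⟨D.dB_ξ, D.dQ_ξ, hSξ, h1, D.killing_ne, D.killing_self, D.β_eq, D.κ_eq 0,
    fun m => ?_, D.dB_ρ, hSρ, hρQQ, hlx, D.dB_l⟩, hlQ, hlS0⟩
  rw [hF' m, hc m, mul_zero]

end FieldFrame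

end

noncomputable section

/-! ### The frame of an open set of the base -/

section Frame

variable {n m : ℕ} {M : Set (Base n m)}

namespace smoothFun

/-- The unit vector in the direction of an independent variable. -/
def ex (i : Fin n) : Base n m := (Pi.single i 1, 0)

/-- The unit vector in the direction of a dependent variable. -/
def eu (k : Fin m) : Base n m := (0, Pi.single k 1)

/-- An independent variable, as a function on `M`. -/
def cx (M : Set (Base n m)) (a : Fin n) : smoothFun M := mk (fun z => z.1 a) (by fun_prop)

/-- A dependent variable, as a function on `M`. -/
def cu (M : Set (Base n m)) (k : Fin m) : smoothFun M := mk (fun z => z.2 k) (by fun_prop)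

lemma dir_cx (hM : IsOpen M) (v : Base n m) (a : Fin n) :
    dir hM v (cx M a) = algebraMap ℝ _ (v.1 a) := by
  ext z
  have h : HasFDerivAt (fun z : Base n m => z.1 a)
      ((ContinuousLinearMap.proj (R := ℝ) (φ := fun _ => ℝ) a).comp
        (ContinuousLinearMap.fst ℝ (Fin n → ℝ) (Fin m → ℝ))) z.1 :=
    ((ContinuousLinearMap.proj (R := ℝ) (φ := fun _ => ℝ) a).comp
      (ContinuousLinearMap.fst ℝ (Fin n → ℝ) (Fin m → ℝ))).hasFDerivAt
  rw [cx, dir_mk_apply, h.fderiv]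
  rfl

lemma dir_cu (hM : IsOpen M) (v : Base n m) (k : Fin m) :
    dir hM v (cu M k) = algebraMap ℝ _ (v.2 k) := by
  ext z
  have h : HasFDerivAt (fun z : Base n m => z.2 k)
      ((ContinuousLinearMap.proj (R := ℝ) (φ := fun _ => ℝ) k).comp
        (ContinuousLinearMap.snd ℝ (Fin n → ℝ) (Fin m → ℝ))) z.1 :=
    ((ContinuousLinearMap.proj (R := ℝ) (φ := fun _ => ℝ) k).comp
      (ContinuousLinearMap.snd ℝ (Fin n → ℝ) (Fin m → ℝ))).hasFDerivAt
  rw [cu, dir_mk_apply, h.fderiv]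
  rfl

lemma totalDeriv_eq (hM : IsOpen M) (g : Base n m → ℝ) (hg : ContDiffOn ℝ ∞ g M) (i : Fin n)
    (z : M) (w : Fin m → Fin n → ℝ) :
    totalDeriv g i (z.1, w)
      = (dir hM (ex i) (mk g hg)).1 z + ∑ l, w l i * (dir hM (eu l) (mk g hg)).1 z := by
  have hv : ((Pi.single i 1, fun l => w l i) : Base n m) = ex i + ∑ l, w l i • eu l := by
    refine Prod.ext ?_ ?_
    · simp [ex, eu, Prod.fst_sum]
    · funext k
      simp [ex, eu, Prod.snd_sum, Pi.single_apply]
  simp only [dir_mk_apply]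
  rw [totalDeriv, hv, map_add, map_sum]
  simp

/-- A smooth function is constant if its partial derivatives vanish. -/
lemma exists_const (hM : IsOpen M) (hc : IsConnected M) (f : smoothFun M)
    (h1 : ∀ i, dir hM (ex i) f = 0) (h2 : ∀ k, dir hM (eu k) f = 0) :
    ∃ c : ℝ, f = algebraMap ℝ (smoothFun M) c := by
  refine exists_eq_algebraMap hM hc f fun v => ?_
  have hv : v = ∑ i, v.1 i • ex i + ∑ l, v.2 l • eu l := by
    refine Prod.ext ?_ ?_ <;> funext k <;>
      simp [ex, eu, Prod.fst_sum, Prod.snd_sum, Pi.single_apply]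
  ext z
  have h1' : ∀ i, fderiv ℝ (extension f) z (ex i) = 0 := fun i =>
    congrFun (congrArg Subtype.val (h1 i)) z
  have h2' : ∀ i, fderiv ℝ (extension f) z (eu i) = 0 := fun i =>
    congrFun (congrArg Subtype.val (h2 i)) z
  rw [dir_apply, hv, map_add, map_sum, map_sum]
  simp [h1', h2']

end smoothFun

open smoothFun

/-- The frame of `M` for magnetic components `u (ι k)`, pressure component `u p` and a parameter
`σ` that varies in direction `w`. -/
def fieldFrame {M : Set (Base 3 m)} (hM : IsOpen M) (ι : Fin 3 → Fin m) (hι : Function.Injective ι)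
    (p : Fin m) (hp : ∀ k, ι k ≠ p) (w : Base 3 m) (hw : ∀ k, w.2 (ι k) = 0) (σ : smoothFun M)
    (hx : ∀ i, dir hM (ex i) σ = 0) (hB : ∀ k, dir hM (eu (ι k)) σ = 0)
    (hQ : dir hM (eu p) σ = 0) (h0 : ∀ f, σ * f = 0 → f = 0) : FieldFrame (smoothFun M) where
  dx i := dir hM (ex i)
  -- This is the derivative in `B_k` at fixed `Q = p + B²/2`, so `p` has to change by `-B_k`.
  dB k := dir hM (eu (ι k)) - cu M (ι k) • dir hM (eu p)
  dQ := dir hM (eu p)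
  dS := dir hM w
  B k := cu M (ι k)
  σ := σ
  dx_B i k := by simp [dir_cu, ex]
  dB_B_self i := by simp [dir_cu, eu, hp]
  dB_B_ne i k hik := by simp [dir_cu, eu, hp, (hι.ne hik).symm]
  dQ_B k := by simp [dir_cu, eu, hp]
  dS_B k := by simp [dir_cu, hw]
  dx_σ := hx
  dB_σ i := by simp [hB, hQ]
  dQ_σ := hQ
  dx_dx i k f := dir_comm hM _ _ f
  dB_dx i k f := by
    simp [dir_cu, ex]
    rw [dir_comm hM (eu (ι i)) (Pi.single k 1, 0), dir_comm hM (eu p) (Pi.single k 1, 0)]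
  dQ_dx k f := dir_comm hM _ _ f
  dB_dQ k f := by
    simp [dir_cu, eu, hp]
    rw [dir_comm hM (0, Pi.single (ι k) 1)]
  dS_dx k f := dir_comm hM _ _ f
  dS_dB k f := by
    simp [dir_cu, hw]
    rw [dir_comm hM w (eu (ι k)), dir_comm hM w (eu p)]
  dS_dQ f := dir_comm hM _ _ f
  eq_zero_of_B_mul k f h := by
    refine eq_zero_of_mul_eq_zero hM (cu M (ι k)) f (v := eu (ι k)) (c := 1) one_ne_zero
      (fun z t h h' => ?_) (fun z => congrFun (congrArg Subtype.val h) z)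
    simp [cu, eu]
  eq_zero_of_σ_mul := h0

end Frame

end

noncomputable section

/-! ### Linearization of the systems -/

section Linearization

lemma fderiv_jet_u {n m : ℕ} (k : Fin m) (j d : Jet n m) :
    fderiv ℝ (fun j : Jet n m => j.1.2 k) j d = d.1.2 k := by
  have h := ((ContinuousLinearMap.proj (R := ℝ) (φ := fun _ => ℝ) k).comp
    ((ContinuousLinearMap.snd ℝ (Fin n → ℝ) (Fin m → ℝ)).comp
      (ContinuousLinearMap.fst ℝ (Base n m) (Fin m → Fin n → ℝ)))).hasFDerivAt (x := j)
  exact congrArg (fun L => L d) h.fderiv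

lemma fderiv_jet_w {n m : ℕ} (k : Fin m) (i : Fin n) (j d : Jet n m) :
    fderiv ℝ (fun j : Jet n m => j.2 k i) j d = d.2 k i := by
  have h := ((ContinuousLinearMap.proj (R := ℝ) (φ := fun _ => ℝ) i).comp
    ((ContinuousLinearMap.proj (R := ℝ) (φ := fun _ : Fin m => Fin n → ℝ) k).comp
      (ContinuousLinearMap.snd ℝ (Base n m) (Fin m → Fin n → ℝ)))).hasFDerivAt (x := j)
  exact congrArg (fun L => L d) h.fderiv

/-- The indices of the magnetic components among the dependent variables of the CGL system. -/
def CGL.mag : Fin 3 → Fin 5 := ![0, 1, 2]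

/-- The indices of the magnetic components among the dependent variables of the MHD system. -/
def MHD.mag : Fin 3 → Fin 4 := ![0, 1, 2]

open CGL in
-- From `curl B × B = (B·∇)B - ∇(B²/2)`: the coefficients `-(1 - τ)` and `-τ` of `∇(B²/2)` add up to
-- `-1`, which makes `p⊥ + B²/2` the natural pressure variable.
lemma cglForce_apply (j : Jet 3 5) (i : Fin 3) :
    cglForce j i = (1 - j.1.2 4) * ∑ k, j.2 (mag i) k * j.1.2 (mag k)
      - (j.2 3 i + ∑ k, j.1.2 (mag k) * j.2 (mag k) i)
      - (∑ k, j.1.2 (mag k) * j.2 4 k) * j.1.2 (mag i) := by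
  simp only [cglForce, Pi.sub_apply, Pi.add_apply, Pi.smul_apply, smul_eq_mul, jetGradHalfSq,
    cross_apply, jetCurl, dotProduct, Fin.sum_univ_three, mag]
  fin_cases i <;> simp <;> ring

open CGL in
lemma fderiv_cglForce (j d : Jet 3 5) (i : Fin 3) :
    fderiv ℝ (fun j => cglForce j i) j d
      = - d.1.2 4 * ∑ k, j.2 (mag i) k * j.1.2 (mag k)
        + (1 - j.1.2 4) * ∑ k, (d.2 (mag i) k * j.1.2 (mag k) + j.2 (mag i) k * d.1.2 (mag k))
        - (d.2 3 i + ∑ k, (d.1.2 (mag k) * j.2 (mag k) i + j.1.2 (mag k) * d.2 (mag k) i))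
        - (∑ k, (d.1.2 (mag k) * j.2 4 k + j.1.2 (mag k) * d.2 4 k)) * j.1.2 (mag i)
        - (∑ k, j.1.2 (mag k) * j.2 4 k) * d.1.2 (mag i) := by
  have h : (fun j => cglForce j i) = _ := funext fun j => cglForce_apply j i
  rw [h]
  simp (disch := fun_prop) only [Fin.sum_univ_three, fderiv_fun_sub, fderiv_fun_add, fderiv_fun_mul,
    fderiv_fun_const, Pi.zero_apply, zero_sub, sub_apply, add_apply, smul_apply, neg_apply,
    fderiv_jet_u, fderiv_jet_w, smul_eq_mul]
  ring

lemma differentiable_cglForce (i : Fin 3) : Differentiable ℝ (fun j => cglForce j i) := by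
  have h : (fun j => cglForce j i) = _ := funext fun j => cglForce_apply j i
  rw [h]
  fun_prop

open CGL in
lemma fderiv_cglSystem_eq_zero_iff (j d : Jet 3 5) : fderiv ℝ cglSystem j d = 0 ↔
    ∑ k, d.2 (mag k) k = 0 ∧ ∀ i, fderiv ℝ (fun j => cglForce j i) j d = 0 := by
  have hd : ∀ k, DifferentiableAt ℝ (fun j => cglSystem j k) j := fun k => by
    fin_cases k
    · exact (differentiable_cglForce 0) j
    · exact (differentiable_cglForce 1) j
    · exact (differentiable_cglForce 2) j
    · simp [cglSystem, jetDiv]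
      fun_prop
  have h3 : fderiv ℝ (fun j => cglSystem j 3) j d = ∑ k, d.2 (mag k) k := by
    simp (disch := fun_prop) [cglSystem, jetDiv, mag, Fin.sum_univ_three, fderiv_fun_add,
      fderiv_jet_w]
  rw [show cglSystem = fun j k => cglSystem j k from rfl, fderiv_pi hd, ← h3]
  constructor
  · intro h
    have h' := fun k => congrFun h k
    exact ⟨h' 3, fun i => by fin_cases i; exacts [h' 0, h' 1, h' 2]⟩
  · rintro ⟨h, h'⟩
    funext k
    fin_cases k
    exacts [h' 0, h' 1, h' 2, h]

open CGL in
lemma fderiv_cglStateSystem_eq_zero_iff (j d : Jet 3 5) : fderiv ℝ cglStateSystem j d = 0 ↔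
    ∑ k, d.2 (mag k) k = 0 ∧ ∑ k, (d.1.2 (mag k) * j.2 4 k + j.1.2 (mag k) * d.2 4 k) = 0 ∧
      ∀ i, fderiv ℝ (fun j => cglForce j i) j d = 0 := by
  have hd : ∀ k, DifferentiableAt ℝ (fun j => cglStateSystem j k) j := fun k => by
    fin_cases k
    · exact (differentiable_cglForce 0) j
    · exact (differentiable_cglForce 1) j
    · exact (differentiable_cglForce 2) j
    · simp [cglStateSystem, jetDiv]
      fun_prop
    · simp [cglStateSystem, dotProduct, Fin.sum_univ_three]
      fun_prop
  have h3 : fderiv ℝ (fun j => cglStateSystem j 3) j d = ∑ k, d.2 (mag k) k := by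
    simp (disch := fun_prop) [cglStateSystem, jetDiv, mag, Fin.sum_univ_three, fderiv_fun_add,
      fderiv_jet_w]
  have h4 : fderiv ℝ (fun j => cglStateSystem j 4) j d
      = ∑ k, (d.1.2 (mag k) * j.2 4 k + j.1.2 (mag k) * d.2 4 k) := by
    simp (disch := fun_prop) [cglStateSystem, mag, Fin.sum_univ_three, fderiv_fun_add,
      fderiv_fun_mul, fderiv_jet_w, fderiv_jet_u, dotProduct]
    ring
  rw [show cglStateSystem = fun j k => cglStateSystem j k from rfl, fderiv_pi hd, ← h3, ← h4]
  constructor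
  · intro h
    have h' := fun k => congrFun h k
    exact ⟨h' 3, h' 4, fun i => by fin_cases i; exacts [h' 0, h' 1, h' 2]⟩
  · rintro ⟨h, h'', h'⟩
    funext k
    fin_cases k
    exacts [h' 0, h' 1, h' 2, h, h'']

open CGL in
lemma cglSystem_eq_zero_iff (j : Jet 3 5) : cglSystem j = 0 ↔
    ∑ k, j.2 (mag k) k = 0 ∧ ∀ i, cglForce j i = 0 := by
  have h3 : cglSystem j 3 = ∑ k, j.2 (mag k) k := by
    simp [cglSystem, jetDiv, mag, Fin.sum_univ_three]
  rw [← h3]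
  constructor
  · intro h
    have h' := fun k => congrFun h k
    exact ⟨h' 3, fun i => by fin_cases i; exacts [h' 0, h' 1, h' 2]⟩
  · rintro ⟨h, h'⟩
    funext k
    fin_cases k
    exacts [h' 0, h' 1, h' 2, h]

open CGL in
lemma cglStateSystem_eq_zero_iff (j : Jet 3 5) : cglStateSystem j = 0 ↔
    ∑ k, j.2 (mag k) k = 0 ∧ ∑ k, j.1.2 (mag k) * j.2 4 k = 0 ∧ ∀ i, cglForce j i = 0 := by
  have h3 : cglStateSystem j 3 = ∑ k, j.2 (mag k) k := by
    simp [cglStateSystem, jetDiv, mag, Fin.sum_univ_three]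
  have h4 : cglStateSystem j 4 = ∑ k, j.1.2 (mag k) * j.2 4 k := by
    simp [cglStateSystem, mag, Fin.sum_univ_three, dotProduct]
  rw [← h3, ← h4]
  constructor
  · intro h
    have h' := fun k => congrFun h k
    exact ⟨h' 3, h' 4, fun i => by fin_cases i; exacts [h' 0, h' 1, h' 2]⟩
  · rintro ⟨h, h'', h'⟩
    funext k
    fin_cases k
    exacts [h' 0, h' 1, h' 2, h, h'']

/-- The force balance of the static MHD system. -/
def mhdForce (j : Jet 3 4) (i : Fin 3) : ℝ :=
  ∑ k, j.2 (MHD.mag i) k * j.1.2 (MHD.mag k)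
    - (j.2 3 i + ∑ k, j.1.2 (MHD.mag k) * j.2 (MHD.mag k) i)

open MHD in
lemma mhdSystem_eq (j : Jet 3 4) : mhdSystem j
    = ![mhdForce j 0, mhdForce j 1, mhdForce j 2, ∑ k, j.2 (mag k) k] := by
  funext k
  fin_cases k <;>
    simp [mhdSystem, mhdForce, mag, Fin.sum_univ_three, crossProduct, jetCurl, jetDiv] <;> ring

open MHD in
lemma fderiv_mhdForce (j d : Jet 3 4) (i : Fin 3) :
    fderiv ℝ (fun j => mhdForce j i) j d
      = ∑ k, (d.2 (mag i) k * j.1.2 (mag k) + j.2 (mag i) k * d.1.2 (mag k))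
        - (d.2 3 i + ∑ k, (d.1.2 (mag k) * j.2 (mag k) i + j.1.2 (mag k) * d.2 (mag k) i)) := by
  simp (disch := fun_prop) only [mhdForce, Fin.sum_univ_three, fderiv_fun_sub, fderiv_fun_add,
    fderiv_fun_mul, sub_apply, add_apply, smul_apply,
    fderiv_jet_u, fderiv_jet_w, smul_eq_mul]
  ring

open MHD in
lemma fderiv_mhdSystem_eq_zero_iff (j d : Jet 3 4) : fderiv ℝ mhdSystem j d = 0 ↔
    ∑ k, d.2 (mag k) k = 0 ∧ ∀ i, fderiv ℝ (fun j => mhdForce j i) j d = 0 := by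
  have hf : ∀ i, DifferentiableAt ℝ (fun j => mhdForce j i) j := fun i => by
    unfold mhdForce
    fun_prop
  have hd : ∀ k, DifferentiableAt ℝ (fun j => mhdSystem j k) j := fun k => by
    simp only [mhdSystem_eq]
    fin_cases k
    · exact hf 0
    · exact hf 1
    · exact hf 2
    · simp
      fun_prop
  have h3 : fderiv ℝ (fun j => mhdSystem j 3) j d = ∑ k, d.2 (mag k) k := by
    simp (disch := fun_prop) [mhdSystem_eq, Fin.sum_univ_three, fderiv_fun_add, fderiv_jet_w]
  have hF : ∀ i : Fin 3, (fun j => mhdSystem j i.castSucc) = fun j => mhdForce j i := fun i => by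
    funext j
    rw [mhdSystem_eq]
    fin_cases i <;> rfl
  rw [show mhdSystem = fun j k => mhdSystem j k from rfl, fderiv_pi hd, ← h3]
  constructor
  · intro h
    have h' := fun k => congrFun h k
    exact ⟨h' 3, fun i => by rw [← hF]; exact h' i.castSucc⟩
  · rintro ⟨h, h'⟩
    simp only [← hF] at h'
    funext k
    fin_cases k
    exacts [h' 0, h' 1, h' 2, h]

open MHD in
lemma mhdSystem_eq_zero_iff (j : Jet 3 4) : mhdSystem j = 0 ↔
    ∑ k, j.2 (mag k) k = 0 ∧ ∀ i, mhdForce j i = 0 := by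
  rw [mhdSystem_eq]
  constructor
  · intro h
    have h' := fun k => congrFun h k
    exact ⟨h' 3, fun i => by fin_cases i; exacts [h' 0, h' 1, h' 2]⟩
  · rintro ⟨h, h'⟩
    funext k
    fin_cases k
    exacts [h' 0, h' 1, h' 2, h]

end Linearization

end

/-! ### Evaluation at points, and the CGL prolongation in terms of the frame. -/

noncomputable section

open smoothFun

namespace smoothFun

section
variable {V : Type*} [NormedAddCommGroup V] [NormedSpace ℝ V] {M : Set V}

/-- Evaluation at a point. -/
def ev (z : M) : smoothFun M →ₐ[ℝ] ℝ :=
  (Pi.evalAlgHom ℝ (fun _ : M => ℝ) z).comp (smoothFun M).val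

lemma ev_eq (z : M) (f : smoothFun M) : ev z f = f.1 z := rfl

lemma ext_ev {f g : smoothFun M} (h : ∀ z, ev z f = ev z g) : f = g := by
  ext z
  exact h z

lemma dir_neg (hM : IsOpen M) (v : V) (f : smoothFun M) : dir hM (-v) f = - dir hM v f := by
  apply ext_ev
  intro z
  rw [map_neg, ev_eq, ev_eq, dir_apply, dir_apply, map_neg]

lemma dir_zero (hM : IsOpen M) (f : smoothFun M) : dir hM (0 : V) f = 0 := by
  apply ext_ev
  intro z
  rw [map_zero, ev_eq, dir_apply, map_zero]
end

section
variable {n m : ℕ} {M : Set (Base n m)} {v : Base n m → Base n m}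

/-- The components of a vector field along the independent variables. -/
def xi (hv : ContDiffOn ℝ ∞ v M) (a : Fin n) : smoothFun M :=
  mk (fun z => (v z).1 a) (contDiffOn_pi.1 hv.fst a)

/-- The components of a vector field along the dependent variables. -/
def eta (hv : ContDiffOn ℝ ∞ v M) (k : Fin m) : smoothFun M :=
  mk (fun z => (v z).2 k) (contDiffOn_pi.1 hv.snd k)

lemma ev_xi (hv : ContDiffOn ℝ ∞ v M) (a : Fin n) (z : M) : ev z (xi hv a) = (v z).1 a := rfl

lemma ev_eta (hv : ContDiffOn ℝ ∞ v M) (k : Fin m) (z : M) : ev z (eta hv k) = (v z).2 k := rfl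

lemma ev_cu (k : Fin m) (z : M) : ev z (cu M k) = z.1.2 k := rfl

lemma ev_cx (k : Fin n) (z : M) : ev z (cx M k) = z.1.1 k := rfl
end

end smoothFun

lemma FieldFrame.tot_add {A : Type*} [CommRing A] [Algebra ℝ A] (Φ : FieldFrame A)
    (b : Fin 3 → Fin 3 → A) (q h : Fin 3 → A) (i : Fin 3) (f g : A) :
    Φ.tot b q h i (f + g) = Φ.tot b q h i f + Φ.tot b q h i g := by
  simp only [tot, map_add, mul_add, Finset.sum_add_distrib]
  ring

lemma FieldFrame.tot_map_neg {A : Type*} [CommRing A] [Algebra ℝ A] (Φ : FieldFrame A)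
    (b : Fin 3 → Fin 3 → A) (q h : Fin 3 → A) (i : Fin 3) (f : A) :
    Φ.tot b q h i (-f) = - Φ.tot b q h i f := by
  simp only [tot, map_neg, mul_neg, Finset.sum_neg_distrib]
  ring

lemma FieldFrame.tot_mul {A : Type*} [CommRing A] [Algebra ℝ A] (Φ : FieldFrame A)
    (b : Fin 3 → Fin 3 → A) (q h : Fin 3 → A) (i : Fin 3) (f g : A) :
    Φ.tot b q h i (f * g) = f * Φ.tot b q h i g + g * Φ.tot b q h i f := by
  simp only [tot, Derivation.leibniz, smul_eq_mul, Fin.sum_univ_three]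
  ring

lemma FieldFrame.tot_B {A : Type*} [CommRing A] [Algebra ℝ A] (Φ : FieldFrame A)
    (b : Fin 3 → Fin 3 → A) (q h : Fin 3 → A) (i k : Fin 3) :
    Φ.tot b q h i (Φ.B k) = b k i := by
  rw [tot, Φ.dx_B, Φ.dQ_B, Φ.dS_B, Finset.sum_eq_single k]
  · simp [Φ.dB_B_self]
  · intro j _ hj
    rw [Φ.dB_B_ne j k hj, mul_zero]
  · simp

lemma FieldFrame.tot_pressure {A : Type*} [CommRing A] [Algebra ℝ A] (Φ : FieldFrame A)
    (b : Fin 3 → Fin 3 → A) (q h : Fin 3 → A) (i : Fin 3) (p : A) (β : Fin 3 → A) :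
    Φ.tot b q h i (p + ∑ k, Φ.B k * β k)
      = Φ.tot b q h i p + ∑ k, (Φ.B k * Φ.tot b q h i (β k) + β k * b k i) := by
  simp only [Fin.sum_univ_three, tot_add, tot_mul, tot_B]

namespace CGL

variable {M : Set (Base 3 5)} (hM : IsOpen M)

/-- The frame of the CGL systems, with `σ = 1 - τ`. -/
def frame : FieldFrame (smoothFun M) :=
  fieldFrame hM mag (by decide) 3 (by decide) (-eu 4)
    (fun k => by fin_cases k <;> simp [eu, mag]) (1 - cu M 4)
    (fun i => by simp [dir_cu, ex]) (fun k => by fin_cases k <;> simp [dir_cu, eu, mag])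
    (by simp [dir_cu, eu])
    (fun f h => by
      refine eq_zero_of_mul_eq_zero hM (1 - cu M 4) f (v := eu 4) (c := -1) (by norm_num)
        (fun z t h h' => ?_) (fun z => congrFun (congrArg Subtype.val h) z)
      simp [cu, eu]
      ring)

lemma frame_dS_σ : (frame hM).dS (frame hM).σ = 1 := by
  simp [frame, fieldFrame, dir_cu, eu]

/-- The jet at `z` with the given derivatives of `B`, `Q = p + B² / 2` and `σ = 1 - τ`. -/
def jetAt (b : Fin 3 → Fin 3 → smoothFun M) (q h : Fin 3 → smoothFun M) (z : M) : Jet 3 5 :=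
  (z, ![fun i => ev z (b 0 i), fun i => ev z (b 1 i), fun i => ev z (b 2 i),
    fun i => ev z (q i) - ∑ k, z.1.2 (mag k) * ev z (b k i), fun i => - ev z (h i)])

variable (b : Fin 3 → Fin 3 → smoothFun M) (q h : Fin 3 → smoothFun M) (z : M)

lemma jetAt_mag (k i : Fin 3) : (jetAt b q h z).2 (mag k) i = ev z (b k i) := by
  fin_cases k <;> rfl

lemma jetAt_pressure (i : Fin 3) :
    (jetAt b q h z).2 3 i = ev z (q i) - ∑ k, z.1.2 (mag k) * ev z (b k i) := rfl

lemma jetAt_tau (i : Fin 3) : (jetAt b q h z).2 4 i = - ev z (h i) := rfl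

lemma jetAt_fst : (jetAt b q h z).1 = z := rfl

lemma ev_tot (g : Base 3 5 → ℝ) (hg : ContDiffOn ℝ ∞ g M) (i : Fin 3) :
    ev z ((frame hM).tot b q h i (mk g hg)) = totalDeriv g i (jetAt b q h z) := by
  rw [jetAt, totalDeriv_eq hM g hg]
  simp [FieldFrame.tot, frame, fieldFrame, dir_neg, Fin.sum_univ_five, Fin.sum_univ_three, ev_cu,
    mag, ← ev_eq]
  ring

variable {v : Base 3 5 → Base 3 5} (hv : ContDiffOn ℝ ∞ v M)

/-- The component along the total pressure `p + B² / 2`. -/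
def rho : smoothFun M := eta hv 3 + ∑ k, cu M (mag k) * eta hv (mag k)

lemma ev_div : ∑ k, (jetAt b q h z).2 (mag k) k = ev z (∑ i, b i i) := by
  simp only [jetAt_mag, map_sum]

lemma ev_state : ∑ k, (jetAt b q h z).1.2 (mag k) * (jetAt b q h z).2 4 k
    = - ev z (∑ k, (frame hM).B k * h k) := by
  simp only [jetAt_tau, map_sum, map_mul, mul_neg, Finset.sum_neg_distrib]
  rfl

lemma ev_force (i : Fin 3) : cglForce (jetAt b q h z) i
    = ev z ((frame hM).σ * ∑ j, b i j * (frame hM).B j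
      + (∑ j, (frame hM).B j * h j) * (frame hM).B i - q i) := by
  rw [cglForce_apply, ev_state hM]
  simp only [jetAt_mag, jetAt_pressure, jetAt_fst, map_sum, map_mul, map_sub, map_add,
    frame, fieldFrame, map_one, ev_cu]
  ring

lemma ev_totalDeriv_eta (k : Fin 5) (i : Fin 3) :
    totalDeriv (fun z => (v z).2 k) i (jetAt b q h z)
      = ev z ((frame hM).tot b q h i (eta hv k)) := (ev_tot hM b q h z _ _ i).symm

lemma ev_totalDeriv_xi (a i : Fin 3) :
    totalDeriv (fun z => (v z).1 a) i (jetAt b q h z)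
      = ev z ((frame hM).tot b q h i (xi hv a)) := (ev_tot hM b q h z _ _ i).symm

lemma ev_prolong_div : ∑ k, (prolong v (jetAt b q h z)).2 (mag k) k
    = ev z ((frame hM).divRes (xi hv) (fun k => eta hv (mag k)) b q h) := by
  simp only [prolong, FieldFrame.divRes, map_sub, map_sum, map_mul, jetAt_mag,
    ev_totalDeriv_eta hM b q h z hv, ev_totalDeriv_xi hM b q h z hv, Finset.sum_sub_distrib]

lemma ev_prolong_state : ∑ k, ((prolong v (jetAt b q h z)).1.2 (mag k) * (jetAt b q h z).2 4 k
      + (jetAt b q h z).1.2 (mag k) * (prolong v (jetAt b q h z)).2 4 k)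
    = - ev z ((frame hM).stateRes (xi hv) (fun k => eta hv (mag k)) (-eta hv 4) b q h) := by
  have hB : ∀ k, ev z ((frame hM).B k) = z.1.2 (mag k) := fun _ => rfl
  simp only [prolong, FieldFrame.stateRes, map_sub, map_sum, map_mul, map_add, map_neg, jetAt_tau,
    ev_totalDeriv_eta hM b q h z hv, ev_totalDeriv_xi hM b q h z hv, FieldFrame.tot_map_neg, hB, ev_eta,
    jetAt_fst, ← Finset.sum_add_distrib, ← Finset.sum_neg_distrib]
  refine Finset.sum_congr rfl fun i _ => ?_
  simp only [neg_mul, Finset.sum_neg_distrib]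
  ring

lemma ev_prolong_force (i : Fin 3) :
    fderiv ℝ (fun j => cglForce j i) (jetAt b q h z) (prolong v (jetAt b q h z))
    = ev z ((frame hM).stateRes (xi hv) (fun k => eta hv (mag k)) (-eta hv 4) b q h
        * (frame hM).B i + (∑ j, (frame hM).B j * h j) * eta hv (mag i)
        - (frame hM).forceRes (xi hv) (fun k => eta hv (mag k)) (rho hv) (-eta hv 4) b q h i) := by
  have hB : ∀ k, cu M (mag k) = (frame hM).B k := fun _ => rfl
  have hB' : ∀ k, ev z ((frame hM).B k) = z.1.2 (mag k) := fun _ => rfl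
  have hσ : ev z (frame hM).σ = 1 - z.1.2 4 := rfl
  rw [fderiv_cglForce, ev_prolong_state hM b q h z hv, ev_state hM]
  simp only [rho, hB, FieldFrame.forceRes, FieldFrame.tot_pressure]
  simp only [map_sub, map_add,
    map_mul, map_neg, prolong, jetAt_mag, jetAt_pressure, jetAt_fst, hB', hσ, ev_eta,
    ev_totalDeriv_eta hM b q h z hv, ev_totalDeriv_xi hM b q h z hv, Fin.sum_univ_three]
  ring

/-- A single jet is the value of a family with constant coefficients, so the frame identities apply
to every jet when the symmetry condition is verified. -/
lemma jetAt_eq (j : Jet 3 5) (hj : j.1 ∈ M) :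
    jetAt (fun k i => algebraMap ℝ (smoothFun M) (j.2 (mag k) i))
      (fun i => algebraMap ℝ _ (j.2 3 i + ∑ k, j.1.2 (mag k) * j.2 (mag k) i))
      (fun i => algebraMap ℝ _ (- j.2 4 i)) ⟨j.1, hj⟩ = j := by
  refine Prod.ext rfl ?_
  funext k i
  fin_cases k <;> simp [jetAt, mag]

end CGL

end

/-! ### Residuals of solved fields, and constants of integration. -/

noncomputable section

namespace FieldFrame

variable {A : Type*} [CommRing A] [Algebra ℝ A] {Φ : FieldFrame A}
  {ξ β : Fin 3 → A} {ρ κ l : A}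

/-- The departure of a jet from the force balance without the term in `B · grad σ`. -/
def residual (Φ : FieldFrame A) (b : Fin 3 → Fin 3 → A) (q : Fin 3 → A) (i : Fin 3) : A :=
  q i - Φ.σ * ∑ j, b i j * Φ.B j

namespace Solved

section
variable (S : Φ.Solved ξ β ρ κ l) (b : Fin 3 → Fin 3 → A) (q h : Fin 3 → A)
include S

lemma tot_ξ (i a : Fin 3) : Φ.tot b q h i (ξ a) = Φ.dx i (ξ a) := by
  simp [tot, S.dB_ξ, S.dQ_ξ, S.dS_ξ]

lemma tot_dx_ξ (i j a : Fin 3) : Φ.tot b q h i (Φ.dx j (ξ a)) = 0 := by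
  simp [tot, Φ.dB_dx, Φ.dQ_dx, Φ.dS_dx, S.dB_ξ, S.dQ_ξ, S.dS_ξ, S.dx_dx_ξ]

lemma tot_ρ (i : Fin 3) : Φ.tot b q h i ρ = q i * Φ.dQ ρ := by
  simp [tot, S.dx_ρ, S.dB_ρ, S.dS_ρ]

lemma tot_dQ_ρ (i : Fin 3) : Φ.tot b q h i (Φ.dQ ρ) = 0 := by
  simp [tot, ← Φ.dQ_dx, Φ.dB_dQ, Φ.dS_dQ, S.dx_ρ, S.dB_ρ, S.dS_ρ, S.dQ_dQ_ρ]

lemma tot_β (i m : Fin 3) : Φ.tot b q h i (β m)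
    = ∑ a, Φ.dx a (ξ m) * b a i + l * b m i + Φ.B m * Φ.tot b q h i l := by
  rw [S.β_eq m]
  simp only [Fin.sum_univ_three, tot_add, tot_mul, tot_B, S.tot_dx_ξ]
  ring

/-- The transport equation for `l` assembles the terms in `b` and `q` into the force residual. In
the closed system both sums on the right vanish on solutions, whatever `l` is; in the other systems
`dQ l` and `dS l` vanish. -/
lemma sum_B_tot_l : ∑ i, Φ.B i * Φ.tot b q h i l
    = Φ.dQ l * ∑ i, Φ.B i * Φ.residual b q i + Φ.dS l * ∑ i, Φ.B i * h i := by
  simp only [tot, residual, S.dx_l, S.dB_l, Fin.sum_univ_three]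
  ring

lemma divRes_eq : Φ.divRes ξ β b q h = l * ∑ i, b i i + ∑ i, Φ.B i * Φ.tot b q h i l := by
  simp only [divRes, S.tot_ξ, S.tot_β, Fin.sum_univ_three]
  ring

/-- The conformal Killing equation reduces the symmetrized gradient of `ξ` acting on `(B·∇)B` to a
scalar, which the formula for `κ` absorbs. -/
lemma forceRes_eq (m : Fin 3) : Φ.forceRes ξ β ρ κ b q h m
    = Φ.dQ ρ * Φ.residual b q m - ∑ a, Φ.residual b q a * Φ.dx m (ξ a)
      - Φ.σ * Φ.B m * ∑ i, Φ.B i * Φ.tot b q h i l := by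
  have hk : ∑ a, (Φ.dx m (ξ a) + Φ.dx a (ξ m)) * ∑ j, b a j * Φ.B j
      = 2 * Φ.dx 0 (ξ 0) * ∑ j, b m j * Φ.B j := by
    rw [Finset.sum_eq_single m]
    · rw [S.killing_self m 0]; ring
    · intro a _ ha
      rw [S.killing_ne a m ha, zero_mul]
    · simp
  simp only [forceRes, residual, S.tot_ξ, S.tot_β, S.tot_ρ, S.κ_eq]
  simp only [S.β_eq]
  simp only [Fin.sum_univ_three] at hk ⊢
  linear_combination -Φ.σ * hk

lemma stateRes_eq (hσ : Φ.dS Φ.σ = 1) : Φ.stateRes ξ β κ b q h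
    = (Φ.dQ ρ - 2 * Φ.dx 0 (ξ 0) - l) * ∑ i, Φ.B i * h i
      - 2 * Φ.σ * ∑ i, Φ.B i * Φ.tot b q h i l := by
  have hs : ∀ i, Φ.tot b q h i Φ.σ = h i := fun i => by
    simp [tot, Φ.dx_σ, Φ.dB_σ, Φ.dQ_σ, hσ]
  have hκ : κ = Φ.σ * (Φ.dQ ρ + -(Φ.dx 0 (ξ 0) + Φ.dx 0 (ξ 0) + l + l)) := by
    rw [S.κ_eq]; ring
  simp only [stateRes, S.tot_ξ, S.β_eq]
  simp only [hκ, tot_mul, tot_add, tot_map_neg, hs, S.tot_dx_ξ, S.tot_dQ_ρ, Fin.sum_univ_three]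
  ring

end

/-- Integration of the equations for `ξ` and `ρ`. -/
lemma integrate (S : Φ.Solved ξ β ρ κ l) (x : Fin 3 → A) (Q : A)
    (hconst : ∀ f, (∀ i, Φ.dx i f = 0) → (∀ i, Φ.dB i f = 0) → Φ.dQ f = 0 → Φ.dS f = 0 →
      ∃ c : ℝ, f = algebraMap ℝ A c)
    (hx : ∀ i a, Φ.dx i (x a) = if i = a then 1 else 0) (hxB : ∀ i a, Φ.dB i (x a) = 0)
    (hxQ : ∀ a, Φ.dQ (x a) = 0) (hxS : ∀ a, Φ.dS (x a) = 0)
    (hQx : ∀ i, Φ.dx i Q = 0) (hQB : ∀ i, Φ.dB i Q = 0) (hQQ : Φ.dQ Q = 1) (hQS : Φ.dS Q = 0) :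
    ∃ (K : Fin 3 → ℝ) (X : Fin 3 → Fin 3 → ℝ) (r r₀ : ℝ),
      (∀ a, ξ a = algebraMap ℝ A (K a) + ∑ i, algebraMap ℝ A (X a i) * x i) ∧
      (∀ a i, Φ.dx i (ξ a) = algebraMap ℝ A (X a i)) ∧
      ρ = algebraMap ℝ A r₀ + algebraMap ℝ A r * Q ∧ Φ.dQ ρ = algebraMap ℝ A r := by
  have hX : ∀ a i, ∃ c : ℝ, Φ.dx i (ξ a) = algebraMap ℝ A c := fun a i =>
    hconst _ (fun j => S.dx_dx_ξ a j i) (fun j => by rw [Φ.dB_dx, S.dB_ξ, map_zero])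
      (by rw [Φ.dQ_dx, S.dQ_ξ, map_zero]) (by rw [Φ.dS_dx, S.dS_ξ, map_zero])
  choose X hX using hX
  obtain ⟨r, hr⟩ := hconst (Φ.dQ ρ) (fun j => by rw [← Φ.dQ_dx, S.dx_ρ, map_zero])
    (fun j => by rw [Φ.dB_dQ, S.dB_ρ, map_zero]) S.dQ_dQ_ρ (by rw [Φ.dS_dQ, S.dS_ρ, map_zero])
  have hK : ∀ a, ∃ c : ℝ, ξ a - ∑ i, algebraMap ℝ A (X a i) * x i = algebraMap ℝ A c :=
    fun a => hconst _ (fun j => by simp [hx, hX]) (fun j => by simp [S.dB_ξ, hxB])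
      (by simp [S.dQ_ξ, hxQ]) (by simp [S.dS_ξ, hxS])
  choose K hK using hK
  obtain ⟨r₀, hr₀⟩ := hconst (ρ - algebraMap ℝ A r * Q) (fun j => by simp [S.dx_ρ, hQx])
    (fun j => by simp [S.dB_ρ, hQB]) (by simp [hr, hQQ]) (by simp [S.dS_ρ, hQS])
  exact ⟨K, X, r, r₀, fun a => by rw [← hK]; ring, hX, by rw [← hr₀]; ring, hr⟩

/-- The fields given by constants of integration and a factor `l` solve the determining
equations. -/
lemma of_constants (x : Fin 3 → A) (Q : A)
    (hx : ∀ i a, Φ.dx i (x a) = if i = a then 1 else 0) (hxB : ∀ i a, Φ.dB i (x a) = 0)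
    (hxQ : ∀ a, Φ.dQ (x a) = 0) (hxS : ∀ a, Φ.dS (x a) = 0)
    (hQx : ∀ i, Φ.dx i Q = 0) (hQB : ∀ i, Φ.dB i Q = 0) (hQQ : Φ.dQ Q = 1) (hQS : Φ.dS Q = 0)
    (K : Fin 3 → ℝ) (X : Fin 3 → Fin 3 → ℝ) (r r₀ : ℝ)
    (hX : ∀ i k, i ≠ k → X i k + X k i = 0) (hX' : ∀ i j, X i i = X j j)
    (hξ : ∀ a, ξ a = algebraMap ℝ A (K a) + ∑ i, algebraMap ℝ A (X a i) * x i)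
    (hρ : ρ = algebraMap ℝ A r₀ + algebraMap ℝ A r * Q)
    (hβ : ∀ j, β j = ∑ a, algebraMap ℝ A (X j a) * Φ.B a + l * Φ.B j)
    (hκ : κ = Φ.σ * (algebraMap ℝ A r - 2 * algebraMap ℝ A (X 0 0) - 2 * l))
    (hlx : ∀ i, Φ.dx i l = 0) (hlB : ∀ i, Φ.dB i l = - Φ.σ * Φ.dQ l * Φ.B i) :
    Φ.Solved ξ β ρ κ l := by
  have hdx : ∀ i a, Φ.dx i (ξ a) = algebraMap ℝ A (X a i) := fun i a => by
    simp [hξ, hx]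
  have hr : Φ.dQ ρ = algebraMap ℝ A r := by simp [hρ, hQQ]
  exact
    { dB_ξ := fun k a => by simp [hξ, hxB]
      dQ_ξ := fun a => by simp [hξ, hxQ]
      dS_ξ := fun a => by simp [hξ, hxS]
      dx_dx_ξ := fun i a b => by rw [hdx, Derivation.map_algebraMap]
      killing_ne := fun i k hik => by rw [hdx, hdx, ← map_add, hX i k hik, map_zero]
      killing_self := fun i j => by rw [hdx, hdx, hX' i j]
      β_eq := fun j => by simp only [hβ, hdx]
      κ_eq := by rw [hκ, hr, hdx]
      dx_ρ := fun i => by simp [hρ, hQx]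
      dB_ρ := fun i => by simp [hρ, hQB]
      dS_ρ := by simp [hρ, hQS]
      dQ_dQ_ρ := by rw [hr, Derivation.map_algebraMap]
      dx_l := hlx
      dB_l := hlB }

end Solved

end FieldFrame

end

noncomputable section

open smoothFun

namespace CGL

variable {M : Set (Base 3 5)} (hM : IsOpen M) {v : Base 3 5 → Base 3 5}

/-! ### The symmetry conditions in terms of the frame -/

lemma cglSymmetric (hs : IsPointSymmetry cglSystem M v) :
    (frame hM).CGLSymmetric (xi hs.1) (fun k => eta hs.1 (mag k)) (rho hs.1) (-eta hs.1 4) := by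
  intro b q h hb hq
  have key : ∀ z : M, _ := fun z => (fderiv_cglSystem_eq_zero_iff _ _).1
    (hs.2 (jetAt b q h z) z.2 ((cglSystem_eq_zero_iff _).2 ⟨by rw [ev_div, hb, map_zero],
      fun i => by rw [ev_force hM, hq i, sub_self, map_zero]⟩))
  refine ⟨ext_ev fun z => ?_, fun m => ext_ev fun z => ?_⟩
  · rw [← ev_prolong_div hM b q h z hs.1, (key z).1, map_zero]
  · have := (key z).2 m
    rw [ev_prolong_force hM b q h z hs.1, map_sub, sub_eq_zero] at this
    exact this.symm

lemma stateSymmetric (hs : IsPointSymmetry cglStateSystem M v) :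
    (frame hM).StateSymmetric (xi hs.1) (fun k => eta hs.1 (mag k)) (rho hs.1)
      (-eta hs.1 4) := by
  intro b q h hb hq hh
  have key : ∀ z : M, _ := fun z => (fderiv_cglStateSystem_eq_zero_iff _ _).1
    (hs.2 (jetAt b q h z) z.2 ((cglStateSystem_eq_zero_iff _).2 ⟨by rw [ev_div, hb, map_zero],
      by rw [ev_state hM, hh, map_zero, neg_zero],
      fun i => by rw [ev_force hM, hq i, hh, zero_mul, add_zero, sub_self, map_zero]⟩))
  have hst : (frame hM).stateRes (xi hs.1) (fun k => eta hs.1 (mag k)) (-eta hs.1 4) b q h = 0 :=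
    ext_ev fun z => by
      have := (key z).2.1
      rw [ev_prolong_state hM b q h z hs.1, neg_eq_zero] at this
      rw [this, map_zero]
  refine ⟨ext_ev fun z => ?_, hst, fun m => ext_ev fun z => ?_⟩
  · rw [← ev_prolong_div hM b q h z hs.1, (key z).1, map_zero]
  · have := (key z).2.2 m
    rw [ev_prolong_force hM b q h z hs.1, hst, hh, zero_mul, zero_mul, zero_add, zero_sub,
      map_neg, neg_eq_zero] at this
    rw [this, map_zero]

lemma isPointSymmetry_cglSystem (hv : ContDiffOn ℝ ∞ v M) {l : smoothFun M}
    (S : (frame hM).Solved (xi hv) (fun k => eta hv (mag k)) (rho hv) (-eta hv 4) l)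
    (hQ : (frame hM).dQ l = 0) (hS : (frame hM).dS l = 0) : IsPointSymmetry cglSystem M v := by
  refine ⟨hv, fun j hj hE => ?_⟩
  rw [← jetAt_eq j hj] at hE ⊢
  generalize (fun k i => algebraMap ℝ (smoothFun M) (j.2 (mag k) i)) = b at *
  generalize (fun i => algebraMap ℝ (smoothFun M)
    (j.2 3 i + ∑ k, j.1.2 (mag k) * j.2 (mag k) i)) = q at *
  generalize (fun i => algebraMap ℝ (smoothFun M) (- j.2 4 i)) = h at *
  generalize (⟨j.1, hj⟩ : M) = z at *
  rw [cglSystem_eq_zero_iff, ev_div] at hE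
  rw [fderiv_cglSystem_eq_zero_iff, ev_prolong_div hM b q h z hv]
  have hR : ∀ i, ev z ((frame hM).residual b q i)
      = ev z (∑ j, (frame hM).B j * h j) * ev z ((frame hM).B i) := fun i => by
    have := hE.2 i
    rw [ev_force hM] at this
    simp only [map_sub, map_add, map_mul] at this
    simp only [FieldFrame.residual, map_sub, map_mul]
    linear_combination -this
  have hl : ∑ i, (frame hM).B i * (frame hM).tot b q h i l = 0 := by
    rw [S.sum_B_tot_l, hQ, hS, zero_mul, zero_mul, add_zero]
  have hβ : ∀ i, eta hv (mag i) = _ := S.β_eq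
  refine ⟨by rw [S.divRes_eq, hl, add_zero, map_mul, hE.1, mul_zero], fun i => ?_⟩
  have hk : ∑ a, (ev z ((frame hM).dx i (xi hv a)) + ev z ((frame hM).dx a (xi hv i)))
        * ev z ((frame hM).B a)
      = 2 * ev z ((frame hM).dx 0 (xi hv 0)) * ev z ((frame hM).B i) := by
    rw [Finset.sum_eq_single i]
    · rw [S.killing_self i 0]; ring
    · intro a _ ha
      rw [← map_add, S.killing_ne a i ha, map_zero, zero_mul]
    · simp
  rw [ev_prolong_force hM b q h z hv, S.forceRes_eq, S.stateRes_eq b q h (frame_dS_σ hM), hl, hβ]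
  simp only [mul_zero, sub_zero, map_sub, map_add, map_mul, map_sum, hR, map_ofNat]
  generalize ∑ x, ev z ((frame hM).B x) * ev z (h x) = e
  simp only [Fin.sum_univ_three] at hk ⊢
  linear_combination e * hk

lemma isPointSymmetry_cglStateSystem (hv : ContDiffOn ℝ ∞ v M) {l : smoothFun M}
    (S : (frame hM).Solved (xi hv) (fun k => eta hv (mag k)) (rho hv) (-eta hv 4) l) :
    IsPointSymmetry cglStateSystem M v := by
  refine ⟨hv, fun j hj hE => ?_⟩
  rw [← jetAt_eq j hj] at hE ⊢
  generalize (fun k i => algebraMap ℝ (smoothFun M) (j.2 (mag k) i)) = b at *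
  generalize (fun i => algebraMap ℝ (smoothFun M)
    (j.2 3 i + ∑ k, j.1.2 (mag k) * j.2 (mag k) i)) = q at *
  generalize (fun i => algebraMap ℝ (smoothFun M) (- j.2 4 i)) = h at *
  generalize (⟨j.1, hj⟩ : M) = z at *
  rw [cglStateSystem_eq_zero_iff, ev_div, ev_state hM, neg_eq_zero] at hE
  obtain ⟨hdiv, hst, hF⟩ := hE
  rw [fderiv_cglStateSystem_eq_zero_iff, ev_prolong_div hM b q h z hv,
    ev_prolong_state hM b q h z hv]
  have hR : ∀ i, ev z ((frame hM).residual b q i) = 0 := fun i => by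
    have := hF i
    rw [ev_force hM] at this
    simp only [map_sub, map_add, map_mul, hst] at this
    simp only [FieldFrame.residual, map_sub, map_mul]
    linear_combination -this
  have hl : ev z (∑ i, (frame hM).B i * (frame hM).tot b q h i l) = 0 := by
    rw [S.sum_B_tot_l, map_add, map_mul, map_mul, hst, map_sum]
    simp [hR]
  have hs : ev z ((frame hM).stateRes (xi hv) (fun k => eta hv (mag k)) (-eta hv 4) b q h) = 0 := by
    rw [S.stateRes_eq b q h (frame_dS_σ hM), map_sub, map_mul, map_mul, hst, hl, mul_zero, mul_zero,
      sub_zero]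
  refine ⟨by rw [S.divRes_eq, map_add, map_mul, hdiv, hl, mul_zero, add_zero],
    by rw [hs, neg_zero], fun i => ?_⟩
  rw [ev_prolong_force hM b q h z hv, S.forceRes_eq]
  simp [hs, hst, hl, hR]

/-! ### Fields in normal form -/

/-- A combination of the ten generators plus `f` times the infinite generator. -/
def normalForm (c : Fin 10 → ℝ) (f : Base 3 5 → ℝ) : Base 3 5 → Base 3 5 := fun z =>
  ∑ a, c a • generators a z
    + f z • ((0, ![z.2 0, z.2 1, z.2 2, -magSq z, 2 * (1 - z.2 4)]) : Base 3 5)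

/-- The linear part of the action on `x`. -/
def linearPart (b c d s : ℝ) : Fin 3 → Fin 3 → ℝ := ![![s, c, d], ![-c, s, -b], ![-d, b, s]]

lemma normalForm_fst (c : Fin 10 → ℝ) (f : Base 3 5 → ℝ) (z : Base 3 5) (i : Fin 3) :
    (normalForm c f z).1 i = ![c 0, c 1, c 2] i
      + ∑ k, linearPart (c 4) (c 5) (c 6) (c 7) i k * z.1 k := by
  fin_cases i <;>
  simp [normalForm, generators, Fin.sum_univ_succ, transX, transP, rot, scal₁, scal₂, scal₃, infRot,
    linearPart, Matrix.vecHead, Matrix.vecTail] <;> ring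

lemma normalForm_mag (c : Fin 10 → ℝ) (f : Base 3 5 → ℝ) (z : Base 3 5) (i : Fin 3) :
    (normalForm c f z).2 (mag i)
      = ∑ k, linearPart (c 4) (c 5) (c 6) (c 7) i k * z.2 (mag k)
        + (c 8 - c 7 + f z) * z.2 (mag i) := by
  fin_cases i <;>
  simp [normalForm, generators, Fin.sum_univ_succ, transX, transP, rot, scal₁, scal₂, scal₃, infRot,
    linearPart, mag] <;> ring

lemma normalForm_pressure (c : Fin 10 → ℝ) (f : Base 3 5 → ℝ) (z : Base 3 5) :
    (normalForm c f z).2 3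
      = c 3 + 2 * c 8 * z.2 3 + c 9 * (z.2 3 + magSq z / 2) - f z * magSq z := by
  simp [normalForm, generators, Fin.sum_univ_succ, transX, transP, rot, scal₁, scal₂, scal₃]
  ring

lemma normalForm_tau (c : Fin 10 → ℝ) (f : Base 3 5 → ℝ) (z : Base 3 5) :
    (normalForm c f z).2 4 = (2 * f z - c 9) * (1 - z.2 4) := by
  simp [normalForm, generators, Fin.sum_univ_succ, transX, transP, rot, scal₁, scal₂, scal₃]
  ring

lemma contDiffOn_normalForm (c : Fin 10 → ℝ) {f : Base 3 5 → ℝ} (hf : ContDiffOn ℝ ∞ f M) :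
    ContDiffOn ℝ ∞ (normalForm c f) M := by
  have h1 : ContDiffOn ℝ ∞ (fun z => (normalForm c f z).1) M := by
    refine contDiffOn_pi.2 fun i => ?_
    simp only [normalForm_fst]
    fun_prop
  have h2 : ContDiffOn ℝ ∞ (fun z => (normalForm c f z).2) M := by
    have hm : ∀ i, ContDiffOn ℝ ∞ (fun z => (normalForm c f z).2 (mag i)) M := fun i => by
      simp only [normalForm_mag]
      fun_prop
    refine contDiffOn_pi.2 fun i => ?_
    fin_cases i
    · exact hm 0
    · exact hm 1
    · exact hm 2
    · simp only [Fin.reduceFinMk, normalForm_pressure, magSq]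
      fun_prop
    · simp only [Fin.reduceFinMk, normalForm_tau]
      fun_prop
  exact h1.prodMk h2

/-- The total pressure `p + B² / 2`. -/
def totalPressure (M : Set (Base 3 5)) : smoothFun M :=
  cu M 3 + algebraMap ℝ _ 2⁻¹ * ∑ k, cu M (mag k) ^ 2

lemma ev_totalPressure (z : M) : ev z (totalPressure M) = z.1.2 3 + magSq z / 2 := by
  simp [totalPressure, magSq, ev_cu, Fin.sum_univ_three, mag]
  ring

lemma frame_dx_cx (i a : Fin 3) : (frame hM).dx i (cx M a) = if i = a then 1 else 0 := by
  rcases eq_or_ne i a with rfl | h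
  · simp [frame, fieldFrame, dir_cx, ex]
  · simp [frame, fieldFrame, dir_cx, ex, h, h.symm]

lemma frame_dB_cx (i a : Fin 3) : (frame hM).dB i (cx M a) = 0 := by
  simp [frame, fieldFrame, dir_cx, eu]

lemma frame_dQ_cx (a : Fin 3) : (frame hM).dQ (cx M a) = 0 := by
  simp [frame, fieldFrame, dir_cx, eu]

lemma frame_dS_cx (a : Fin 3) : (frame hM).dS (cx M a) = 0 := by
  simp [frame, fieldFrame, dir_cx, eu]

lemma frame_dx_totalPressure (i : Fin 3) : (frame hM).dx i (totalPressure M) = 0 := by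
  simp [frame, fieldFrame, totalPressure, dir_cu, ex, Derivation.leibniz_pow]

lemma frame_dB_totalPressure (i : Fin 3) : (frame hM).dB i (totalPressure M) = 0 := by
  have h2 : algebraMap ℝ (smoothFun M) 2⁻¹ * 2 = 1 := by
    rw [← map_ofNat (algebraMap ℝ (smoothFun M)) 2, ← map_mul]; norm_num
  fin_cases i <;>
  simp [frame, fieldFrame, totalPressure, dir_cu, eu, Derivation.leibniz_pow, Fin.sum_univ_three,
    mag, ← mul_assoc, h2]

lemma frame_dQ_totalPressure : (frame hM).dQ (totalPressure M) = 1 := by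
  simp [frame, fieldFrame, totalPressure, dir_cu, eu, Derivation.leibniz_pow, Fin.sum_univ_three,
    mag]

lemma frame_dS_totalPressure : (frame hM).dS (totalPressure M) = 0 := by
  simp [frame, fieldFrame, totalPressure, dir_cu, eu, Derivation.leibniz_pow, Fin.sum_univ_three,
    mag]

lemma frame_exists_const (hc : IsConnected M) (f : smoothFun M)
    (hx : ∀ i, (frame hM).dx i f = 0) (hB : ∀ i, (frame hM).dB i f = 0)
    (hQ : (frame hM).dQ f = 0) (hS : (frame hM).dS f = 0) :
    ∃ c : ℝ, f = algebraMap ℝ (smoothFun M) c := by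
  have hQ' : dir hM (eu 3) f = 0 := hQ
  have hB' : ∀ i, dir hM (eu (mag i)) f = 0 := fun i => by
    have : dir hM (eu (mag i)) f - cu M (mag i) * dir hM (eu 3) f = 0 := hB i
    rwa [hQ', mul_zero, sub_zero] at this
  have hS' : dir hM (-eu 4) f = 0 := hS
  refine exists_const hM hc f hx fun k => ?_
  fin_cases k
  · exact hB' 0
  · exact hB' 1
  · exact hB' 2
  · exact hQ'
  · rwa [dir_neg, neg_eq_zero] at hS'

end CGL

end

/-! ### Solved fields in normal form, and the general CGL system. -/

noncomputable section

open smoothFun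

namespace CGL

variable {M : Set (Base 3 5)} (hM : IsOpen M) {v : Base 3 5 → Base 3 5}

lemma linearPart_ne (b c d s : ℝ) (i k : Fin 3) (h : i ≠ k) :
    linearPart b c d s i k + linearPart b c d s k i = 0 := by
  fin_cases i <;> fin_cases k <;> simp [linearPart] at h ⊢

lemma linearPart_self (b c d s : ℝ) (i : Fin 3) : linearPart b c d s i i = s := by
  fin_cases i <;> rfl

lemma ev_rho (hv : ContDiffOn ℝ ∞ v M) (z : M) :
    ev z (rho hv) = (v z).2 3 + ∑ k, z.1.2 (mag k) * (v z).2 (mag k) := by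
  simp [rho, ev_eta, ev_cu]

lemma solved_normalForm (c : Fin 10 → ℝ) {f : Base 3 5 → ℝ} (hf : ContDiffOn ℝ ∞ f M)
    (hx : ∀ i, (frame hM).dx i (mk f hf) = 0)
    (hB : ∀ i, (frame hM).dB i (mk f hf)
      = - (frame hM).σ * (frame hM).dQ (mk f hf) * (frame hM).B i) :
    (frame hM).Solved (xi (contDiffOn_normalForm c hf))
      (fun k => eta (contDiffOn_normalForm c hf) (mag k)) (rho (contDiffOn_normalForm c hf))
      (-eta (contDiffOn_normalForm c hf) 4) (algebraMap ℝ _ (c 8 - c 7) + mk f hf) := by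
  have hf' : ∀ z : M, ev z (mk f hf) = f z := fun _ => rfl
  have hB' : ∀ z k, ev z ((frame hM).B k) = z.1.2 (mag k) := fun _ _ => rfl
  have hσ : ∀ z, ev z (frame hM).σ = 1 - z.1.2 4 := fun _ => rfl
  refine FieldFrame.Solved.of_constants (cx M) (totalPressure M) (frame_dx_cx hM) (frame_dB_cx hM)
    (frame_dQ_cx hM) (frame_dS_cx hM) (frame_dx_totalPressure hM) (frame_dB_totalPressure hM)
    (frame_dQ_totalPressure hM) (frame_dS_totalPressure hM) ![c 0, c 1, c 2]
    (linearPart (c 4) (c 5) (c 6) (c 7)) (2 * c 8 + c 9) (c 3) (linearPart_ne _ _ _ _)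
    (fun i j => by rw [linearPart_self, linearPart_self]) (fun a => ext_ev fun z => ?_)
    (ext_ev fun z => ?_) (fun j => ext_ev fun z => ?_) (ext_ev fun z => ?_) (fun i => ?_)
    (fun i => ?_)
  · simp only [ev_xi, normalForm_fst, map_add, map_sum, map_mul, AlgHom.commutes, ev_cx,
      Algebra.algebraMap_self, RingHom.id_apply]
  · rw [ev_rho]
    simp only [normalForm_pressure, normalForm_mag, map_add, map_mul, AlgHom.commutes,
      ev_totalPressure, Algebra.algebraMap_self, RingHom.id_apply, magSq]
    simp [Fin.sum_univ_three, mag, linearPart]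
    ring
  · simp only [ev_eta, normalForm_mag, map_add, map_sum, map_mul, AlgHom.commutes, hB', hf',
      Algebra.algebraMap_self, RingHom.id_apply]
  · simp only [map_neg, ev_eta, normalForm_tau, map_add, map_sub, map_mul, AlgHom.commutes, hσ, hf',
      Algebra.algebraMap_self, RingHom.id_apply, map_ofNat, linearPart_self]
    ring
  · simp [hx]
  · rw [map_add, map_add, Derivation.map_algebraMap, Derivation.map_algebraMap, zero_add, zero_add,
      hB]

/-- A solution of the determining equations is in normal form. -/
lemma eq_normalForm (hc : IsConnected M) (hv : ContDiffOn ℝ ∞ v M) {l : smoothFun M}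
    (S : (frame hM).Solved (xi hv) (fun k => eta hv (mag k)) (rho hv) (-eta hv 4) l) :
    ∃ (c : Fin 10 → ℝ) (a : ℝ), ∀ (f : Base 3 5 → ℝ) (z : M), f z = ev z l + a →
      v z = normalForm c f z := by
  obtain ⟨K, X, r, r₀, hξ, hX, hρ, hr⟩ := S.integrate (cx M) (totalPressure M)
    (frame_exists_const hM hc) (frame_dx_cx hM) (frame_dB_cx hM)
    (frame_dQ_cx hM) (frame_dS_cx hM) (frame_dx_totalPressure hM) (frame_dB_totalPressure hM)
    (frame_dQ_totalPressure hM) (frame_dS_totalPressure hM)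
  obtain ⟨z₀, hz₀⟩ := hc.nonempty
  have hXne : ∀ i k, i ≠ k → X i k + X k i = 0 := fun i k hik => by
    have := congrArg (ev ⟨z₀, hz₀⟩) (S.killing_ne i k hik)
    simpa [hX] using this
  have hXself : ∀ i, X i i = X 0 0 := fun i => by
    have := congrArg (ev ⟨z₀, hz₀⟩) (S.killing_self i 0)
    simpa [hX] using this
  have hXL : X = linearPart (X 2 1) (X 0 1) (X 0 2) (X 0 0) := by
    funext i k
    fin_cases i <;> fin_cases k <;> simp [linearPart]
    · linarith [hXne 0 1 (by decide)]
    · exact hXself 1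
    · linarith [hXne 1 2 (by decide)]
    · linarith [hXne 0 2 (by decide)]
    · exact hXself 2
  have hB' : ∀ z k, ev z ((frame hM).B k) = z.1.2 (mag k) := fun _ _ => rfl
  have hσ : ∀ z, ev z (frame hM).σ = 1 - z.1.2 4 := fun _ => rfl
  -- The coefficients are not unique, since the infinite generator with constant factor `1` equals
  -- `scal₂ - 2 • scal₃`. The choice `c 9 = 0` gives `c 8 = r / 2`, and `l = c 8 - c 7 + f` then
  -- fixes the shift.
  refine ⟨![K 0, K 1, K 2, r₀, X 2 1, X 0 1, X 0 2, X 0 0, r / 2, 0], X 0 0 - r / 2,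
    fun f z hf => ?_⟩
  have hβ : ∀ k, (v z).2 (mag k) = ∑ a, X k a * z.1.2 (mag a) + ev z l * z.1.2 (mag k) :=
    fun k => by
      have := congrArg (ev z) (S.β_eq k)
      simpa [hX, hB', ev_eta] using this
  have hp := congrArg (ev z) hρ
  rw [ev_rho] at hp
  simp only [map_add, map_mul, AlgHom.commutes, Algebra.algebraMap_self, RingHom.id_apply,
    ev_totalPressure, hβ] at hp
  have hτ := congrArg (ev z) S.κ_eq
  simp only [map_neg, ev_eta, map_mul, map_sub, hσ, hr, hX, AlgHom.commutes, map_ofNat,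
    Algebra.algebraMap_self, RingHom.id_apply] at hτ
  have hmag : ∀ k, (v z).2 (mag k) = (normalForm
      ![K 0, K 1, K 2, r₀, X 2 1, X 0 1, X 0 2, X 0 0, r / 2, 0] f z).2 (mag k) := fun k => by
    rw [hβ, normalForm_mag, hf]
    simp only [Matrix.cons_val]
    rw [← hXL]
    ring
  refine Prod.ext (funext fun i => ?_) (funext fun k => ?_)
  · have := congrArg (ev z) (hξ i)
    simp only [ev_xi, map_add, map_sum, map_mul, AlgHom.commutes, ev_cx,
      Algebra.algebraMap_self, RingHom.id_apply] at this
    rw [this, normalForm_fst]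
    simp only [Matrix.cons_val]
    rw [← hXL]
    congr 1
    fin_cases i <;> rfl
  · fin_cases k
    · exact hmag 0
    · exact hmag 1
    · exact hmag 2
    · simp only [Fin.reduceFinMk, normalForm_pressure, hf]
      simp only [Fin.sum_univ_three, magSq, mag, Matrix.cons_val] at hp ⊢
      linear_combination hp - z.1.2 0 * z.1.2 1 * hXne 0 1 (by decide)
        - z.1.2 0 * z.1.2 2 * hXne 0 2 (by decide) - z.1.2 1 * z.1.2 2 * hXne 1 2 (by decide)
        - z.1.2 1 ^ 2 * hXself 1 - z.1.2 2 ^ 2 * hXself 2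
    · simp only [Fin.reduceFinMk, normalForm_tau, hf, Matrix.cons_val]
      linear_combination -hτ

/-- The infinite generator with constant factor `a` is `a • (scal₂ - 2 • scal₃)`. -/
lemma normalForm_const (c : Fin 10 → ℝ) (a : ℝ) : ∃ c' : Fin 10 → ℝ,
    normalForm c (fun _ => a) = normalForm c' (fun _ => 0) := by
  refine ⟨![c 0, c 1, c 2, c 3, c 4, c 5, c 6, c 7, c 8 + a, c 9 - 2 * a], funext fun z => ?_⟩
  have hm : ∀ k, (normalForm c (fun _ => a) z).2 (mag k) = (normalForm
      ![c 0, c 1, c 2, c 3, c 4, c 5, c 6, c 7, c 8 + a, c 9 - 2 * a] (fun _ => 0) z).2 (mag k) :=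
    fun k => by
      rw [normalForm_mag, normalForm_mag]
      simp only [Matrix.cons_val]
      ring
  refine Prod.ext (funext fun i => ?_) (funext fun k => ?_)
  · rw [normalForm_fst, normalForm_fst]
    simp only [Matrix.cons_val]
  · fin_cases k
    · exact hm 0
    · exact hm 1
    · exact hm 2
    · simp only [Fin.reduceFinMk, normalForm_pressure, Matrix.cons_val]
      ring
    · simp only [Fin.reduceFinMk, normalForm_tau, Matrix.cons_val]
      ring

lemma domRestrict_normalForm_zero (c : Fin 10 → ℝ) :
    M.domRestrict (normalForm c (fun _ => 0))
      = ∑ a, c a • M.domRestrict (generators a) := by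
  funext z
  simp [normalForm]

theorem symmetryGenerators_cglSystem (hM : IsOpen M) (hc : IsConnected M) :
    symmetryGenerators cglSystem M
      = (Submodule.span ℝ (Set.range fun a => M.domRestrict (generators a)) :
          Set (M → Base 3 5)) := by
  ext w
  rw [SetLike.mem_coe, Submodule.mem_span_range_iff_exists_fun]
  constructor
  · rintro ⟨v, hs, rfl⟩
    obtain ⟨l, S, hQ, hS⟩ := (cglSymmetric hM hs).solved (frame_dS_σ hM)
    obtain ⟨a, ha⟩ := frame_exists_const hM hc l S.dx_l
      (fun i => by rw [S.dB_l, hQ, mul_zero, zero_mul]) hQ hS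
    obtain ⟨c, a', h⟩ := eq_normalForm hM hc hs.1 S
    obtain ⟨c', hc'⟩ := normalForm_const c (a + a')
    refine ⟨c', ?_⟩
    rw [← domRestrict_normalForm_zero, ← hc']
    funext z
    refine (h (fun _ => a + a') z ?_).symm
    rw [ha, AlgHom.commutes]
    rfl
  · rintro ⟨c, rfl⟩
    rw [← domRestrict_normalForm_zero]
    have h0 : mk (M := M) (fun _ => (0 : ℝ)) contDiffOn_const = 0 := rfl
    refine ⟨_, isPointSymmetry_cglSystem hM (contDiffOn_normalForm c contDiffOn_const)
      (solved_normalForm hM c contDiffOn_const (fun i => ?_) (fun i => ?_)) ?_ ?_, rfl⟩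
    · rw [h0, map_zero]
    · rw [h0, map_zero, map_zero, mul_zero, zero_mul]
    · rw [h0, add_zero, Derivation.map_algebraMap]
    · rw [h0, add_zero, Derivation.map_algebraMap]

end CGL

end

/-! ### Linear independence, and the closed CGL system. -/

noncomputable section

open smoothFun

namespace CGL

variable {M : Set (Base 3 5)}

/-- As `M` need not contain convenient points, the coefficients are isolated by differentiating the
component identities along the frame rather than by evaluating them. -/
theorem linearIndependent_generators (hM : IsOpen M) (hc : IsConnected M) :
    LinearIndependent ℝ (fun a => M.domRestrict (generators a)) := by
  obtain ⟨z₀, hz₀⟩ := hc.nonempty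
  rw [Fintype.linearIndependent_iff]
  intro c h
  rw [← domRestrict_normalForm_zero] at h
  have hz : ∀ z : M, normalForm c (fun _ => 0) z = 0 := fun z => congrFun h z
  have hreal : ∀ r : ℝ, algebraMap ℝ (smoothFun M) r = 0 → r = 0 := fun r hr => by
    simpa using congrArg (ev ⟨z₀, hz₀⟩) hr
  have hξ : ∀ a, algebraMap ℝ (smoothFun M) (![c 0, c 1, c 2] a)
      + ∑ i, algebraMap ℝ _ (linearPart (c 4) (c 5) (c 6) (c 7) a i) * cx M i = 0 := fun a =>
    ext_ev fun z => by
      have := congrArg (fun y => y.1 a) (hz z)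
      simp only [normalForm_fst] at this
      simpa [ev_cx] using this
  have hX : ∀ a i, linearPart (c 4) (c 5) (c 6) (c 7) a i = 0 := fun a i => hreal _ (by
    have := congrArg ((frame hM).dx i) (hξ a)
    simpa only [map_add, map_sum, Derivation.leibniz, Derivation.map_algebraMap, frame_dx_cx,
      smul_zero, add_zero, zero_add, map_zero, smul_eq_mul, mul_ite, mul_one, mul_zero,
      Finset.sum_ite_eq, Finset.mem_univ, if_true] using this)
  have hK : ∀ a, ![c 0, c 1, c 2] a = 0 := fun a => hreal _ (by
    have := hξ a
    simpa only [hX, map_zero, zero_mul, Finset.sum_const_zero, add_zero] using this)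
  have h7 : c 7 = 0 := hX 0 0
  have h8 : c 8 = 0 := hreal _ (by
    have h1 : algebraMap ℝ (smoothFun M) (c 8) * (frame hM).B 0 = 0 := ext_ev fun z => by
      have := congrArg (fun y => y.2 (mag 0)) (hz z)
      simp only [normalForm_mag, hX] at this
      simp only [h7, zero_mul, Finset.sum_const_zero, zero_add, sub_zero, add_zero] at this
      rw [map_mul, AlgHom.commutes, map_zero]
      exact this
    have h2 := congrArg ((frame hM).dB 0) h1
    simpa only [Derivation.leibniz, Derivation.map_algebraMap, (frame hM).dB_B_self, smul_eq_mul,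
      mul_one, mul_zero, add_zero, map_zero] using h2)
  have hp : algebraMap ℝ (smoothFun M) (c 3) + algebraMap ℝ _ (c 9) * totalPressure M = 0 :=
    ext_ev fun z => by
      have := congrArg (fun y => y.2 3) (hz z)
      simp only [normalForm_pressure, h8] at this
      simpa [ev_totalPressure] using this
  have h9 : c 9 = 0 := hreal _ (by
    have := congrArg (frame hM).dQ hp
    simpa only [map_add, Derivation.leibniz, Derivation.map_algebraMap, frame_dQ_totalPressure,
      smul_eq_mul, mul_one, mul_zero, add_zero, zero_add, map_zero] using this)
  have h3 : c 3 = 0 := hreal _ (by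
    simpa only [h9, map_zero, zero_mul, add_zero] using hp)
  intro a
  fin_cases a
  exacts [hK 0, hK 1, hK 2, h3, hX 2 1, hX 0 1, hX 0 2, h7, h8, h9]

/-! ### Functions of the state invariants -/

/-- A section of `stateInv` through the point `z`. -/
def stateSection (z : Base 3 5) (c : ℝ × ℝ) : Base 3 5 :=
  (z.1, ![z.2 0, z.2 1, z.2 2, c.2 - c.1 * magSq z / 2, c.1])

lemma stateInv_stateSection (z : Base 3 5) (c : ℝ × ℝ) : stateInv (stateSection z c) = c := by
  refine Prod.ext ?_ ?_ <;> simp [stateInv, stateSection, magSq]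

lemma stateSection_stateInv (z : Base 3 5) : stateSection z (stateInv z) = z := by
  refine Prod.ext rfl (funext fun k => ?_)
  fin_cases k <;> simp [stateInv, stateSection]

lemma contDiff_stateSection (z : Base 3 5) : ContDiff ℝ ∞ (stateSection z) := by
  refine contDiff_const.prodMk (contDiff_pi.2 fun k => ?_)
  fin_cases k <;> simp <;> fun_prop

lemma contDiff_stateInv : ContDiff ℝ ∞ stateInv := by
  unfold stateInv magSq
  fun_prop

/-- Through each point of `M` passes a continuous section of `stateInv`, and it stays in `M` near
the value at that point. -/
lemma isOpen_image_stateInv (hM : IsOpen M) : IsOpen (stateInv '' M) := by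
  rw [isOpen_iff_mem_nhds]
  rintro _ ⟨z, hz, rfl⟩
  have h : stateSection z ⁻¹' M ∈ nhds (stateInv z) :=
    (contDiff_stateSection z).continuous.continuousAt.preimage_mem_nhds
      (hM.mem_nhds (by rwa [stateSection_stateInv]))
  exact Filter.mem_of_superset h fun c hc => ⟨_, hc, stateInv_stateSection z c⟩

lemma fderiv_coord (k : Fin 5) (z w : Base 3 5) :
    fderiv ℝ (fun z : Base 3 5 => z.2 k) z w = w.2 k := by
  have h := ((ContinuousLinearMap.proj (R := ℝ) (φ := fun _ => ℝ) k).comp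
    (ContinuousLinearMap.snd ℝ (Fin 3 → ℝ) (Fin 5 → ℝ))).hasFDerivAt (x := z)
  exact congrArg (fun L => L w) h.fderiv

lemma fderiv_stateInv (z w : Base 3 5) : fderiv ℝ stateInv z w
    = (w.2 4, w.2 3 + w.2 4 * magSq z / 2 + z.2 4 * ∑ k, z.2 (mag k) * w.2 (mag k)) := by
  have h : stateInv = fun z : Base 3 5 =>
      (z.2 4, z.2 3 + z.2 4 * 2⁻¹ * (z.2 0 * z.2 0 + z.2 1 * z.2 1 + z.2 2 * z.2 2)) := by
    funext z
    simp only [stateInv, magSq]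
    congr 1
    ring
  rw [h, DifferentiableAt.fderiv_prodMk (by fun_prop) (by fun_prop)]
  refine Prod.ext (fderiv_coord 4 z w) ?_
  simp (disch := fun_prop) [fderiv_fun_add, fderiv_fun_mul, fderiv_coord, Fin.sum_univ_three, mag,
    magSq]
  ring

section
variable (hM : IsOpen M)

lemma contDiffOn_comp_stateInv {F : ℝ × ℝ → ℝ} (hF : ContDiffOn ℝ ∞ F (stateInv '' M)) :
    ContDiffOn ℝ ∞ (fun z => F (stateInv z)) M :=
  hF.comp contDiff_stateInv.contDiffOn (Set.mapsTo_image _ _)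

lemma ev_dir_comp_stateInv {F : ℝ × ℝ → ℝ} (hF : ContDiffOn ℝ ∞ F (stateInv '' M)) (z : M)
    (w : Base 3 5) : ev z (dir hM w (mk _ (contDiffOn_comp_stateInv hF)))
      = fderiv ℝ F (stateInv z)
        (w.2 4, w.2 3 + w.2 4 * magSq z / 2 + z.1.2 4 * ∑ k, z.1.2 (mag k) * w.2 (mag k)) := by
  have hd : DifferentiableAt ℝ F (stateInv z) :=
    (hF.contDiffAt ((isOpen_image_stateInv hM).mem_nhds ⟨z, z.2, rfl⟩)).differentiableAt (by simp)
  rw [ev_eq, dir_mk_apply, fderiv_fun_comp z.1 hd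
    (contDiff_stateInv.differentiable (by simp)).differentiableAt, ContinuousLinearMap.comp_apply,
    fderiv_stateInv]

lemma dx_comp_stateInv {F : ℝ × ℝ → ℝ} (hF : ContDiffOn ℝ ∞ F (stateInv '' M)) (i : Fin 3) :
    (frame hM).dx i (mk _ (contDiffOn_comp_stateInv hF)) = 0 := by
  refine ext_ev fun z => ?_
  change ev z (dir hM (ex i) _) = _
  rw [ev_dir_comp_stateInv hM hF]
  simp [ex, Prod.mk_zero_zero]

lemma dB_comp_stateInv {F : ℝ × ℝ → ℝ} (hF : ContDiffOn ℝ ∞ F (stateInv '' M)) (i : Fin 3) :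
    (frame hM).dB i (mk _ (contDiffOn_comp_stateInv hF))
      = - (frame hM).σ * (frame hM).dQ (mk _ (contDiffOn_comp_stateInv hF)) * (frame hM).B i := by
  refine ext_ev fun z => ?_
  change ev z (dir hM (eu (mag i)) _ - cu M (mag i) * dir hM (eu 3) _)
    = ev z (- (1 - cu M 4) * dir hM (eu 3) _ * cu M (mag i))
  rw [map_sub, map_mul, map_mul, map_mul, map_neg, map_sub, map_one, ev_dir_comp_stateInv hM hF,
    ev_dir_comp_stateInv hM hF, ev_cu, ev_cu]
  have h1 : (((eu (mag i) : Base 3 5).2 4, (eu (mag i) : Base 3 5).2 3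
      + (eu (mag i) : Base 3 5).2 4 * magSq z / 2
      + z.1.2 4 * ∑ k, z.1.2 (mag k) * (eu (mag i) : Base 3 5).2 (mag k)) : ℝ × ℝ)
      = (z.1.2 4 * z.1.2 (mag i)) • ((0, 1) : ℝ × ℝ) := by
    fin_cases i <;> simp [eu, mag, Fin.sum_univ_three]
  have h2 : (((eu 3 : Base 3 5).2 4, (eu 3 : Base 3 5).2 3
      + (eu 3 : Base 3 5).2 4 * magSq z / 2
      + z.1.2 4 * ∑ k, z.1.2 (mag k) * (eu 3 : Base 3 5).2 (mag k)) : ℝ × ℝ)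
      = ((0, 1) : ℝ × ℝ) := by
    simp [eu, mag, Fin.sum_univ_three]
  rw [h1, h2, map_smul, smul_eq_mul]
  ring

/-- A function with the derivatives of a function of the state invariants has zero derivative
along their level sets. -/
lemma fderiv_eq_zero_of_fderiv_stateInv {l : smoothFun M}
    (hx : ∀ i, (frame hM).dx i l = 0)
    (hB : ∀ i, (frame hM).dB i l = - (frame hM).σ * (frame hM).dQ l * (frame hM).B i)
    (z : M) (w : Base 3 5) (hw : fderiv ℝ stateInv z w = 0) :
    fderiv ℝ (extension l) z w = 0 := by
  have hx' : ∀ i, fderiv ℝ (extension l) z (ex i) = 0 := fun i => congrArg (ev z) (hx i)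
  have hB' : ∀ i, fderiv ℝ (extension l) z (eu (mag i))
      = z.1.2 4 * fderiv ℝ (extension l) z (eu 3) * z.1.2 (mag i) := fun i => by
    have h : ev z (dir hM (eu (mag i)) l - cu M (mag i) * dir hM (eu 3) l)
        = ev z (- (1 - cu M 4) * dir hM (eu 3) l * cu M (mag i)) := congrArg (ev z) (hB i)
    rw [map_sub, map_mul, map_mul, map_mul, map_neg, map_sub, map_one, ev_cu, ev_cu, ev_eq, ev_eq,
      dir_apply, dir_apply] at h
    linear_combination h
  rw [fderiv_stateInv] at hw
  have h4 : w.2 4 = 0 := congrArg Prod.fst hw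
  have h3 := congrArg Prod.snd hw
  simp only [h4, zero_mul, zero_div, add_zero, Prod.snd_zero] at h3
  have hv : w = ∑ i, w.1 i • ex i + (∑ k, w.2 (mag k) • eu (mag k) + w.2 3 • eu 3) := by
    refine Prod.ext ?_ ?_ <;> funext k
    · fin_cases k <;> simp [ex, eu, Fin.sum_univ_three]
    · fin_cases k <;> simp [ex, eu, Fin.sum_univ_three, mag, h4]
  rw [hv, map_add, map_add, map_sum, map_sum]
  simp only [map_smul, hx', hB', smul_eq_mul, mul_zero, Finset.sum_const_zero, zero_add]
  simp only [Fin.sum_univ_three] at h3 ⊢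
  linear_combination fderiv ℝ (extension l) z (eu 3) * h3

/-- A level set of `stateInv` is a graph over the space of `(x, B)`, parametrized by `ψ` with
inverse `π`. Its part in `M` thus becomes a preconnected open set, on which `l ∘ ψ` has zero
derivative. -/
lemma eq_of_stateInv_eq (hlev : ∀ c : ℝ × ℝ, IsPreconnected (M ∩ stateInv ⁻¹' {c}))
    {l : smoothFun M} (hx : ∀ i, (frame hM).dx i l = 0)
    (hB : ∀ i, (frame hM).dB i l = - (frame hM).σ * (frame hM).dQ l * (frame hM).B i)
    (z z' : M) (h : stateInv z = stateInv z') : ev z l = ev z' l := by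
  set c := stateInv z' with hc
  let ψ : Base 3 3 → Base 3 5 := fun y => (y.1, ![y.2 0, y.2 1, y.2 2,
    c.2 - c.1 * (y.2 0 ^ 2 + y.2 1 ^ 2 + y.2 2 ^ 2) / 2, c.1])
  let π : Base 3 5 → Base 3 3 := fun y => (y.1, ![y.2 0, y.2 1, y.2 2])
  have hψ : ContDiff ℝ ∞ ψ := by
    refine contDiff_fst.prodMk (contDiff_pi.2 fun k => ?_)
    fin_cases k <;> simp <;> fun_prop
  have hπ : Continuous π := by
    refine continuous_fst.prodMk (continuous_pi fun k => ?_)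
    fin_cases k <;> simp <;> fun_prop
  have hψπ : ∀ y, stateInv y = c → ψ (π y) = y := fun y hy => by
    refine Prod.ext rfl (funext fun k => ?_)
    fin_cases k <;> simp [ψ, π, ← hy, stateInv, magSq]
  have hinv : ∀ y, stateInv (ψ y) = c := fun y => by
    refine Prod.ext ?_ ?_ <;> simp [stateInv, ψ, magSq]
  have hU : ψ ⁻¹' M = π '' (M ∩ stateInv ⁻¹' {c}) := by
    ext y
    constructor
    · intro hy
      refine ⟨ψ y, ⟨hy, hinv y⟩, Prod.ext rfl (funext fun k => ?_)⟩
      fin_cases k <;> simp [ψ, π]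
    · rintro ⟨x, ⟨hxM, hxc⟩, rfl⟩
      rw [Set.mem_preimage, hψπ x hxc]
      exact hxM
  have hpre : IsPreconnected (ψ ⁻¹' M) := hU ▸ (hlev c).image _ hπ.continuousOn
  have hopen : IsOpen (ψ ⁻¹' M) := hM.preimage hψ.continuous
  have hd : ∀ y, DifferentiableAt ℝ ψ y := fun y => (hψ.differentiable (by simp)).differentiableAt
  have hdl : ∀ y (hy : ψ y ∈ M), DifferentiableAt ℝ (extension l) (ψ y) := fun y hy =>
    differentiableAt_extension hM l ⟨_, hy⟩
  obtain ⟨a, ha⟩ := hopen.exists_is_const_of_fderiv_eq_zero hpre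
    (f := fun y => extension l (ψ y))
    (fun y hy => ((hdl y hy).comp y (hd y)).differentiableWithinAt) (fun y hy => by
      refine ContinuousLinearMap.ext fun w => ?_
      rw [fderiv_fun_comp y (hdl y hy) (hd y)]
      refine fderiv_eq_zero_of_fderiv_stateInv hM hx hB ⟨ψ y, hy⟩ _ ?_
      have h0 : fderiv ℝ (fun y => stateInv (ψ y)) y w = 0 := by
        simp [hinv]
      rwa [fderiv_fun_comp y (contDiff_stateInv.differentiable (by simp)).differentiableAt (hd y)] at h0)
  have key : ∀ x : M, stateInv x = c → ev x l = a := fun x hxc => by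
    have := ha (π x) (by rw [Set.mem_preimage, hψπ _ hxc]; exact x.2)
    rw [hψπ _ hxc, extension_apply l x] at this
    exact this
  rw [key z h, key z' rfl]

/-- If the level sets are connected, a function with the derivatives of a function of the state
invariants is a function of the state invariants. -/
lemma exists_eq_comp_stateInv (hlev : ∀ c : ℝ × ℝ, IsPreconnected (M ∩ stateInv ⁻¹' {c}))
    {l : smoothFun M} (hx : ∀ i, (frame hM).dx i l = 0)
    (hB : ∀ i, (frame hM).dB i l = - (frame hM).σ * (frame hM).dQ l * (frame hM).B i) :
    ∃ F : ℝ × ℝ → ℝ, ContDiffOn ℝ ∞ F (stateInv '' M) ∧ ∀ z : M, F (stateInv z) = ev z l := by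
  classical
  let F : ℝ × ℝ → ℝ := fun c =>
    if h : ∃ z : M, stateInv z = c then ev h.choose l else 0
  have hF : ∀ z : M, F (stateInv z) = ev z l := fun z => by
    have h : ∃ z' : M, stateInv z' = stateInv z := ⟨z, rfl⟩
    simp only [F, dif_pos h]
    exact eq_of_stateInv_eq hM hlev hx hB _ _ h.choose_spec
  refine ⟨F, ?_, hF⟩
  rintro _ ⟨z, hz, rfl⟩
  refine ContDiffAt.contDiffWithinAt ?_
  have hs := (contDiff_stateSection z).contDiffAt (x := stateInv z)
  have hl : ContDiffAt ℝ ∞ (extension l) (stateSection z (stateInv z)) := by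
    rw [stateSection_stateInv]
    exact (contDiffOn_extension l).contDiffAt (hM.mem_nhds hz)
  -- Although `F` is defined by pointwise choice, near `stateInv z` it agrees with `l` along the
  -- smooth section through `z`.
  refine (hl.comp _ hs).congr_of_eventuallyEq ?_
  have hnear : ∀ᶠ c in nhds (stateInv z), stateSection z c ∈ M :=
    hs.continuousAt.eventually_mem (hM.mem_nhds (by rwa [stateSection_stateInv]))
  filter_upwards [hnear] with c hc
  have := hF ⟨_, hc⟩
  rw [stateInv_stateSection] at this
  rw [this, ev_eq, ← extension_apply]
  rfl

end

/-! ### The closed system -/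

/-- The infinite generators form a subspace. -/
def infSubmodule (M : Set (Base 3 5)) : Submodule ℝ (M → Base 3 5) where
  carrier := infFields M
  zero_mem' := ⟨fun _ => 0, contDiffOn_const, by funext z; simp [xInf]⟩
  add_mem' := by
    rintro _ _ ⟨F, hF, rfl⟩ ⟨G, hG, rfl⟩
    exact ⟨fun c => F c + G c, hF.add hG, by
      funext z
      simp only [Pi.add_apply, Set.domRestrict_apply, xInf, add_smul]⟩
  smul_mem' := by
    rintro a _ ⟨F, hF, rfl⟩
    refine ⟨fun c => a * F c, contDiffOn_const.mul hF, ?_⟩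
    funext z
    simp only [Pi.smul_apply, Set.domRestrict_apply, xInf, mul_smul]

lemma mem_span_union_iff (w : M → Base 3 5) :
    w ∈ Submodule.span ℝ ((Set.range fun a => M.domRestrict (generators a)) ∪ infFields M) ↔
      ∃ (c : Fin 10 → ℝ) (F : ℝ × ℝ → ℝ), ContDiffOn ℝ ∞ F (stateInv '' M) ∧
        w = M.domRestrict (normalForm c fun z => F (stateInv z)) := by
  have hspan : Submodule.span ℝ (infFields M) = infSubmodule M :=
    Submodule.span_eq (infSubmodule M)
  have hsplit : ∀ (c : Fin 10 → ℝ) (F : ℝ × ℝ → ℝ),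
      M.domRestrict (normalForm c fun z => F (stateInv z))
        = ∑ a, c a • M.domRestrict (generators a) + M.domRestrict (xInf F) := fun c F => by
    funext z
    simp [normalForm, xInf]
  rw [Submodule.span_union, hspan, Submodule.mem_sup]
  constructor
  · rintro ⟨u, hu, _, ⟨F, hF, rfl⟩, rfl⟩
    obtain ⟨c, rfl⟩ := (Submodule.mem_span_range_iff_exists_fun ℝ).1 hu
    exact ⟨c, F, hF, (hsplit c F).symm⟩
  · rintro ⟨c, F, hF, rfl⟩
    exact ⟨_, (Submodule.mem_span_range_iff_exists_fun ℝ).2 ⟨c, rfl⟩, _, ⟨F, hF, rfl⟩,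
      (hsplit c F).symm⟩

theorem span_subset_symmetryGenerators (hM : IsOpen M) :
    (Submodule.span ℝ ((Set.range fun a => M.domRestrict (generators a)) ∪ infFields M) :
      Set (M → Base 3 5)) ⊆ symmetryGenerators cglStateSystem M := by
  intro w hw
  obtain ⟨c, F, hF, rfl⟩ := (mem_span_union_iff w).1 hw
  exact ⟨_, isPointSymmetry_cglStateSystem hM
    (contDiffOn_normalForm c (contDiffOn_comp_stateInv hF))
    (solved_normalForm hM c (contDiffOn_comp_stateInv hF) (dx_comp_stateInv hM hF)
      (dB_comp_stateInv hM hF)), rfl⟩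

theorem symmetryGenerators_cglStateSystem_subset (hM : IsOpen M) (hc : IsConnected M)
    (hlev : ∀ c : ℝ × ℝ, IsPreconnected (M ∩ stateInv ⁻¹' {c})) :
    symmetryGenerators cglStateSystem M ⊆
      (Submodule.span ℝ ((Set.range fun a => M.domRestrict (generators a)) ∪ infFields M) :
        Set (M → Base 3 5)) := by
  rintro _ ⟨v, hs, rfl⟩
  obtain ⟨l, S⟩ := (stateSymmetric hM hs).solved (frame_dS_σ hM)
  obtain ⟨c, a, h⟩ := eq_normalForm hM hc hs.1 S
  obtain ⟨F, hF, hFl⟩ := exists_eq_comp_stateInv hM hlev S.dx_l S.dB_l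
  refine (mem_span_union_iff _).2 ⟨c, fun y => F y + a, hF.add contDiffOn_const, ?_⟩
  funext z
  exact h _ z (by simp only [hFl])

open Polynomial in
-- Polynomials in `τ` already give an infinite-dimensional subspace. If one yields the zero field,
-- its product with `2(1 - τ)` vanishes on the open, hence infinite, set of values of `τ` on `M`.
theorem not_finiteDimensional_infFields (hM : IsOpen M) (hne : M.Nonempty) :
    ¬ FiniteDimensional ℝ (Submodule.span ℝ (infFields M)) := by
  intro hfin
  have hsm : ∀ P : ℝ[X], ContDiff ℝ ∞ fun c : ℝ × ℝ => P.eval c.1 := fun P => by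
    simpa [Function.comp_def] using (P.contDiff_aeval (𝕜 := ℝ) ∞).comp contDiff_fst
  let φ : ℝ[X] →ₗ[ℝ] Submodule.span ℝ (infFields M) :=
    { toFun := fun P => ⟨M.domRestrict (xInf fun c => P.eval c.1),
        Submodule.subset_span ⟨_, (hsm P).contDiffOn, rfl⟩⟩
      map_add' := fun P R => by
        ext1
        funext z
        simp only [Set.domRestrict_apply, xInf, Polynomial.eval_add, add_smul, Submodule.coe_add,
          Pi.add_apply]
      map_smul' := fun a P => by
        ext1
        funext z
        simp [xInf, mul_assoc] }
  have hinj : Function.Injective φ := by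
    rw [← LinearMap.ker_eq_bot, LinearMap.ker_eq_bot']
    intro P hP
    have hz : ∀ z ∈ M, P.eval (z.2 4) * (2 * (1 - z.2 4)) = 0 := fun z hz => by
      have := congrFun (congrArg Subtype.val hP) ⟨z, hz⟩
      have := congrArg (fun y => y.2 4) this
      simpa [φ, xInf, stateInv] using this
    have hopen : IsOpen ((fun z : Base 3 5 => z.2 4) '' M) :=
      ((isOpenMap_eval (4 : Fin 5)).comp isOpenMap_snd) M hM
    have hinf : ((fun z : Base 3 5 => z.2 4) '' M).Infinite := by
      obtain ⟨y, hy⟩ := hne.image (fun z : Base 3 5 => z.2 4)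
      exact infinite_of_mem_nhds y (hopen.mem_nhds hy)
    have h0 : P * (C 2 * (1 - X)) = 0 := by
      refine Polynomial.eq_zero_of_infinite_isRoot _ (hinf.mono ?_)
      rintro _ ⟨z, hz', rfl⟩
      simpa using hz z hz'
    refine (mul_eq_zero.1 h0).resolve_right fun h => ?_
    have := congrArg (Polynomial.eval 0) h
    norm_num at this
  have : Module.Finite ℝ ℝ[X] := Module.Finite.of_injective φ hinj
  exact Polynomial.not_finite this

end CGL

end

/-! ### The static MHD system. -/

noncomputable section

open smoothFun

namespace MHD

variable {M : Set (Base 3 4)} (hM : IsOpen M) {v : Base 3 4 → Base 3 4}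

/-- The frame of the MHD system, with `σ = 1`. -/
def frame : FieldFrame (smoothFun M) :=
  fieldFrame hM mag (by decide) 3 (by decide) 0 (fun _ => rfl) 1
    (fun _ => Derivation.map_one_eq_zero _) (fun _ => Derivation.map_one_eq_zero _)
    (Derivation.map_one_eq_zero _) (fun f h => by rwa [one_mul] at h)

lemma frame_σ : (frame hM).σ = 1 := rfl

lemma frame_dS (f : smoothFun M) : (frame hM).dS f = 0 := dir_zero hM f

/-- The jet at `z` with the given derivatives of `B` and `Q = P + B² / 2`. -/
def jetAt (b : Fin 3 → Fin 3 → smoothFun M) (q : Fin 3 → smoothFun M) (z : M) : Jet 3 4 :=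
  (z, ![fun i => ev z (b 0 i), fun i => ev z (b 1 i), fun i => ev z (b 2 i),
    fun i => ev z (q i) - ∑ k, z.1.2 (mag k) * ev z (b k i)])

variable (b : Fin 3 → Fin 3 → smoothFun M) (q : Fin 3 → smoothFun M) (z : M)

lemma jetAt_mag (k i : Fin 3) : (jetAt b q z).2 (mag k) i = ev z (b k i) := by
  fin_cases k <;> rfl

lemma jetAt_pressure (i : Fin 3) :
    (jetAt b q z).2 3 i = ev z (q i) - ∑ k, z.1.2 (mag k) * ev z (b k i) := rfl

lemma jetAt_fst : (jetAt b q z).1 = z := rfl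

lemma ev_tot (g : Base 3 4 → ℝ) (hg : ContDiffOn ℝ ∞ g M) (i : Fin 3) :
    ev z ((frame hM).tot b q 0 i (mk g hg)) = totalDeriv g i (jetAt b q z) := by
  rw [jetAt, totalDeriv_eq hM g hg]
  simp [FieldFrame.tot, frame, fieldFrame, Fin.sum_univ_four, Fin.sum_univ_three, ev_cu, mag,
    ← ev_eq]
  ring

variable (hv : ContDiffOn ℝ ∞ v M)

/-- The component along the total pressure `P + B² / 2`. -/
def rho : smoothFun M := eta hv 3 + ∑ k, cu M (mag k) * eta hv (mag k)

lemma ev_div : ∑ k, (jetAt b q z).2 (mag k) k = ev z (∑ i, b i i) := by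
  simp only [jetAt_mag, map_sum]

lemma ev_force (i : Fin 3) : mhdForce (jetAt b q z) i
    = - ev z ((frame hM).residual b q i) := by
  simp only [mhdForce, FieldFrame.residual, jetAt_mag, jetAt_pressure, jetAt_fst, map_sum, map_mul,
    map_sub, frame, fieldFrame, map_one, ev_cu]
  ring

lemma ev_totalDeriv_eta (k : Fin 4) (i : Fin 3) :
    totalDeriv (fun z => (v z).2 k) i (jetAt b q z)
      = ev z ((frame hM).tot b q 0 i (eta hv k)) := (ev_tot hM b q z _ _ i).symm

lemma ev_totalDeriv_xi (a i : Fin 3) :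
    totalDeriv (fun z => (v z).1 a) i (jetAt b q z)
      = ev z ((frame hM).tot b q 0 i (xi hv a)) := (ev_tot hM b q z _ _ i).symm

lemma ev_prolong_div : ∑ k, (prolong v (jetAt b q z)).2 (mag k) k
    = ev z ((frame hM).divRes (xi hv) (fun k => eta hv (mag k)) b q 0) := by
  simp only [prolong, FieldFrame.divRes, map_sub, map_sum, map_mul, jetAt_mag,
    ev_totalDeriv_eta hM b q z hv, ev_totalDeriv_xi hM b q z hv, Finset.sum_sub_distrib]

lemma ev_prolong_force (i : Fin 3) :
    fderiv ℝ (fun j => mhdForce j i) (jetAt b q z) (prolong v (jetAt b q z))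
    = - ev z ((frame hM).forceRes (xi hv) (fun k => eta hv (mag k)) (rho hv) 0 b q 0 i) := by
  have hB : ∀ k, cu M (mag k) = (frame hM).B k := fun _ => rfl
  have hB' : ∀ k, ev z ((frame hM).B k) = z.1.2 (mag k) := fun _ => rfl
  rw [fderiv_mhdForce]
  simp only [rho, hB, FieldFrame.forceRes, FieldFrame.tot_pressure]
  simp only [map_sub, map_add, map_mul, map_zero, prolong, jetAt_mag, jetAt_pressure, jetAt_fst,
    hB', frame_σ, map_one, ev_eta, ev_totalDeriv_eta hM b q z hv, ev_totalDeriv_xi hM b q z hv,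
    Fin.sum_univ_three]
  ring

lemma jetAt_eq (j : Jet 3 4) (hj : j.1 ∈ M) :
    jetAt (fun k i => algebraMap ℝ (smoothFun M) (j.2 (mag k) i))
      (fun i => algebraMap ℝ _ (j.2 3 i + ∑ k, j.1.2 (mag k) * j.2 (mag k) i)) ⟨j.1, hj⟩ = j := by
  refine Prod.ext rfl ?_
  funext k i
  fin_cases k <;> simp [jetAt, mag]

/-- There is no variable `σ` here, so `κ = 0` and `ε = 0`, and the force balance determines the
gradient of `Q` from `∂B`. -/
lemma balanced (hs : IsPointSymmetry mhdSystem M v) :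
    (frame hM).Balanced (xi hs.1) (fun k => eta hs.1 (mag k)) (rho hs.1) 0 0 := by
  have key : ∀ (b : Fin 3 → Fin 3 → smoothFun M) (_ : ∑ i, b i i = 0) (z : M), _ :=
    fun b hb z => (fderiv_mhdSystem_eq_zero_iff _ _).1
      (hs.2 (jetAt b (fun i => (frame hM).σ * ∑ j, b i j * (frame hM).B j) z) z.2
        ((mhdSystem_eq_zero_iff _).2 ⟨by rw [ev_div, hb, map_zero],
          fun i => by rw [ev_force hM, FieldFrame.residual, sub_self, map_zero, neg_zero]⟩))
  refine ⟨fun b hb => ext_ev fun z => ?_, fun b hb m => ext_ev fun z => ?_⟩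
  · rw [← ev_prolong_div hM b _ z hs.1, (key b hb z).1, map_zero]
  · have := (key b hb z).2 m
    rw [ev_prolong_force hM b _ z hs.1, neg_eq_zero] at this
    rw [this, zero_mul, zero_mul, map_zero]

lemma isPointSymmetry_mhdSystem {l : smoothFun M}
    (S : (frame hM).Solved (xi hv) (fun k => eta hv (mag k)) (rho hv) 0 l)
    (hQ : (frame hM).dQ l = 0) : IsPointSymmetry mhdSystem M v := by
  refine ⟨hv, fun j hj hE => ?_⟩
  rw [← jetAt_eq j hj] at hE ⊢
  generalize (fun k i => algebraMap ℝ (smoothFun M) (j.2 (mag k) i)) = b at *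
  generalize (fun i => algebraMap ℝ (smoothFun M)
    (j.2 3 i + ∑ k, j.1.2 (mag k) * j.2 (mag k) i)) = q at *
  generalize (⟨j.1, hj⟩ : M) = z at *
  rw [mhdSystem_eq_zero_iff, ev_div] at hE
  rw [fderiv_mhdSystem_eq_zero_iff, ev_prolong_div hM b q z hv]
  have hR : ∀ i, ev z ((frame hM).residual b q i) = 0 := fun i => by
    have := hE.2 i
    rwa [ev_force hM, neg_eq_zero] at this
  have hl : ∑ i, (frame hM).B i * (frame hM).tot b q 0 i l = 0 := by
    rw [S.sum_B_tot_l, hQ, frame_dS, zero_mul, zero_mul, add_zero]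
  refine ⟨by rw [S.divRes_eq, hl, add_zero, map_mul, hE.1, mul_zero], fun i => ?_⟩
  rw [ev_prolong_force hM b q z hv, S.forceRes_eq, hl]
  simp [hR]

/-! ### Fields in normal form -/

lemma combination_fst (c : Fin 9 → ℝ) (z : Base 3 4) (i : Fin 3) :
    (∑ a, c a • generators a z).1 i = ![c 0, c 1, c 2] i
      + ∑ k, CGL.linearPart (c 4) (c 5) (c 6) (c 7) i k * z.1 k := by
  fin_cases i <;>
  simp [generators, Fin.sum_univ_succ, transX, transP, rot, scal₁, scal₂, infRot,
    CGL.linearPart, Matrix.vecHead, Matrix.vecTail] <;> ring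

lemma combination_mag (c : Fin 9 → ℝ) (z : Base 3 4) (i : Fin 3) :
    (∑ a, c a • generators a z).2 (mag i)
      = ∑ k, CGL.linearPart (c 4) (c 5) (c 6) (c 7) i k * z.2 (mag k)
        + (c 8 - c 7) * z.2 (mag i) := by
  fin_cases i <;>
  simp [generators, Fin.sum_univ_succ, transX, transP, rot, scal₁, scal₂, infRot,
    CGL.linearPart, mag] <;> ring

lemma combination_pressure (c : Fin 9 → ℝ) (z : Base 3 4) :
    (∑ a, c a • generators a z).2 3 = c 3 + 2 * c 8 * z.2 3 := by
  simp [generators, Fin.sum_univ_succ, transX, transP, rot, scal₁, scal₂]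
  ring

lemma contDiffOn_combination (c : Fin 9 → ℝ) :
    ContDiffOn ℝ ∞ (fun z => ∑ a, c a • generators a z) M := by
  have h1 : ContDiffOn ℝ ∞ (fun z => (∑ a, c a • generators a z).1) M := by
    refine contDiffOn_pi.2 fun i => ?_
    simp only [combination_fst]
    fun_prop
  have h2 : ContDiffOn ℝ ∞ (fun z => (∑ a, c a • generators a z).2) M := by
    have hm : ∀ i, ContDiffOn ℝ ∞ (fun z => (∑ a, c a • generators a z).2 (mag i)) M := fun i => by
      simp only [combination_mag]
      fun_prop
    refine contDiffOn_pi.2 fun i => ?_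
    fin_cases i
    · exact hm 0
    · exact hm 1
    · exact hm 2
    · simp only [Fin.reduceFinMk, combination_pressure]
      fun_prop
  exact h1.prodMk h2

/-- The total pressure `P + B² / 2`. -/
def totalPressure (M : Set (Base 3 4)) : smoothFun M :=
  cu M 3 + algebraMap ℝ _ 2⁻¹ * ∑ k, cu M (mag k) ^ 2

lemma ev_totalPressure (z : M) : ev z (totalPressure M)
    = z.1.2 3 + (z.1.2 0 ^ 2 + z.1.2 1 ^ 2 + z.1.2 2 ^ 2) / 2 := by
  simp [totalPressure, ev_cu, Fin.sum_univ_three, mag]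
  ring

lemma frame_dx_cx (i a : Fin 3) : (frame hM).dx i (cx M a) = if i = a then 1 else 0 := by
  rcases eq_or_ne i a with rfl | h
  · simp [frame, fieldFrame, dir_cx, ex]
  · simp [frame, fieldFrame, dir_cx, ex, h, h.symm]

lemma frame_dB_cx (i a : Fin 3) : (frame hM).dB i (cx M a) = 0 := by
  simp [frame, fieldFrame, dir_cx, eu]

lemma frame_dQ_cx (a : Fin 3) : (frame hM).dQ (cx M a) = 0 := by
  simp [frame, fieldFrame, dir_cx, eu]

lemma frame_dx_totalPressure (i : Fin 3) : (frame hM).dx i (totalPressure M) = 0 := by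
  simp [frame, fieldFrame, totalPressure, dir_cu, ex, Derivation.leibniz_pow]

lemma frame_dB_totalPressure (i : Fin 3) : (frame hM).dB i (totalPressure M) = 0 := by
  have h2 : algebraMap ℝ (smoothFun M) 2⁻¹ * 2 = 1 := by
    rw [← map_ofNat (algebraMap ℝ (smoothFun M)) 2, ← map_mul]; norm_num
  fin_cases i <;>
  simp [frame, fieldFrame, totalPressure, dir_cu, eu, Derivation.leibniz_pow, Fin.sum_univ_three,
    mag, ← mul_assoc, h2]

lemma frame_dQ_totalPressure : (frame hM).dQ (totalPressure M) = 1 := by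
  simp [frame, fieldFrame, totalPressure, dir_cu, eu, Derivation.leibniz_pow, Fin.sum_univ_three,
    mag]

lemma frame_exists_const (hc : IsConnected M) (f : smoothFun M)
    (hx : ∀ i, (frame hM).dx i f = 0) (hB : ∀ i, (frame hM).dB i f = 0)
    (hQ : (frame hM).dQ f = 0) : ∃ c : ℝ, f = algebraMap ℝ (smoothFun M) c := by
  have hQ' : dir hM (eu 3) f = 0 := hQ
  have hB' : ∀ i, dir hM (eu (mag i)) f = 0 := fun i => by
    have : dir hM (eu (mag i)) f - cu M (mag i) * dir hM (eu 3) f = 0 := hB i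
    rwa [hQ', mul_zero, sub_zero] at this
  refine exists_const hM hc f hx fun k => ?_
  fin_cases k
  · exact hB' 0
  · exact hB' 1
  · exact hB' 2
  · exact hQ'

lemma ev_rho (z : M) :
    ev z (rho hv) = (v z).2 3 + ∑ k, z.1.2 (mag k) * (v z).2 (mag k) := by
  simp [rho, ev_eta, ev_cu]

lemma solved_combination (c : Fin 9 → ℝ) :
    (frame hM).Solved (xi (contDiffOn_combination c))
      (fun k => eta (contDiffOn_combination c) (mag k)) (rho (contDiffOn_combination c))
      0 (algebraMap ℝ _ (c 8 - c 7)) := by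
  have hB' : ∀ z k, ev z ((frame hM).B k) = z.1.2 (mag k) := fun _ _ => rfl
  refine FieldFrame.Solved.of_constants (cx M) (totalPressure M) (frame_dx_cx hM) (frame_dB_cx hM)
    (frame_dQ_cx hM) (fun _ => frame_dS hM _) (frame_dx_totalPressure hM)
    (frame_dB_totalPressure hM) (frame_dQ_totalPressure hM) (frame_dS hM _) ![c 0, c 1, c 2]
    (CGL.linearPart (c 4) (c 5) (c 6) (c 7)) (2 * c 8) (c 3) (CGL.linearPart_ne _ _ _ _)
    (fun i j => by rw [CGL.linearPart_self, CGL.linearPart_self]) (fun a => ext_ev fun z => ?_)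
    (ext_ev fun z => ?_) (fun j => ext_ev fun z => ?_) (ext_ev fun z => ?_) (fun i => ?_)
    (fun i => ?_)
  · simp only [ev_xi, combination_fst, map_add, map_sum, map_mul, AlgHom.commutes, ev_cx,
      Algebra.algebraMap_self, RingHom.id_apply]
  · rw [ev_rho]
    simp only [combination_pressure, combination_mag, map_add, map_mul, AlgHom.commutes,
      ev_totalPressure, Algebra.algebraMap_self, RingHom.id_apply]
    simp [Fin.sum_univ_three, mag, CGL.linearPart]
    ring
  · simp only [ev_eta, combination_mag, map_add, map_sum, map_mul, AlgHom.commutes, hB',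
      Algebra.algebraMap_self, RingHom.id_apply]
  · simp only [map_zero, frame_σ, map_sub, map_mul, AlgHom.commutes, map_one,
      Algebra.algebraMap_self, RingHom.id_apply, map_ofNat, CGL.linearPart_self]
    ring
  · rw [Derivation.map_algebraMap]
  · rw [Derivation.map_algebraMap, Derivation.map_algebraMap, mul_zero, zero_mul]

/-- A solution of the determining equations is a combination of the generators. -/
lemma eq_combination (hc : IsConnected M) {l : smoothFun M}
    (S : (frame hM).Solved (xi hv) (fun k => eta hv (mag k)) (rho hv) 0 l)
    (hQ : (frame hM).dQ l = 0) :
    ∃ c : Fin 9 → ℝ, ∀ z : M, v z = ∑ a, c a • generators a z := by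
  obtain ⟨K, X, r, r₀, hξ, hX, hρ, hr⟩ := S.integrate (cx M) (totalPressure M)
    (fun f hx hB hQ _ => frame_exists_const hM hc f hx hB hQ) (frame_dx_cx hM) (frame_dB_cx hM)
    (frame_dQ_cx hM) (fun _ => frame_dS hM _) (frame_dx_totalPressure hM)
    (frame_dB_totalPressure hM) (frame_dQ_totalPressure hM) (frame_dS hM _)
  obtain ⟨a, ha⟩ := frame_exists_const hM hc l S.dx_l
    (fun i => by rw [S.dB_l, hQ, mul_zero, zero_mul]) hQ
  obtain ⟨z₀, hz₀⟩ := hc.nonempty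
  have hXne : ∀ i k, i ≠ k → X i k + X k i = 0 := fun i k hik => by
    have := congrArg (ev ⟨z₀, hz₀⟩) (S.killing_ne i k hik)
    simpa [hX] using this
  have hXself : ∀ i, X i i = X 0 0 := fun i => by
    have := congrArg (ev ⟨z₀, hz₀⟩) (S.killing_self i 0)
    simpa [hX] using this
  have hXL : X = CGL.linearPart (X 2 1) (X 0 1) (X 0 2) (X 0 0) := by
    funext i k
    fin_cases i <;> fin_cases k <;> simp [CGL.linearPart]
    · linarith [hXne 0 1 (by decide)]
    · exact hXself 1
    · linarith [hXne 1 2 (by decide)]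
    · linarith [hXne 0 2 (by decide)]
    · exact hXself 2
  have hB' : ∀ z k, ev z ((frame hM).B k) = z.1.2 (mag k) := fun _ _ => rfl
  -- The vanishing of `κ` ties the scaling of the pressure to that of `B`: the factor for `B` is `X
  -- 0 0 + a` and that for `P` is twice as large. This is `scal₂`, and no analogue of the third CGL
  -- scaling remains.
  have hra : r = 2 * X 0 0 + 2 * a := by
    have h := congrArg (ev ⟨z₀, hz₀⟩) S.κ_eq
    simp only [map_zero, frame_σ, map_one, map_mul, map_sub, hr, hX, ha, AlgHom.commutes, map_ofNat,
      Algebra.algebraMap_self, RingHom.id_apply] at h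
    linear_combination -h
  refine ⟨![K 0, K 1, K 2, r₀, X 2 1, X 0 1, X 0 2, X 0 0, X 0 0 + a], fun z => ?_⟩
  have hβ : ∀ k, (v z).2 (mag k) = ∑ i, X k i * z.1.2 (mag i) + a * z.1.2 (mag k) :=
    fun k => by
      have := congrArg (ev z) (S.β_eq k)
      simpa [hX, hB', ev_eta, ha] using this
  have hp := congrArg (ev z) hρ
  rw [ev_rho] at hp
  simp only [map_add, map_mul, AlgHom.commutes, Algebra.algebraMap_self, RingHom.id_apply,
    ev_totalPressure, hβ] at hp
  have hmag : ∀ k, (v z).2 (mag k) = (∑ i, (![K 0, K 1, K 2, r₀, X 2 1, X 0 1, X 0 2, X 0 0,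
      X 0 0 + a] : Fin 9 → ℝ) i • generators i z.1).2 (mag k) := fun k => by
    rw [hβ, combination_mag]
    simp only [Matrix.cons_val]
    rw [← hXL]
    ring
  refine Prod.ext (funext fun i => ?_) (funext fun k => ?_)
  · have := congrArg (ev z) (hξ i)
    simp only [ev_xi, map_add, map_sum, map_mul, AlgHom.commutes, ev_cx,
      Algebra.algebraMap_self, RingHom.id_apply] at this
    rw [this, combination_fst]
    simp only [Matrix.cons_val]
    rw [← hXL]
    congr 1
    fin_cases i <;> rfl
  · fin_cases k
    · exact hmag 0
    · exact hmag 1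
    · exact hmag 2
    · simp only [Fin.reduceFinMk, combination_pressure]
      simp only [Fin.sum_univ_three, mag, Matrix.cons_val] at hp ⊢
      rw [hra] at hp
      linear_combination hp - z.1.2 0 * z.1.2 1 * hXne 0 1 (by decide)
        - z.1.2 0 * z.1.2 2 * hXne 0 2 (by decide) - z.1.2 1 * z.1.2 2 * hXne 1 2 (by decide)
        - z.1.2 1 ^ 2 * hXself 1 - z.1.2 2 ^ 2 * hXself 2

lemma domRestrict_combination (c : Fin 9 → ℝ) :
    M.domRestrict (fun z => ∑ a, c a • generators a z)
      = ∑ a, c a • M.domRestrict (generators a) := by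
  funext z
  simp

theorem symmetryGenerators_mhdSystem (hM : IsOpen M) (hc : IsConnected M) :
    symmetryGenerators mhdSystem M
      = (Submodule.span ℝ (Set.range fun a => M.domRestrict (generators a)) :
          Set (M → Base 3 4)) := by
  ext w
  rw [SetLike.mem_coe, Submodule.mem_span_range_iff_exists_fun]
  constructor
  · rintro ⟨v, hs, rfl⟩
    obtain ⟨l, S, hQ⟩ := (balanced hM hs).solved_of_const (frame_σ hM) (frame_dS hM)
    obtain ⟨c, h⟩ := eq_combination hM hs.1 hc S hQ
    refine ⟨c, ?_⟩
    rw [← domRestrict_combination]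
    funext z
    exact (h z).symm
  · rintro ⟨c, rfl⟩
    rw [← domRestrict_combination]
    exact ⟨_, isPointSymmetry_mhdSystem hM (contDiffOn_combination c) (solved_combination hM c)
      (Derivation.map_algebraMap _ _), rfl⟩

theorem linearIndependent_generators (hM : IsOpen M) (hc : IsConnected M) :
    LinearIndependent ℝ (fun a => M.domRestrict (generators a)) := by
  obtain ⟨z₀, hz₀⟩ := hc.nonempty
  rw [Fintype.linearIndependent_iff]
  intro c h
  rw [← domRestrict_combination] at h
  have hz : ∀ z : M, ∑ a, c a • generators a z = 0 := fun z => congrFun h z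
  have hreal : ∀ r : ℝ, algebraMap ℝ (smoothFun M) r = 0 → r = 0 := fun r hr => by
    simpa using congrArg (ev ⟨z₀, hz₀⟩) hr
  have hξ : ∀ a, algebraMap ℝ (smoothFun M) (![c 0, c 1, c 2] a)
      + ∑ i, algebraMap ℝ _ (CGL.linearPart (c 4) (c 5) (c 6) (c 7) a i) * cx M i = 0 := fun a =>
    ext_ev fun z => by
      have := congrArg (fun y => y.1 a) (hz z)
      simp only [combination_fst] at this
      simpa [ev_cx] using this
  have hX : ∀ a i, CGL.linearPart (c 4) (c 5) (c 6) (c 7) a i = 0 := fun a i => hreal _ (by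
    have := congrArg ((frame hM).dx i) (hξ a)
    simpa only [map_add, map_sum, Derivation.leibniz, Derivation.map_algebraMap, frame_dx_cx,
      smul_zero, add_zero, zero_add, map_zero, smul_eq_mul, mul_ite, mul_one, mul_zero,
      Finset.sum_ite_eq, Finset.mem_univ, if_true] using this)
  have hK : ∀ a, ![c 0, c 1, c 2] a = 0 := fun a => hreal _ (by
    have := hξ a
    simpa only [hX, map_zero, zero_mul, Finset.sum_const_zero, add_zero] using this)
  have h7 : c 7 = 0 := hX 0 0
  have h8 : c 8 = 0 := hreal _ (by
    have h1 : algebraMap ℝ (smoothFun M) (c 8) * (frame hM).B 0 = 0 := ext_ev fun z => by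
      have := congrArg (fun y => y.2 (mag 0)) (hz z)
      simp only [combination_mag, hX] at this
      simp only [h7, zero_mul, Finset.sum_const_zero, zero_add, sub_zero] at this
      rw [map_mul, AlgHom.commutes, map_zero]
      exact this
    have h2 := congrArg ((frame hM).dB 0) h1
    simpa only [Derivation.leibniz, Derivation.map_algebraMap, (frame hM).dB_B_self, smul_eq_mul,
      mul_one, mul_zero, add_zero, map_zero] using h2)
  have h3 : c 3 = 0 := by
    have := congrArg (fun y => y.2 3) (hz ⟨z₀, hz₀⟩)
    simp only [combination_pressure, h8] at this
    simpa using this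
  intro a
  fin_cases a
  exacts [hK 0, hK 1, hK 2, h3, hX 2 1, hX 0 1, hX 0 2, h7, h8]

end MHD

end

theorem theorem1 :
    (∀ M : Set (Base 3 5), IsOpen M → IsConnected M →
      symmetryGenerators cglSystem M =
          (Submodule.span ℝ (Set.range fun a => M.domRestrict (CGL.generators a)) :
            Set (M → Base 3 5)) ∧
        LinearIndependent ℝ (fun a => M.domRestrict (CGL.generators a))) ∧
    (∀ M : Set (Base 3 5), IsOpen M → IsConnected M →
      (Submodule.span ℝ
            ((Set.range fun a => M.domRestrict (CGL.generators a)) ∪ CGL.infFields M) :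
          Set (M → Base 3 5)) ⊆ symmetryGenerators cglStateSystem M ∧
        ¬ FiniteDimensional ℝ (Submodule.span ℝ (CGL.infFields M)) ∧
        ((∀ c : ℝ × ℝ, IsPreconnected (M ∩ CGL.stateInv ⁻¹' {c})) →
          symmetryGenerators cglStateSystem M =
            (Submodule.span ℝ
                ((Set.range fun a => M.domRestrict (CGL.generators a)) ∪ CGL.infFields M) :
              Set (M → Base 3 5)))) ∧
    (∀ M : Set (Base 3 4), IsOpen M → IsConnected M →
      symmetryGenerators mhdSystem M =
          (Submodule.span ℝ (Set.range fun a => M.domRestrict (MHD.generators a)) :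
            Set (M → Base 3 4)) ∧
        LinearIndependent ℝ (fun a => M.domRestrict (MHD.generators a))) := by
  refine ⟨fun M hM hc => ⟨CGL.symmetryGenerators_cglSystem hM hc,
      CGL.linearIndependent_generators hM hc⟩,
    fun M hM hc => ⟨CGL.span_subset_symmetryGenerators hM,
      CGL.not_finiteDimensional_infFields hM hc.nonempty, fun hlev =>
        (CGL.symmetryGenerators_cglStateSystem_subset hM hc hlev).antisymm
          (CGL.span_subset_symmetryGenerators hM)⟩,
    fun M hM hc => ⟨MHD.symmetryGenerators_mhdSystem hM hc,
      MHD.linearIndependent_generators hM hc⟩⟩
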